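/- Let $K$ be a compact (smooth, boundaryless) Riemannian manifold, with no assumption on its curvature, let $I=[0,1]$, and let $\pi_1:K\times I\to K$ and $\pi_2:K\times I\to I$ be the projections. Let $\mathcal F$ be a foliated $I$-bundle structure on $K\times I$, that is, a continuous codimension-one foliation of $K\times I$ that is transverse to the fibers $\{q\}\times I$, such that the restriction of $\pi_1$ to each leaf is a covering of $K$ and such that $K\times\{0\}$ and $K\times\{1\}$ are unions of leaves. Give the leaves the smooth structure and the Riemannian metric pulled back from $K$ by $\pi_1$, so that these coverings are Riemannian coverings. Suppose that 1. $\mathcal F$ is a harmonic foliation: the height function $\pi_2$ is leafwise harmonic, i.e. its restriction to each leaf is $C^2$ and satisfies $\Delta\pi_2=0$ for the Laplace–Beltrami operator $\Delta$ of the leaf (equivalently, the leaves are locally graphs of harmonic functions on open subsets of $K$); 2. $\mathcal F$ is Lipschitz continuous: every point of $K\times I$ has a neighborhood in which the holonomy maps of $\mathcal F$ between fibers $\{q\}\times I$ and $\{q'\}\times I$, given by sliding along plaques, are Lipschitz with a constant independent of $q$ and $q'$. Then $\mathcal F$ is the product foliation: its leaves are the sets $K'\times\{t\}$ with $K'$ a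 connected component of $K$ and $t\in I$ (thus the sets $K\times\{t\}$ if $K$ is connected). -/

import Mathlib

open Bundle
open scoped Manifold ContDiff Topology NNReal

noncomputable section

/-! ### The Laplace-Beltrami operator and harmonic functions -/

section Harmonic

variable {n : ℕ} {K : Type*} [TopologicalSpace K] [ChartedSpace (EuclideanSpace ℝ (Fin n)) K]
  [IsManifold (𝓡 n) ∞ K] [RiemannianBundle (fun x : K ↦ TangentSpace (𝓡 n) x)]

/-- The matrix `g i j = ⟪∂ᵢ, ∂ⱼ⟫` of the Riemannian metric in the chart `c`, at the point with
coordinates `y`. -/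
def metricMatrix (c : OpenPartialHomeomorph K (EuclideanSpace ℝ (Fin n)))
    (y : EuclideanSpace ℝ (Fin n)) : Matrix (Fin n) (Fin n) ℝ :=
  Matrix.of fun i j ↦
    inner ℝ (mfderiv (𝓡 n) (𝓡 n) c.symm y (EuclideanSpace.single i (1 : ℝ)))
      (mfderiv (𝓡 n) (𝓡 n) c.symm y (EuclideanSpace.single j (1 : ℝ)))

/-- The density `√(det g)` of the Riemannian volume in the chart `c`. -/
def volDensity (c : OpenPartialHomeomorph K (EuclideanSpace ℝ (Fin n)))
    (y : EuclideanSpace ℝ (Fin n)) : ℝ :=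
  Real.sqrt (metricMatrix c y).det

/-- The Laplace-Beltrami operator in the chart `c`:
`Δ u = (det g)^(-1/2) ∑ i, ∂ᵢ ((det g)^(1/2) ∑ j, gⁱʲ ∂ⱼ u)`, at the point with coordinates `y`. -/
def laplaceBeltrami (c : OpenPartialHomeomorph K (EuclideanSpace ℝ (Fin n))) (u : K → ℝ)
    (y : EuclideanSpace ℝ (Fin n)) : ℝ :=
  (volDensity c y)⁻¹ *
    ∑ i, fderiv ℝ
      (fun z ↦ volDensity c z *
        ∑ j, (metricMatrix c z)⁻¹ i j *
          fderiv ℝ (u ∘ c.symm) z (EuclideanSpace.single j (1 : ℝ)))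
      y (EuclideanSpace.single i (1 : ℝ))

/-- `u` is harmonic on the open set `U`: it is `C²` there and `Δ u = 0` on `U`
(computed in the charts of the atlas). -/
def IsHarmonicOn (u : K → ℝ) (U : Set K) : Prop :=
  ContMDiffOn (𝓡 n) 𝓘(ℝ, ℝ) 2 u U ∧
    ∀ c ∈ atlas (EuclideanSpace ℝ (Fin n)) K, ∀ x ∈ U ∩ c.source, laplaceBeltrami c u (c x) = 0

end Harmonic

/-! ### Foliations -/

/-- A continuous foliation of `X`, with leaves modelled on `B` and transversals modelled on `T`:
an atlas of charts with values in `B × T` whose changes of charts have locally the form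
`(x, y) ↦ (f x y, g y)`. -/
structure Foliation (B T X : Type*) [TopologicalSpace B] [TopologicalSpace T]
    [TopologicalSpace X] where
  /-- The foliation charts. -/
  charts : Set (OpenPartialHomeomorph X (B × T))
  cover : ∀ x, ∃ e ∈ charts, x ∈ e.source
  compatible : ∀ e ∈ charts, ∀ e' ∈ charts, ∀ x ∈ e.source ∩ e'.source,
    ∃ U ∈ 𝓝 x, ∀ y ∈ U, ∀ z ∈ U, (e y).2 = (e z).2 → (e' y).2 = (e' z).2

namespace Foliation

variable {B T X : Type*} [TopologicalSpace B] [TopologicalSpace T] [TopologicalSpace X]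

/-- The leaf topology, generated by the open subsets of the plaques. -/
@[reducible]
def leafTopology (F : Foliation B T X) : TopologicalSpace X :=
  TopologicalSpace.generateFrom
    {s | ∃ e ∈ F.charts, ∃ V : Set B, IsOpen V ∧ ∃ y : T, s = e.source ∩ e ⁻¹' (V ×ˢ {y})}

/-- The leaf through `x`: its connected component in the leaf topology. -/
def leaf (F : Foliation B T X) (x : X) : Set X :=
  @connectedComponent X F.leafTopology x

end Foliation

section Bundle

variable {n : ℕ} {K : Type*} [TopologicalSpace K]

/-- A foliated `I`-bundle structure on `π₁ : K × I → K`, `I = [0, 1]`: a codimension one foliation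
of `K × I` that is transverse to the fibers `{q} × I`, such that `π₁` restricted to each leaf is a
covering of `K` and the boundary components `K × {0}` and `K × {1}` are saturated by leaves.
The leaves carry the smooth structure and the metric that make these coverings Riemannian, that is,
those pulled back from `K` by `π₁`. -/
structure IsFoliatedIBundle (F : Foliation (EuclideanSpace ℝ (Fin n)) unitInterval (K × unitInterval)) : Prop where
  /-- Near every point, `π₁` and the transverse coordinate of a foliation chart form together
  a topological chart, in which leaves are horizontal and fibers are vertical. -/
  transverse : ∀ e ∈ F.charts,
    IsLocalHomeomorphOn (fun p : K × unitInterval ↦ ((p.1, (e p).2) : K × unitInterval)) e.source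
  covering : ∀ p : K × unitInterval,
    letI : TopologicalSpace (F.leaf p) := F.leafTopology.induced Subtype.val
    IsCoveringMap (fun x : F.leaf p ↦ (x : K × unitInterval).1)
  boundary_zero : ∀ q : K, ∀ p ∈ F.leaf (q, 0), p.2 = 0
  boundary_one : ∀ q : K, ∀ p ∈ F.leaf (q, 1), p.2 = 1

/-- `f` is leafwise harmonic: it is continuous, and its restriction to each leaf is harmonic for the
pulled back metric, i.e. harmonic on `U` when composed with any section `τ` of `π₁` over an open set
`U` of `K` that is continuous for the leaf topology (the local inverses of the restrictions of `π₁`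
to the leaves). -/
def IsLeafwiseHarmonic [ChartedSpace (EuclideanSpace ℝ (Fin n)) K] [IsManifold (𝓡 n) ∞ K]
    [RiemannianBundle (fun x : K ↦ TangentSpace (𝓡 n) x)]
    (F : Foliation (EuclideanSpace ℝ (Fin n)) unitInterval (K × unitInterval)) (f : K × unitInterval → ℝ) : Prop :=
  Continuous f ∧
    ∀ (U : Set K) (τ : K → K × unitInterval), IsOpen U → (∀ q ∈ U, (τ q).1 = q) →
      @ContinuousOn K (K × unitInterval) _ F.leafTopology τ U → IsHarmonicOn (n := n) (f ∘ τ) U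

/-- A harmonic foliation of `K × I`: a foliated `I`-bundle whose height function `π₂` is leafwise
harmonic. -/
def IsHarmonicFoliation [ChartedSpace (EuclideanSpace ℝ (Fin n)) K] [IsManifold (𝓡 n) ∞ K]
    [RiemannianBundle (fun x : K ↦ TangentSpace (𝓡 n) x)]
    (F : Foliation (EuclideanSpace ℝ (Fin n)) unitInterval (K × unitInterval)) : Prop :=
  IsFoliatedIBundle F ∧ IsLeafwiseHarmonic F (fun p ↦ (p.2 : ℝ))

/-- The holonomy is Lipschitz: near every point the holonomy maps between pieces of fibers
`{q} × I` and `{q'} × I` that slide points along plaques are Lipschitz, locally uniformly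
in `q`, `q'`. -/
def IsLipschitzFoliation (F : Foliation (EuclideanSpace ℝ (Fin n)) unitInterval (K × unitInterval)) : Prop :=
  ∀ e ∈ F.charts, ∀ p ∈ e.source, ∃ U ∈ 𝓝 p, ∃ C : ℝ≥0, ∀ (q q' : K) (s t s' t' : unitInterval),
    (q, s) ∈ U → (q, t) ∈ U → (q', s') ∈ U → (q', t') ∈ U →
    (e (q, s)).2 = (e (q', s')).2 → (e (q, t)).2 = (e (q', t')).2 →
    dist s' t' ≤ C * dist s t

/-- The product foliation: the leaves are the sets `K' × {t}`, with `K'` a connected component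
of `K` (so `K × {t}` when `K` is connected). -/
def IsProductFoliation (F : Foliation (EuclideanSpace ℝ (Fin n)) unitInterval (K × unitInterval)) : Prop :=
  ∀ (q : K) (t : unitInterval), F.leaf (q, t) = connectedComponent q ×ˢ {t}

end Bundle

end

/-! Let `a(q, s)` be the leafwise differential of the height at the point `(q, s)`. Leaves are
locally graphs of functions `u` with `du = a(·, u)`, so if `a` were smooth, harmonicity would read
`div a + ½ ∂ₛ|a|² = 0`. The boundary leaves are horizontal, so `a = 0` at `s = 0` and `s = 1`.
Testing this equation against `s ψ(q)` and integrating by parts gives `∫∫ (s ⟪dψ, a⟫ + ½ ψ |a|²) ds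
dvol = 0`. Summing over a partition of unity, whose differentials add up to zero, leaves `∫∫ |a|² =
0`. Hence `a` vanishes almost everywhere and the leaves are horizontal. Curvature never enters.

The difficulty is that `a` need not be differentiable in `s`; Lipschitz holonomy makes up for it.
Compactness of the fiber and uniqueness of leaves give boxes in which the leaves are graphs `h · t`,
bi-Lipschitz in `t` (`IsFoliatedIBundle.exists_isFoliatedBox`). Differences `h · t - h · s` are
harmonic of size `O(|t - s|)`, so Caccioppoli's inequality makes their differentials `O(|t - s|)` in
`L²` on compact sets.

The identity is therefore proved by discretization. The fiber is cut at the heights `h y (i / N)`,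
and on each slab the integrand is replaced by an average of the differentials at its two boundary
graphs. The average is chosen so that Green's formula turns the slab integrals into a telescoping
sum with zero end terms (`integral_stepIntegral`, `integral_sum_stepIntegral`). The `L¹` error is
`O(1 / N)`, which gives `integral_leafDensity`.

Multiplying by a second partition function moves the local identities between charts without a
measure on `K`, and yields `ae_leafEnergy_eq_zero`. Finally, Lipschitz holonomy carries null sets of
heights to null sets of parameters `t`, and continuity removes the exceptional sets
(`eq_of_ae_eq_zero`). -/

open Filter Set MeasureTheory

/-! ### The leaf topology and its continuous sections -/

namespace Foliation

variable {B T X : Type*} [TopologicalSpace B] [TopologicalSpace T] [TopologicalSpace X]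

/-- By compatibility, the plaque of `e` through `x` stays, near `x`, inside the plaque of any other
chart. The generating sets from all charts thus give nothing finer than the trace of the ordinary
topology on this one plaque. -/
theorem nhds_leafTopology (F : Foliation B T X) {e : OpenPartialHomeomorph X (B × T)}
    (he : e ∈ F.charts) {x : X} (hx : x ∈ e.source) :
    @nhds X F.leafTopology x = 𝓝[{y | (e y).2 = (e x).2}] x := by
  apply le_antisymm
  · refine le_inf ?_ ?_
    · intro s hs
      obtain ⟨O, hOs, hO, hxO⟩ := mem_nhds_iff.1 hs
      have h1 : IsOpen (e '' (e.source ∩ O)) := e.isOpen_image_source_inter hO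
      have h2 : e x ∈ e '' (e.source ∩ O) := ⟨x, ⟨hx, hxO⟩, rfl⟩
      obtain ⟨V, W, hV, hW, hxV, hxW, hVW⟩ := isOpen_prod_iff.1 h1 (e x).1 (e x).2 h2
      rw [TopologicalSpace.nhds_generateFrom]
      have hmem : (e.source ∩ e ⁻¹' (V ×ˢ {(e x).2})) ∈
          {s | x ∈ s ∧ s ∈ {s | ∃ e ∈ F.charts, ∃ V : Set B, IsOpen V ∧ ∃ y : T,
            s = e.source ∩ e ⁻¹' (V ×ˢ {y})}} :=
        ⟨⟨hx, hxV, rfl⟩, e, he, V, hV, _, rfl⟩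
      refine mem_of_superset (mem_iInf_of_mem _ (mem_iInf_of_mem hmem (mem_principal_self _))) ?_
      rintro y ⟨hy, hyV, hyW⟩
      have : e y ∈ V ×ˢ W := ⟨hyV, by rw [mem_singleton_iff.1 hyW]; exact hxW⟩
      obtain ⟨z, ⟨hz, hzO⟩, hzy⟩ := hVW this
      rw [e.injOn hz hy hzy] at hzO
      exact hOs hzO
    · rw [TopologicalSpace.nhds_generateFrom]
      have hmem : (e.source ∩ e ⁻¹' (univ ×ˢ {(e x).2})) ∈
          {s | x ∈ s ∧ s ∈ {s | ∃ e ∈ F.charts, ∃ V : Set B, IsOpen V ∧ ∃ y : T,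
            s = e.source ∩ e ⁻¹' (V ×ˢ {y})}} :=
        ⟨⟨hx, mem_univ _, rfl⟩, e, he, _, isOpen_univ, _, rfl⟩
      refine (iInf₂_le _ hmem).trans (principal_mono.2 ?_)
      rintro y ⟨-, -, hy⟩
      exact hy
  · rw [TopologicalSpace.nhds_generateFrom]
    refine le_iInf₂ ?_
    rintro s ⟨hxs, e', he', V, hV, y, rfl⟩
    obtain ⟨U, hU, hUc⟩ := F.compatible e he e' he' x ⟨hx, hxs.1⟩
    rw [le_principal_iff]
    have h1 : e'.source ∩ e' ⁻¹' (V ×ˢ univ) ∈ 𝓝 x :=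
      (e'.isOpen_inter_preimage (hV.prod isOpen_univ)).mem_nhds ⟨hxs.1, hxs.2.1, mem_univ _⟩
    filter_upwards [inter_mem_inf (inter_mem hU h1) (mem_principal_self _)]
    rintro z ⟨⟨hzU, hz, hzV, -⟩, hze⟩
    refine ⟨hz, hzV, ?_⟩
    rw [mem_singleton_iff, hUc z hzU x (mem_of_mem_nhds hU) hze]
    exact hxs.2.2

theorem leafTopology_le (F : Foliation B T X) : F.leafTopology ≤ ‹TopologicalSpace X› := by
  refine (le_iff_nhds _ _).2 fun x ↦ ?_
  obtain ⟨e, he, hx⟩ := F.cover x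
  rw [F.nhds_leafTopology he hx]
  exact inf_le_left

/-- `τ` restricted to `U` is continuous for the leaf topology. -/
def LeafContinuousOn {K : Type*} [TopologicalSpace K] (F : Foliation B T X) (τ : K → X)
    (U : Set K) : Prop :=
  @ContinuousOn K X _ F.leafTopology τ U

theorem LeafContinuousOn.continuousOn {K : Type*} [TopologicalSpace K] {F : Foliation B T X}
    {τ : K → X} {U : Set K} (h : F.LeafContinuousOn τ U) : ContinuousOn τ U :=
  fun q hq ↦ (h q hq).mono_right ((le_iff_nhds _ _).1 F.leafTopology_le _)

theorem LeafContinuousOn.eventually_eq {K : Type*} [TopologicalSpace K] {F : Foliation B T X}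
    {τ : K → X} {U : Set K} (h : F.LeafContinuousOn τ U) {q : K} (hq : q ∈ U)
    {e : OpenPartialHomeomorph X (B × T)} (he : e ∈ F.charts) (hx : τ q ∈ e.source) :
    ∀ᶠ q' in 𝓝[U] q, (e (τ q')).2 = (e (τ q)).2 := by
  have h1 : Tendsto τ (𝓝[U] q) (@nhds X F.leafTopology (τ q)) := h q hq
  rw [F.nhds_leafTopology he hx] at h1
  exact h1.eventually (eventually_mem_nhdsWithin)

theorem leafContinuousOn_of {K : Type*} [TopologicalSpace K] {F : Foliation B T X}
    {τ : K → X} {U : Set K} (hc : ContinuousOn τ U)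
    (h : ∀ q ∈ U, ∃ e ∈ F.charts, τ q ∈ e.source ∧
      ∀ᶠ q' in 𝓝[U] q, (e (τ q')).2 = (e (τ q)).2) : F.LeafContinuousOn τ U := by
  intro q hq
  obtain ⟨e, he, hx, hev⟩ := h q hq
  change Tendsto τ (𝓝[U] q) (@nhds X F.leafTopology (τ q))
  rw [F.nhds_leafTopology he hx]
  exact tendsto_inf.2 ⟨hc q hq, tendsto_principal.2 hev⟩

theorem LeafContinuousOn.congr {K : Type*} [TopologicalSpace K] {F : Foliation B T X}
    {τ τ' : K → X} {U : Set K} (h : F.LeafContinuousOn τ U) (h' : ∀ q ∈ U, τ' q = τ q) :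
    F.LeafContinuousOn τ' U :=
  letI := F.leafTopology
  ContinuousOn.congr h h'

theorem LeafContinuousOn.mono {K : Type*} [TopologicalSpace K] {F : Foliation B T X}
    {τ : K → X} {U V : Set K} (h : F.LeafContinuousOn τ U) (h' : V ⊆ U) :
    F.LeafContinuousOn τ V :=
  letI := F.leafTopology
  ContinuousOn.mono h h'

theorem LeafContinuousOn.mem_leaf {K : Type*} [TopologicalSpace K] {F : Foliation B T X}
    {τ : K → X} {U : Set K} (h : F.LeafContinuousOn τ U) (hU : IsPreconnected U)
    {q q' : K} (hq : q ∈ U) (hq' : q' ∈ U) : τ q' ∈ F.leaf (τ q) := by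
  let := F.leafTopology
  have h1 : IsPreconnected (τ '' U) := hU.image τ h
  exact h1.subset_connectedComponent ⟨q, hq, rfl⟩ ⟨q', hq', rfl⟩

end Foliation

/-! ### Leaves as graphs: foliated boxes and bi-Lipschitz holonomy -/

section Sections

variable {n : ℕ} {K : Type*} [TopologicalSpace K]
  {F : Foliation (EuclideanSpace ℝ (Fin n)) unitInterval (K × unitInterval)}

/-- Along each section the transverse coordinate is locally constant, with the same value for both.
By transversality, base point and transverse coordinate together determine a nearby point. -/
theorem IsFoliatedIBundle.section_eventuallyEq (hF : IsFoliatedIBundle F) {u v : K → unitInterval}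
    {U : Set K} (hu : F.LeafContinuousOn (fun q ↦ (q, u q)) U)
    (hv : F.LeafContinuousOn (fun q ↦ (q, v q)) U) {q : K} (hq : q ∈ U) (huv : u q = v q) :
    ∀ᶠ q' in 𝓝[U] q, u q' = v q' := by
  obtain ⟨e, he, hx⟩ := F.cover (q, u q)
  obtain ⟨Φ, hΦ, hΦe⟩ := hF.transverse e he _ hx
  have hx' : (q, v q) ∈ e.source := huv ▸ hx
  have hΦ' : (q, v q) ∈ Φ.source := huv ▸ hΦ
  have h1 := hu.eventually_eq hq he hx
  have h2 := hv.eventually_eq hq he hx'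
  have h3 : ∀ᶠ q' in 𝓝[U] q, (q', u q') ∈ Φ.source :=
    (hu.continuousOn q hq).eventually (Φ.open_source.mem_nhds hΦ)
  have h4 : ∀ᶠ q' in 𝓝[U] q, (q', v q') ∈ Φ.source :=
    (hv.continuousOn q hq).eventually (Φ.open_source.mem_nhds hΦ')
  filter_upwards [h1, h2, h3, h4] with q' h1 h2 h3 h4
  have : Φ (q', u q') = Φ (q', v q') := by
    rw [← hΦe]
    simp only [Prod.mk.injEq, true_and]
    rw [h1, h2, huv]
  simpa using Φ.injOn h3 h4 this

theorem IsFoliatedIBundle.section_eqOn (hF : IsFoliatedIBundle F) {u v : K → unitInterval}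
    {U : Set K} (hUo : IsOpen U) (hU : IsPreconnected U)
    (hu : F.LeafContinuousOn (fun q ↦ (q, u q)) U)
    (hv : F.LeafContinuousOn (fun q ↦ (q, v q)) U) {q : K} (hq : q ∈ U) (huv : u q = v q) :
    ∀ q' ∈ U, u q' = v q' := by
  have hcu : ContinuousOn u U := continuous_snd.comp_continuousOn hu.continuousOn
  have hcv : ContinuousOn v U := continuous_snd.comp_continuousOn hv.continuousOn
  have hO1 : IsOpen {x | x ∈ U ∧ u x = v x} := by
    refine isOpen_iff_mem_nhds.2 fun x hx ↦ ?_
    have := hF.section_eventuallyEq hu hv hx.1 hx.2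
    rw [hUo.nhdsWithin_eq hx.1] at this
    filter_upwards [this, hUo.mem_nhds hx.1] with y h1 h2 using ⟨h2, h1⟩
  have hO2 : IsOpen {x | x ∈ U ∧ u x ≠ v x} := by
    refine isOpen_iff_mem_nhds.2 fun x hx ↦ ?_
    have h1 := ((hcu.continuousAt (hUo.mem_nhds hx.1)).prodMk
      (hcv.continuousAt (hUo.mem_nhds hx.1))).eventually
      (isClosed_diagonal.isOpen_compl.mem_nhds
        (show (u x, v x) ∈ (diagonal unitInterval)ᶜ from hx.2))
    filter_upwards [h1, hUo.mem_nhds hx.1] with y h1 h2 using ⟨h2, h1⟩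
  have := hU.subset_left_of_subset_union hO1 hO2
    (disjoint_left.2 fun x h1 h2 ↦ h2.2 h1.2)
    (fun x hx ↦ by by_cases h : u x = v x <;> [left; right] <;> exact ⟨hx, h⟩) ⟨q, hq, hq, huv⟩
  exact fun q' hq' ↦ (this hq').2

/-- Inverting the local chart `(π₁, transverse coordinate)` writes the plaques as graphs over a
common `W`, labelled by their height over `q₀`. The Lipschitz bound is kept for arbitrary pairs `q`,
`q'`, so that it can be read in both directions. -/
theorem IsFoliatedIBundle.exists_local_sections (hF : IsFoliatedIBundle F)
    (hL : IsLipschitzFoliation F) (q₀ : K) (t : unitInterval) :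
    ∃ W : Set K, IsOpen W ∧ q₀ ∈ W ∧ ∃ J : Set unitInterval, IsOpen J ∧ t ∈ J ∧ ∃ C : ℝ≥0,
    ∃ k : K → unitInterval → unitInterval,
      (∀ s ∈ J, k q₀ s = s ∧ F.LeafContinuousOn (fun q ↦ (q, k q s)) W) ∧
      ∀ s ∈ J, ∀ s' ∈ J, ∀ q ∈ W, ∀ q' ∈ W,
        dist (k q' s) (k q' s') ≤ C * dist (k q s) (k q s') := by
  obtain ⟨e, he, hx⟩ := F.cover (q₀, t)
  obtain ⟨Φ, hΦ, hΦe⟩ := hF.transverse e he _ hx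
  have hΦe' : ∀ p, Φ p = (p.1, (e p).2) := fun p ↦ by rw [← hΦe]
  obtain ⟨N, hN, C, hC⟩ := hL e he _ hx
  obtain ⟨N', hN'N, hN'o, hN'⟩ := mem_nhds_iff.1 hN
  let O := Φ.source ∩ (N' ∩ e.source)
  have hO : IsOpen O := Φ.open_source.inter (hN'o.inter e.open_source)
  have hpO : (q₀, t) ∈ O := ⟨hΦ, hN', hx⟩
  have h1 : IsOpen (Φ '' O) := Φ.isOpen_image_source_inter (hN'o.inter e.open_source)
  have h2 : (q₀, (e (q₀, t)).2) ∈ Φ '' O := ⟨(q₀, t), hpO, hΦe' _⟩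
  obtain ⟨W, Y, hW, hY, hqW, htY, hWY⟩ := isOpen_prod_iff.1 h1 _ _ h2
  let J : Set unitInterval := {s | (q₀, s) ∈ O ∧ (e (q₀, s)).2 ∈ Y}
  have hJ : IsOpen J := by
    refine isOpen_iff_mem_nhds.2 fun s hs ↦ ?_
    have hc : ContinuousAt (fun s : unitInterval ↦ (q₀, s)) s := by fun_prop
    have hc2 : ContinuousAt (fun s : unitInterval ↦ (e (q₀, s)).2) s :=
      continuous_snd.continuousAt.comp
        (ContinuousAt.comp (g := e) (e.continuousAt hs.1.2.2) hc)
    filter_upwards [hc.eventually (hO.mem_nhds hs.1), hc2.eventually (hY.mem_nhds hs.2)]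
      with x a b using ⟨a, b⟩
  have key : ∀ q ∈ W, ∀ s ∈ J, ∃ r : unitInterval, Φ.symm (q, (e (q₀, s)).2) = (q, r) ∧
      (q, r) ∈ O ∧ (e (q, r)).2 = (e (q₀, s)).2 := by
    intro q hq s hs
    obtain ⟨⟨q', r⟩, hp, hpe⟩ := hWY (show (q, (e (q₀, s)).2) ∈ W ×ˢ Y from ⟨hq, hs.2⟩)
    have h3 := hpe
    rw [hΦe'] at h3
    simp only [Prod.mk.injEq] at h3
    obtain ⟨rfl, h3⟩ := h3
    refine ⟨r, ?_, hp, h3⟩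
    rw [← hpe, Φ.left_inv hp.1]
  let k : K → unitInterval → unitInterval := fun q s ↦ (Φ.symm (q, (e (q₀, s)).2)).2
  have hk : ∀ q ∈ W, ∀ s ∈ J, Φ.symm (q, (e (q₀, s)).2) = (q, k q s) ∧ (q, k q s) ∈ O ∧
      (e (q, k q s)).2 = (e (q₀, s)).2 := by
    intro q hq s hs
    obtain ⟨r, h1, h2, h3⟩ := key q hq s hs
    have : k q s = r := by simp only [k, h1]
    rw [this]
    exact ⟨h1, h2, h3⟩
  refine ⟨W, hW, hqW, J, hJ, ⟨hpO, htY⟩, C, k, fun s hs ↦ ⟨?_, ?_⟩, ?_⟩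
  · have h := Φ.left_inv hs.1.1
    rw [hΦe'] at h
    simp only [k, h]
  · refine Foliation.leafContinuousOn_of ?_ fun q hq ↦ ⟨e, he, (hk q hq s hs).2.1.2.2, ?_⟩
    · have hc : ContinuousOn (fun q ↦ Φ.symm (q, (e (q₀, s)).2)) W := by
        refine Φ.symm.continuousOn.comp (by fun_prop) fun q hq ↦ ?_
        obtain ⟨p, hp, hpe⟩ := hWY (show (q, (e (q₀, s)).2) ∈ W ×ˢ Y from ⟨hq, hs.2⟩)
        rw [← hpe]
        exact Φ.map_source hp.1
      exact hc.congr fun q hq ↦ (hk q hq s hs).1.symm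
    · filter_upwards [self_mem_nhdsWithin] with q' hq'
      rw [(hk q hq s hs).2.2, (hk q' hq' s hs).2.2]
  · intro s hs s' hs' q hq q' hq'
    obtain ⟨-, a1, b1⟩ := hk q hq s hs
    obtain ⟨-, a2, b2⟩ := hk q hq s' hs'
    obtain ⟨-, a3, b3⟩ := hk q' hq' s hs
    obtain ⟨-, a4, b4⟩ := hk q' hq' s' hs'
    exact hC q q' _ _ _ _ (hN'N a1.2.1) (hN'N a2.2.1) (hN'N a3.2.1) (hN'N a4.2.1)
      (b1.trans b3.symm) (b2.trans b4.symm)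

/-- A product neighbourhood for a foliated `I`-bundle: over the connected open set `U`, the leaves
are the graphs of the functions `h · t`, with `t` the height over the base point `q₀`, and the
holonomy `h q` from the fiber of `q₀` to the fiber of `q` is bi-Lipschitz. -/
structure IsFoliatedBox (F : Foliation (EuclideanSpace ℝ (Fin n)) unitInterval (K × unitInterval))
    (q₀ : K) (U : Set K) (h : K → unitInterval → unitInterval) (C : ℝ≥0) : Prop where
  isOpen : IsOpen U
  isPreconnected : IsPreconnected U
  mem : q₀ ∈ U
  base : ∀ t, h q₀ t = t
  leafContinuousOn : ∀ t, F.LeafContinuousOn (fun q ↦ (q, h q t)) U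
  lipschitz : ∀ q ∈ U, LipschitzWith C (h q)
  antilipschitz : ∀ q ∈ U, AntilipschitzWith C (h q)
  zero : ∀ q ∈ U, h q 0 = 0
  one : ∀ q ∈ U, h q 1 = 1

/-- At distance at least `δ`, the diameter `1` of the interval already gives the constant `δ⁻¹`. -/
theorem lipschitzWith_of_dist_lt {f : unitInterval → unitInterval} {C : ℝ≥0} {δ : ℝ} (hδ : 0 < δ)
    (hf : ∀ s t, dist s t < δ → dist (f s) (f t) ≤ C * dist s t) :
    LipschitzWith (max C δ⁻¹.toNNReal) f := by
  refine LipschitzWith.of_dist_le_mul fun s t ↦ ?_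
  have hm : ((max C δ⁻¹.toNNReal : ℝ≥0) : ℝ) = max (C : ℝ) δ⁻¹ := by
    rw [NNReal.coe_max, Real.coe_toNNReal _ (by positivity)]
  rw [hm]
  rcases lt_or_ge (dist s t) δ with h | h
  · exact (hf s t h).trans (by gcongr; exact le_max_left _ _)
  · have h1 : dist (f s) (f t) ≤ 1 := by
      rw [Subtype.dist_eq, Real.dist_eq, abs_le]
      constructor <;> linarith [(f s).2.1, (f s).2.2, (f t).2.1, (f t).2.2]
    calc dist (f s) (f t) ≤ δ⁻¹ * δ := by rw [inv_mul_cancel₀ hδ.ne']; exact h1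
      _ ≤ max (C : ℝ) δ⁻¹ * dist s t := by gcongr; exact le_max_right _ _

/-- For distant points, monotonicity bounds the displacement of the images below by that over a
first step of length `δ / 2`; the factor `2 / δ` then pays for a distance of at most `1`. -/
theorem antilipschitzWith_of_dist_lt {f : unitInterval → unitInterval} {C : ℝ≥0} {δ : ℝ}
    (hδ : 0 < δ) (hmono : Monotone f)
    (hf : ∀ s t, dist s t < δ → dist s t ≤ C * dist (f s) (f t)) :
    AntilipschitzWith (C * (2 / δ + 1).toNNReal) f := by
  have hc : (((2 / δ + 1).toNNReal : ℝ≥0) : ℝ) = 2 / δ + 1 := Real.coe_toNNReal _ (by positivity)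
  have key : ∀ s t, s ≤ t → dist s t ≤ (C * (2 / δ + 1).toNNReal : ℝ≥0) * dist (f s) (f t) := by
    intro s t hst
    rw [NNReal.coe_mul, hc]
    rcases lt_or_ge (dist s t) δ with h | h
    · refine (hf s t h).trans ?_
      rw [mul_assoc]
      gcongr
      refine le_mul_of_one_le_left dist_nonneg ?_
      have : 0 ≤ 2 / δ := by positivity
      linarith
    · have hst' : (s : ℝ) ≤ t := hst
      have hd : dist s t = t - s := by
        rw [Subtype.dist_eq, Real.dist_eq, abs_sub_comm, abs_of_nonneg (by linarith)]
      rw [hd] at h ⊢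
      -- Half of `δ`, because the local hypothesis needs a distance strictly below `δ`.
      let r : unitInterval := ⟨s + δ / 2, by linarith [s.2.1], by linarith [t.2.2]⟩
      have hsr : s ≤ r := by change (s : ℝ) ≤ s + δ / 2; linarith
      have hrt : r ≤ t := by change (s : ℝ) + δ / 2 ≤ t; linarith
      have hdr : dist s r = δ / 2 := by
        rw [Subtype.dist_eq, Real.dist_eq, abs_sub_comm]
        change |(s : ℝ) + δ / 2 - s| = _
        rw [add_sub_cancel_left, abs_of_pos (by linarith)]
      have h1 := hf s r (by rw [hdr]; linarith)
      have h2 : dist (f s) (f r) ≤ dist (f s) (f t) := by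
        have a : (f s : ℝ) ≤ f r := hmono hsr
        have b : (f r : ℝ) ≤ f t := hmono hrt
        rw [Subtype.dist_eq, Subtype.dist_eq, Real.dist_eq, Real.dist_eq, abs_sub_comm,
          abs_sub_comm (f s : ℝ), abs_of_nonneg (by linarith), abs_of_nonneg (by linarith)]
        linarith
      have h3 : δ / 2 ≤ C * dist (f s) (f t) := by
        rw [hdr] at h1
        exact h1.trans (by gcongr)
      calc (t : ℝ) - s ≤ 1 := by linarith [s.2.1, t.2.2]
        _ = (2 / δ) * (δ / 2) := by field_simp
        _ ≤ (2 / δ + 1) * (C * dist (f s) (f t)) := by gcongr; linarith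
        _ = _ := by ring
  refine AntilipschitzWith.of_le_mul_dist fun s t ↦ ?_
  rcases le_total s t with h | h
  · exact key s t h
  · rw [dist_comm, dist_comm (f s)]
    exact key t s h

/-- Finitely many local families cover the compact fiber over `q₀`. Over a connected `U` common to
all of them, uniqueness of sections glues them into one family, and a Lebesgue number makes the
local Lipschitz bounds uniform. -/
theorem IsFoliatedIBundle.exists_isFoliatedBox [LocallyConnectedSpace K]
    (hF : IsFoliatedIBundle F) (hL : IsLipschitzFoliation F) (q₀ : K) {W₀ : Set K}
    (hW₀ : W₀ ∈ 𝓝 q₀) :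
    ∃ (U : Set K) (h : K → unitInterval → unitInterval) (C : ℝ≥0),
      U ⊆ W₀ ∧ IsFoliatedBox F q₀ U h C := by
  choose W hWo hqW J hJo htJ C k hk hkC using hF.exists_local_sections hL q₀
  obtain ⟨S, hS⟩ := isCompact_univ.elim_finite_subcover J hJo
    (fun t _ ↦ mem_iUnion.2 ⟨t, htJ t⟩)
  obtain ⟨δ, hδ, hδJ⟩ := lebesgue_number_lemma_of_metric (isCompact_univ (X := unitInterval))
    (c := fun i : S ↦ J i) (fun i ↦ hJo i) (fun t _ ↦ by
      obtain ⟨i, hi, hti⟩ := mem_iUnion₂.1 (hS (mem_univ t))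
      exact mem_iUnion.2 ⟨⟨i, hi⟩, hti⟩)
  have hWS : (⋂ i ∈ S, W i) ∩ W₀ ∈ 𝓝 q₀ :=
    inter_mem ((biInter_finset_mem S).2 fun i _ ↦ (hWo i).mem_nhds (hqW i)) hW₀
  obtain ⟨U, ⟨hUo, hqU, hUc⟩, hUW⟩ :=
    (LocallyConnectedSpace.open_connected_basis q₀).mem_iff.1 hWS
  have hUWi : ∀ i ∈ S, U ⊆ W i := fun i hi x hx ↦ mem_iInter₂.1 (hUW hx).1 i hi
  choose i hi using fun s : unitInterval ↦ hδJ s (mem_univ s)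
  let h : K → unitInterval → unitInterval := fun q s ↦ k (i s) q s
  have hsec : ∀ s, F.LeafContinuousOn (fun q ↦ (q, h q s)) U := fun s ↦
    ((hk (i s) s (hi s (Metric.mem_ball_self hδ))).2).mono (hUWi _ (i s).2)
  have hbase : ∀ s, h q₀ s = s := fun s ↦ (hk (i s) s (hi s (Metric.mem_ball_self hδ))).1
  have hagree : ∀ j ∈ S, ∀ s ∈ J j, ∀ q ∈ U, h q s = k j q s := by
    intro j hj s hs
    exact hF.section_eqOn hUo hUc.isPreconnected (hsec s) ((hk j s hs).2.mono (hUWi j hj)) hqU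
      ((hbase s).trans (hk j s hs).1.symm)
  let C₀ : ℝ≥0 := S.sup C
  -- Two heights closer than `δ` belong to the same local family. Taking `q = q₀` or `q' = q₀`
  -- yields the Lipschitz and the anti-Lipschitz bound respectively.
  have hloc : ∀ s t, dist s t < δ → ∀ q ∈ U, ∀ q' ∈ U,
      dist (h q' s) (h q' t) ≤ C₀ * dist (h q s) (h q t) := by
    intro s t hst q hq q' hq'
    have hs : s ∈ J (i t) := hi t hst
    have ht : t ∈ J (i t) := hi t (Metric.mem_ball_self hδ)
    have hiS := (i t).2
    rw [hagree _ hiS s hs q hq, hagree _ hiS t ht q hq, hagree _ hiS s hs q' hq',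
      hagree _ hiS t ht q' hq']
    refine (hkC (i t) s hs t ht q (hUWi _ hiS hq) q' (hUWi _ hiS hq')).trans ?_
    gcongr
    exact Finset.le_sup (f := C) hiS
  have hlip : ∀ q ∈ U, LipschitzWith (max C₀ δ⁻¹.toNNReal) (h q) := fun q hq ↦
    lipschitzWith_of_dist_lt hδ fun s t hst ↦ by
      simpa only [hbase] using hloc s t hst q₀ hqU q hq
  -- Two leaves that meet over `q` coincide over the connected set `U`, in particular over `q₀`,
  -- where their heights are the labels.
  have hinj : ∀ q ∈ U, Function.Injective (h q) := by
    intro q hq s t hst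
    have := hF.section_eqOn hUo hUc.isPreconnected (hsec s) (hsec t) hq hst q₀ hqU
    rwa [hbase, hbase] at this
  have hzero : ∀ q ∈ U, h q 0 = 0 := by
    intro q hq
    have := (hsec 0).mem_leaf hUc.isPreconnected hqU hq
    simp only [hbase] at this
    exact hF.boundary_zero q₀ _ this
  have hone : ∀ q ∈ U, h q 1 = 1 := by
    intro q hq
    have := (hsec 1).mem_leaf hUc.isPreconnected hqU hq
    simp only [hbase] at this
    exact hF.boundary_one q₀ _ this
  have hmono : ∀ q ∈ U, Monotone (h q) := by
    intro q hq
    rcases (hlip q hq).continuous.strictMono_of_inj (hinj q hq) with hm | hm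
    · exact hm.monotone
    · have := hm (show (0 : unitInterval) < 1 from zero_lt_one)
      rw [hzero q hq, hone q hq] at this
      exact absurd this (not_lt.2 zero_le_one)
  have hanti : ∀ q ∈ U, AntilipschitzWith (C₀ * (2 / δ + 1).toNNReal) (h q) := fun q hq ↦
    antilipschitzWith_of_dist_lt hδ (hmono q hq) fun s t hst ↦ by
      simpa only [hbase] using hloc s t hst q hq q₀ hqU
  refine ⟨U, h, max (max C₀ δ⁻¹.toNNReal) (C₀ * (2 / δ + 1).toNNReal), fun x hx ↦ (hUW hx).2,
    ⟨hUo, hUc.isPreconnected, hqU, hbase, hsec, fun q hq ↦ (hlip q hq).weaken (le_max_left _ _),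
      fun q hq ↦ ?_, hzero, hone⟩⟩
  intro x y
  refine (hanti q hq x y).trans ?_
  gcongr
  exact le_max_right _ _

/-- Horizontal local sections make the height locally constant in the leaf topology, hence constant
on leaves, while `π₁` maps a leaf into a component. Conversely, a horizontal section over a
component is connected for the leaf topology. -/
theorem isProductFoliation_of_constant_sections
    (h : ∀ (q : K) (t : unitInterval), ∃ O : Set K, IsOpen O ∧ q ∈ O ∧
      F.LeafContinuousOn (fun q' ↦ (q', t)) O)
    (hF : IsFoliatedIBundle F) : IsProductFoliation F := by
  intro q t
  apply Subset.antisymm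
  · intro p hp
    have hc1 : @Continuous _ _ F.leafTopology _ (Prod.fst : K × unitInterval → K) :=
      continuous_le_dom F.leafTopology_le continuous_fst
    have hloc :
        @IsLocallyConstant _ _ F.leafTopology (Prod.snd : K × unitInterval → unitInterval) := by
      refine (@IsLocallyConstant.iff_eventually_eq _ _ F.leafTopology _).2 ?_
      rintro ⟨q', s⟩
      obtain ⟨O, hO, hqO, hcO⟩ := h q' s
      obtain ⟨e, he, hx⟩ := F.cover (q', s)
      obtain ⟨Φ, hΦ, hΦe⟩ := hF.transverse e he _ hx
      rw [F.nhds_leafTopology he hx]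
      have h1 := hcO.eventually_eq hqO he hx
      rw [hO.nhdsWithin_eq hqO] at h1
      have h2 : ∀ᶠ q'' in 𝓝 q', (q'', s) ∈ Φ.source :=
        (show ContinuousAt (fun q'' ↦ (q'', s)) q' by fun_prop).eventually
          (Φ.open_source.mem_nhds hΦ)
      have h3 : ∀ᶠ p : K × unitInterval in 𝓝 (q', s), p ∈ Φ.source ∧ (p.1, s) ∈ Φ.source ∧
          (e (p.1, s)).2 = (e (q', s)).2 := by
        filter_upwards [Φ.open_source.mem_nhds hΦ,
          (continuous_fst (X := K) (Y := unitInterval)).continuousAt.eventually (h1.and h2)]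
          with p a b using ⟨a, b.2, b.1⟩
      filter_upwards [mem_inf_of_left h3, mem_inf_of_right (mem_principal_self _)] with p a b
      have hpp : Φ p = Φ (p.1, s) := by
        rw [← hΦe]
        simp only [Prod.mk.injEq, true_and]
        exact b.trans a.2.2.symm
      exact congrArg Prod.snd (Φ.injOn a.1 a.2.1 hpp)
    refine ⟨?_, ?_⟩
    · exact (@Continuous.image_connectedComponent_subset _ _ F.leafTopology _ _ hc1 (q, t))
        ⟨p, hp, rfl⟩
    · exact @IsLocallyConstant.apply_eq_of_isPreconnected _ _ F.leafTopology _ hloc _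
        (@isPreconnected_connectedComponent _ F.leafTopology (q, t)) _ _ hp
        (@mem_connectedComponent _ F.leafTopology (q, t))
  · rintro ⟨q', s⟩ ⟨hq', hs⟩
    obtain rfl : s = t := hs
    have hc : F.LeafContinuousOn (fun q' : K ↦ (q', s)) univ := by
      intro x _
      obtain ⟨O, hO, hxO, hcO⟩ := h x s
      let := F.leafTopology
      have := ContinuousOn.continuousAt hcO (hO.mem_nhds hxO)
      exact ContinuousAt.continuousWithinAt this
    exact (hc.mono (subset_univ _)).mem_leaf isPreconnected_connectedComponent
      (q := q) mem_connectedComponent hq'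

end Sections

/-! ### Changes of coordinates -/

section Transition

variable {n : ℕ} {K : Type*} [TopologicalSpace K]
  {c c' : OpenPartialHomeomorph K (EuclideanSpace ℝ (Fin n))}

/-- The change of coordinates from `c` to `c'`, two charts of a manifold. -/
def transition (c c' : OpenPartialHomeomorph K (EuclideanSpace ℝ (Fin n)))
    (y : EuclideanSpace ℝ (Fin n)) : EuclideanSpace ℝ (Fin n) := c' (c.symm y)

theorem eventually_symm_mem {y : EuclideanSpace ℝ (Fin n)} (hy : y ∈ c.target)
    (hy' : c.symm y ∈ c'.source) :
    ∀ᶠ z in 𝓝 y, z ∈ c.target ∧ c.symm z ∈ c'.source :=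
  Filter.Eventually.and (c.open_target.mem_nhds hy)
    ((c.symm.continuousAt hy).eventually (c'.open_source.mem_nhds hy'))

theorem symm_transition {y : EuclideanSpace ℝ (Fin n)} (hy' : c.symm y ∈ c'.source) :
    c'.symm (transition c c' y) = c.symm y :=
  c'.left_inv hy'

/-- The Jacobian matrix of the change of coordinates from `c` to `c'`, two charts of a manifold. -/
noncomputable def transitionMatrix (c c' : OpenPartialHomeomorph K (EuclideanSpace ℝ (Fin n)))
    (y : EuclideanSpace ℝ (Fin n)) : Matrix (Fin n) (Fin n) ℝ :=
  Matrix.of fun k i ↦ fderiv ℝ (transition c c') y (EuclideanSpace.single i (1 : ℝ)) k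

theorem euclideanSpace_eq_sum_single (v : EuclideanSpace ℝ (Fin n)) :
    v = ∑ k, v k • EuclideanSpace.single k (1 : ℝ) := by
  ext i
  simp [Finset.sum_apply, Pi.single_apply]

theorem det_transitionMatrix (y : EuclideanSpace ℝ (Fin n)) :
    (transitionMatrix c c' y).det = (fderiv ℝ (transition c c') y).det := by
  rw [ContinuousLinearMap.det,
    ← LinearMap.det_toMatrix (EuclideanSpace.basisFun (Fin n) ℝ).toBasis]
  congr 1

end Transition

/-! ### The metric in charts -/

section Geometry

variable {n : ℕ} {K : Type*} [TopologicalSpace K] [ChartedSpace (EuclideanSpace ℝ (Fin n)) K]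
  [IsManifold (𝓡 n) ∞ K]

section Charts

variable {c c' : OpenPartialHomeomorph K (EuclideanSpace ℝ (Fin n))}

theorem contMDiffOn_atlas (hc : c ∈ atlas (EuclideanSpace ℝ (Fin n)) K) :
    ContMDiffOn (𝓡 n) (𝓡 n) ∞ c c.source :=
  contMDiffOn_of_mem_maximalAtlas (IsManifold.subset_maximalAtlas hc)

theorem contMDiffOn_atlas_symm (hc : c ∈ atlas (EuclideanSpace ℝ (Fin n)) K) :
    ContMDiffOn (𝓡 n) (𝓡 n) ∞ c.symm c.target :=
  contMDiffOn_symm_of_mem_maximalAtlas (IsManifold.subset_maximalAtlas hc)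

theorem mdifferentiableAt_atlas' (hc : c ∈ atlas (EuclideanSpace ℝ (Fin n)) K) {q : K}
    (hq : q ∈ c.source) : MDifferentiableAt (𝓡 n) (𝓡 n) c q :=
  ((contMDiffOn_atlas hc).contMDiffAt (c.open_source.mem_nhds hq)).mdifferentiableAt (by simp)

theorem mdifferentiableAt_atlas_symm' (hc : c ∈ atlas (EuclideanSpace ℝ (Fin n)) K)
    {y : EuclideanSpace ℝ (Fin n)} (hy : y ∈ c.target) :
    MDifferentiableAt (𝓡 n) (𝓡 n) c.symm y :=
  ((contMDiffOn_atlas_symm hc).contMDiffAt (c.open_target.mem_nhds hy)).mdifferentiableAt (by simp)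

theorem differentiableAt_transition (hc : c ∈ atlas (EuclideanSpace ℝ (Fin n)) K)
    (hc' : c' ∈ atlas (EuclideanSpace ℝ (Fin n)) K) {y : EuclideanSpace ℝ (Fin n)}
    (hy : y ∈ c.target)
    (hy' : c.symm y ∈ c'.source) :
    DifferentiableAt ℝ (transition c c') y := by
  rw [← mdifferentiableAt_iff_differentiableAt]
  exact (mdifferentiableAt_atlas' hc' hy').comp y (mdifferentiableAt_atlas_symm' hc hy)

/-- The two vectors belong to tangent spaces at points that are equal but not definitionally so; the
ascriptions compare them in the model space. -/
theorem mfderiv_symm_transition (hc : c ∈ atlas (EuclideanSpace ℝ (Fin n)) K)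
    (hc' : c' ∈ atlas (EuclideanSpace ℝ (Fin n)) K) {y : EuclideanSpace ℝ (Fin n)}
    (hy : y ∈ c.target) (hy' : c.symm y ∈ c'.source) (v : EuclideanSpace ℝ (Fin n)) :
    (mfderiv (𝓡 n) (𝓡 n) c.symm y v : EuclideanSpace ℝ (Fin n)) =
      (mfderiv (𝓡 n) (𝓡 n) c'.symm (transition c c' y) (fderiv ℝ (transition c c') y v) :
        EuclideanSpace ℝ (Fin n)) := by
  have h1 : c.symm =ᶠ[𝓝 y] c'.symm ∘ transition c c' := by
    filter_upwards [eventually_symm_mem hy hy'] with z hz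
    exact (symm_transition hz.2).symm
  have h2 := mdifferentiableAt_atlas_symm' hc' (y := transition c c' y) (c'.map_source hy')
  have h3 := (differentiableAt_transition hc hc' hy hy').mdifferentiableAt
  rw [h1.mfderiv_eq, mfderiv_comp y h2 h3, mfderiv_eq_fderiv]
  rfl

theorem mfderiv_symm_injective (hc : c ∈ atlas (EuclideanSpace ℝ (Fin n)) K)
    {y : EuclideanSpace ℝ (Fin n)} (hy : y ∈ c.target) :
    Function.Injective (mfderiv (𝓡 n) (𝓡 n) c.symm y) := by
  have h1 : c ∘ c.symm =ᶠ[𝓝 y] id := by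
    filter_upwards [c.open_target.mem_nhds hy] with z hz using c.right_inv hz
  have h2 := mdifferentiableAt_atlas' hc (c.map_target hy)
  have h3 := mfderiv_comp y h2 (mdifferentiableAt_atlas_symm' hc hy)
  rw [h1.mfderiv_eq, mfderiv_id] at h3
  intro v w hvw
  have h4 : ∀ v, (mfderiv (𝓡 n) (𝓡 n) c (c.symm y)) (mfderiv (𝓡 n) (𝓡 n) c.symm y v) = v :=
    fun v ↦ (congrArg (fun L ↦ L v) h3).symm
  rw [← h4 v, ← h4 w, hvw]

end Charts

variable [RiemannianBundle (fun x : K ↦ TangentSpace (𝓡 n) x)]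
  {c c' : OpenPartialHomeomorph K (EuclideanSpace ℝ (Fin n))}

theorem metricMatrix_posDef (hc : c ∈ atlas (EuclideanSpace ℝ (Fin n)) K)
    {y : EuclideanSpace ℝ (Fin n)} (hy : y ∈ c.target) : (metricMatrix c y).PosDef := by
  refine Matrix.posDef_gram_of_linearIndependent (𝕜 := ℝ)
    (v := fun i ↦ mfderiv (𝓡 n) (𝓡 n) c.symm y (EuclideanSpace.single i (1 : ℝ))) ?_
  have h1 : LinearIndependent ℝ fun i : Fin n ↦ EuclideanSpace.single i (1 : ℝ) := by
    have := (EuclideanSpace.basisFun (Fin n) ℝ).toBasis.linearIndependent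
    simp only [OrthonormalBasis.coe_toBasis] at this
    have h : (fun i : Fin n ↦ EuclideanSpace.single i (1 : ℝ)) =
        EuclideanSpace.basisFun (Fin n) ℝ := by ext1 i; simp
    rw [h]
    exact this
  exact h1.map' (mfderiv (𝓡 n) (𝓡 n) c.symm y).toLinearMap
    (LinearMap.ker_eq_bot.2 (mfderiv_symm_injective hc hy))

theorem inner_tangentSpace_congr {p p' : K} (h : p = p') (v w : EuclideanSpace ℝ (Fin n)) :
    @inner ℝ (TangentSpace (𝓡 n) p) _ v w = @inner ℝ (TangentSpace (𝓡 n) p') _ v w := by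
  subst h
  rfl

theorem metricMatrix_transition (hc : c ∈ atlas (EuclideanSpace ℝ (Fin n)) K)
    (hc' : c' ∈ atlas (EuclideanSpace ℝ (Fin n)) K) {y : EuclideanSpace ℝ (Fin n)}
    (hy : y ∈ c.target)
    (hy' : c.symm y ∈ c'.source) :
    metricMatrix c y = (transitionMatrix c c' y).transpose *
      metricMatrix c' (transition c c' y) * transitionMatrix c c' y := by
  have key : ∀ i, (mfderiv (𝓡 n) (𝓡 n) c.symm y (EuclideanSpace.single i (1 : ℝ)) :
      EuclideanSpace ℝ (Fin n)) = (∑ k, transitionMatrix c c' y k i •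
        mfderiv (𝓡 n) (𝓡 n) c'.symm (transition c c' y) (EuclideanSpace.single k (1 : ℝ)) :
          TangentSpace (𝓡 n) (c'.symm (transition c c' y))) := by
    intro i
    rw [mfderiv_symm_transition hc hc' hy hy']
    conv_lhs => rw [euclideanSpace_eq_sum_single
      (fderiv ℝ (transition c c') y (EuclideanSpace.single i (1 : ℝ)))]
    exact (map_sum (mfderiv (𝓡 n) (𝓡 n) c'.symm (transition c c' y)) _ _).trans
      (Finset.sum_congr rfl fun k _ ↦ map_smul _ _ _)
  ext i j
  have h1 : metricMatrix c y i j = @inner ℝ (TangentSpace (𝓡 n) (c.symm y)) _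
    (mfderiv (𝓡 n) (𝓡 n) c.symm y (EuclideanSpace.single i (1 : ℝ)))
    (mfderiv (𝓡 n) (𝓡 n) c.symm y (EuclideanSpace.single j (1 : ℝ))) := rfl
  rw [h1]
  refine (inner_tangentSpace_congr (symm_transition hy').symm _ _).trans ?_
  refine (congrArg₂ (@inner ℝ (TangentSpace (𝓡 n) (c'.symm (transition c c' y))) _)
    (key i) (key j)).trans ?_
  rw [sum_inner]
  simp only [inner_sum, Matrix.mul_apply, Matrix.transpose_apply,
    real_inner_smul_left, real_inner_smul_right, Finset.sum_mul]
  rw [Finset.sum_comm]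
  refine Finset.sum_congr rfl fun k _ ↦ Finset.sum_congr rfl fun l _ ↦ ?_
  simp only [metricMatrix, Matrix.of_apply]
  ring

/-- The coordinate fields are images of constant fields under the tangent map of `c.symm`, hence
smooth sections, and the smooth metric pairs them smoothly. -/
theorem contDiffOn_metricMatrix [IsContMDiffRiemannianBundle (𝓡 n) ∞ (EuclideanSpace ℝ (Fin n))
      (fun x : K ↦ TangentSpace (𝓡 n) x)]
    (hc : c ∈ atlas (EuclideanSpace ℝ (Fin n)) K) (i j : Fin n) :
    ContDiffOn ℝ ∞ (fun y ↦ metricMatrix c y i j) c.target := by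
  have hs : ∀ i : Fin n, ContMDiffOn (𝓡 n) (𝓡 n).tangent ∞
      (fun y ↦ (⟨c.symm y, mfderiv (𝓡 n) (𝓡 n) c.symm y (EuclideanSpace.single i (1 : ℝ))⟩ :
        TangentBundle (𝓡 n) K)) c.target := by
    intro i
    have h1 := (contMDiffOn_atlas_symm hc).contMDiffOn_tangentMapWithin (m := ∞) (by simp)
      c.open_target.uniqueMDiffOn
    have h2 : ContMDiff (𝓡 n) (𝓡 n).tangent ∞ (fun y : EuclideanSpace ℝ (Fin n) ↦
        (⟨y, EuclideanSpace.single i (1 : ℝ)⟩ :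
          TangentBundle (𝓡 n) (EuclideanSpace ℝ (Fin n)))) :=
      contMDiff_vectorSpace_iff_contDiff.2 contDiff_const
    refine (h1.comp h2.contMDiffOn (fun y hy ↦ hy)).congr fun y hy ↦ ?_
    simp only [Function.comp_apply, tangentMapWithin]
    rw [mfderivWithin_of_isOpen c.open_target hy]
  exact ((hs i).inner_bundle (hs j)).contDiffOn

end Geometry

/-! ### Smoothness of determinants and inverse matrices -/

section Smoothness

variable {E : Type*} [NormedAddCommGroup E] [NormedSpace ℝ E] {n : ℕ} {s : Set E} {k : WithTop ℕ∞}

theorem contDiffOn_det {A : E → Matrix (Fin n) (Fin n) ℝ}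
    (hA : ∀ i j, ContDiffOn ℝ k (fun y ↦ A y i j) s) : ContDiffOn ℝ k (fun y ↦ (A y).det) s := by
  simp only [Matrix.det_apply]
  refine ContDiffOn.sum fun σ _ ↦ ContDiffOn.const_smul _ ?_
  exact contDiffOn_prod fun i _ ↦ hA _ _

theorem contDiffOn_inv_apply {A : E → Matrix (Fin n) (Fin n) ℝ}
    (hA : ∀ i j, ContDiffOn ℝ k (fun y ↦ A y i j) s) (hdet : ∀ y ∈ s, (A y).det ≠ 0)
    (i j : Fin n) : ContDiffOn ℝ k (fun y ↦ (A y)⁻¹ i j) s := by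
  simp only [Matrix.inv_def, Matrix.smul_apply, Ring.inverse_eq_inv', smul_eq_mul,
    Matrix.adjugate_apply]
  refine ((contDiffOn_det hA).inv hdet).mul (contDiffOn_det fun a b ↦ ?_)
  by_cases h : a = j
  · subst h
    simp only [Matrix.updateRow_self]
    exact contDiffOn_const
  · simp only [Matrix.updateRow_ne h]
    exact hA a b

end Smoothness

/-! ### Bilinear forms on covectors -/

section CovForm

variable {n : ℕ}

/-- The bilinear form `∑ i j, Aᵢⱼ ξᵢ ηⱼ` on the covectors of a Euclidean space. -/
noncomputable def covForm (A : Matrix (Fin n) (Fin n) ℝ)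
    (ξ η : EuclideanSpace ℝ (Fin n) →L[ℝ] ℝ) : ℝ :=
  ∑ i, ∑ j, A i j * (ξ (EuclideanSpace.single i (1 : ℝ)) * η (EuclideanSpace.single j (1 : ℝ)))

variable (A : Matrix (Fin n) (Fin n) ℝ) (ξ ξ' η : EuclideanSpace ℝ (Fin n) →L[ℝ] ℝ) (r : ℝ)

theorem covForm_add_left : covForm A (ξ + ξ') η = covForm A ξ η + covForm A ξ' η := by
  simp only [covForm, ← Finset.sum_add_distrib, add_apply]
  refine Finset.sum_congr rfl fun i _ ↦ Finset.sum_congr rfl fun j _ ↦ ?_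
  ring

theorem covForm_add_right : covForm A η (ξ + ξ') = covForm A η ξ + covForm A η ξ' := by
  simp only [covForm, ← Finset.sum_add_distrib, add_apply]
  refine Finset.sum_congr rfl fun i _ ↦ Finset.sum_congr rfl fun j _ ↦ ?_
  ring

theorem covForm_smul_left : covForm A (r • ξ) η = r * covForm A ξ η := by
  simp only [covForm, Finset.mul_sum, smul_apply, smul_eq_mul]
  refine Finset.sum_congr rfl fun i _ ↦ Finset.sum_congr rfl fun j _ ↦ ?_
  ring

theorem covForm_smul_right : covForm A η (r • ξ) = r * covForm A η ξ := by
  simp only [covForm, Finset.mul_sum, smul_apply, smul_eq_mul]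
  refine Finset.sum_congr rfl fun i _ ↦ Finset.sum_congr rfl fun j _ ↦ ?_
  ring

theorem covForm_sub_left : covForm A (ξ - ξ') η = covForm A ξ η - covForm A ξ' η := by
  rw [sub_eq_add_neg, ← neg_one_smul ℝ ξ', covForm_add_left, covForm_smul_left]
  ring

theorem covForm_sub_right : covForm A η (ξ - ξ') = covForm A η ξ - covForm A η ξ' := by
  rw [sub_eq_add_neg, ← neg_one_smul ℝ ξ', covForm_add_right, covForm_smul_right]
  ring

theorem covForm_zero_left : covForm A 0 η = 0 := by simp [covForm]

theorem covForm_zero_right : covForm A η 0 = 0 := by simp [covForm]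

theorem covForm_smul_matrix : covForm (r • A) ξ η = r * covForm A ξ η := by
  simp only [covForm, Finset.mul_sum, Matrix.smul_apply, smul_eq_mul]
  refine Finset.sum_congr rfl fun i _ ↦ Finset.sum_congr rfl fun j _ ↦ ?_
  ring

theorem covForm_sum_left {ι : Type*} (s : Finset ι)
    (ξ : ι → EuclideanSpace ℝ (Fin n) →L[ℝ] ℝ) :
    covForm A (∑ i ∈ s, ξ i) η = ∑ i ∈ s, covForm A (ξ i) η := by
  classical
  induction s using Finset.induction_on with
  | empty => simp [covForm_zero_left]
  | insert a s ha ih => rw [Finset.sum_insert ha, Finset.sum_insert ha, covForm_add_left, ih]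

theorem continuousOn_covForm {X : Type*} [TopologicalSpace X] {s : Set X}
    {A : X → Matrix (Fin n) (Fin n) ℝ} {ξ η : X → EuclideanSpace ℝ (Fin n) →L[ℝ] ℝ}
    (hA : ∀ i j, ContinuousOn (fun x ↦ A x i j) s) (hξ : ContinuousOn ξ s)
    (hη : ContinuousOn η s) : ContinuousOn (fun x ↦ covForm (A x) (ξ x) (η x)) s := by
  unfold covForm
  refine continuousOn_finsetSum _ fun i _ ↦ continuousOn_finsetSum _ fun j _ ↦ ?_
  exact (hA i j).mul ((hξ.clm_apply continuousOn_const).mul (hη.clm_apply continuousOn_const))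

theorem aemeasurable_covForm {X : Type*} [MeasurableSpace X] {μ : Measure X}
    {A : X → Matrix (Fin n) (Fin n) ℝ} {ξ η : X → EuclideanSpace ℝ (Fin n) →L[ℝ] ℝ}
    (hA : ∀ i j, AEMeasurable (fun x ↦ A x i j) μ) (hξ : AEMeasurable ξ μ)
    (hη : AEMeasurable η μ) : AEMeasurable (fun x ↦ covForm (A x) (ξ x) (η x)) μ := by
  unfold covForm
  refine Finset.aemeasurable_fun_sum _ fun i _ ↦ Finset.aemeasurable_fun_sum _ fun j _ ↦ ?_
  exact (hA i j).mul (((ContinuousLinearMap.measurable_apply _).comp_aemeasurable hξ).mul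
    ((ContinuousLinearMap.measurable_apply _).comp_aemeasurable hη))

end CovForm

/-! ### Volume density, products of differentials and Green's formula -/

section Geometry

variable {n : ℕ} {K : Type*} [TopologicalSpace K] [ChartedSpace (EuclideanSpace ℝ (Fin n)) K]
  [IsManifold (𝓡 n) ∞ K] [RiemannianBundle (fun x : K ↦ TangentSpace (𝓡 n) x)]
  {c c' : OpenPartialHomeomorph K (EuclideanSpace ℝ (Fin n))}

theorem volDensity_pos (hc : c ∈ atlas (EuclideanSpace ℝ (Fin n)) K)
    {y : EuclideanSpace ℝ (Fin n)} (hy : y ∈ c.target) : 0 < volDensity c y :=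
  Real.sqrt_pos.2 (metricMatrix_posDef hc hy).det_pos

theorem volDensity_transition (hc : c ∈ atlas (EuclideanSpace ℝ (Fin n)) K)
    (hc' : c' ∈ atlas (EuclideanSpace ℝ (Fin n)) K) {y : EuclideanSpace ℝ (Fin n)}
    (hy : y ∈ c.target) (hy' : c.symm y ∈ c'.source) :
    volDensity c y = |(fderiv ℝ (transition c c') y).det| * volDensity c' (transition c c' y) := by
  rw [volDensity, metricMatrix_transition hc hc' hy hy', Matrix.det_mul, Matrix.det_mul,
    Matrix.det_transpose, det_transitionMatrix, mul_right_comm, ← sq,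
    Real.sqrt_mul (sq_nonneg _), Real.sqrt_sq_eq_abs, volDensity]

/-- The inner product of covectors in the chart `c`, `⟪ξ, η⟫ = ∑ i j, gⁱʲ ξᵢ ηⱼ`. -/
noncomputable def chartForm (c : OpenPartialHomeomorph K (EuclideanSpace ℝ (Fin n)))
    (y : EuclideanSpace ℝ (Fin n)) (ξ η : EuclideanSpace ℝ (Fin n) →L[ℝ] ℝ) : ℝ :=
  covForm (metricMatrix c y)⁻¹ ξ η

theorem chartForm_apply (y : EuclideanSpace ℝ (Fin n)) (ξ η : EuclideanSpace ℝ (Fin n) →L[ℝ] ℝ) :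
    chartForm c y ξ η = ∑ i, ∑ j, (metricMatrix c y)⁻¹ i j *
      (ξ (EuclideanSpace.single i (1 : ℝ)) * η (EuclideanSpace.single j (1 : ℝ))) :=
  rfl

theorem chartForm_eq_dotProduct (y : EuclideanSpace ℝ (Fin n))
    (ξ η : EuclideanSpace ℝ (Fin n) →L[ℝ] ℝ) :
    chartForm c y ξ η = (fun i ↦ ξ (EuclideanSpace.single i (1 : ℝ))) ⬝ᵥ
      ((metricMatrix c y)⁻¹.mulVec fun i ↦ η (EuclideanSpace.single i (1 : ℝ))) := by
  rw [chartForm_apply]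
  simp only [dotProduct, Matrix.mulVec, Finset.mul_sum]
  refine Finset.sum_congr rfl fun i _ ↦ Finset.sum_congr rfl fun j _ ↦ ?_
  ring

theorem chartForm_symm (hc : c ∈ atlas (EuclideanSpace ℝ (Fin n)) K)
    {y : EuclideanSpace ℝ (Fin n)} (hy : y ∈ c.target) (ξ η : EuclideanSpace ℝ (Fin n) →L[ℝ] ℝ) :
    chartForm c y ξ η = chartForm c y η ξ := by
  have h : ∀ i j, (metricMatrix c y)⁻¹ i j = (metricMatrix c y)⁻¹ j i := fun i j ↦ by
    have := (metricMatrix_posDef hc hy).inv.isHermitian.apply j i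
    simpa using this
  rw [chartForm_apply, chartForm_apply, Finset.sum_comm]
  refine Finset.sum_congr rfl fun i _ ↦ Finset.sum_congr rfl fun j _ ↦ ?_
  rw [h, mul_comm (ξ _)]

theorem chartForm_pos (hc : c ∈ atlas (EuclideanSpace ℝ (Fin n)) K)
    {y : EuclideanSpace ℝ (Fin n)} (hy : y ∈ c.target) {ξ : EuclideanSpace ℝ (Fin n) →L[ℝ] ℝ}
    (hξ : ξ ≠ 0) : 0 < chartForm c y ξ ξ := by
  rw [chartForm_eq_dotProduct]
  have := (metricMatrix_posDef hc hy).inv.dotProduct_mulVec_pos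
    (x := fun i ↦ ξ (EuclideanSpace.single i (1 : ℝ))) (fun h ↦ hξ ?_)
  · simpa using this
  · ext v
    rw [euclideanSpace_eq_sum_single v, map_sum]
    simp only [map_smul]
    exact Finset.sum_eq_zero fun i _ ↦ by rw [congrFun h i]; simp

theorem chartForm_nonneg (hc : c ∈ atlas (EuclideanSpace ℝ (Fin n)) K)
    {y : EuclideanSpace ℝ (Fin n)} (hy : y ∈ c.target) (ξ : EuclideanSpace ℝ (Fin n) →L[ℝ] ℝ) :
    0 ≤ chartForm c y ξ ξ := by
  by_cases h : ξ = 0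
  · simp [h, chartForm, covForm_zero_left]
  · exact (chartForm_pos hc hy h).le

/-- With `G = Jᵀ G' J`, the Jacobians cancel in `J G⁻¹ Jᵀ`; `J` is invertible because `det G` is
positive. This makes `gradInner` independent of the chart. -/
theorem chartForm_transition (hc : c ∈ atlas (EuclideanSpace ℝ (Fin n)) K)
    (hc' : c' ∈ atlas (EuclideanSpace ℝ (Fin n)) K) {y : EuclideanSpace ℝ (Fin n)}
    (hy : y ∈ c.target) (hy' : c.symm y ∈ c'.source)
    (ξ η : EuclideanSpace ℝ (Fin n) →L[ℝ] ℝ) :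
    chartForm c y (ξ.comp (fderiv ℝ (transition c c') y))
      (η.comp (fderiv ℝ (transition c c') y)) = chartForm c' (transition c c' y) ξ η := by
  have hv : ∀ ξ : EuclideanSpace ℝ (Fin n) →L[ℝ] ℝ,
      (fun i ↦ ξ.comp (fderiv ℝ (transition c c') y) (EuclideanSpace.single i (1 : ℝ))) =
        (transitionMatrix c c' y).transpose.mulVec
          fun i ↦ ξ (EuclideanSpace.single i (1 : ℝ)) := by
    intro ξ
    ext i
    rw [ContinuousLinearMap.comp_apply, euclideanSpace_eq_sum_single
      (fderiv ℝ (transition c c') y (EuclideanSpace.single i (1 : ℝ))), map_sum]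
    simp [Matrix.mulVec, dotProduct, transitionMatrix]
  have hG := metricMatrix_transition hc hc' hy hy'
  have hdet := (metricMatrix_posDef hc hy).det_pos
  set J := transitionMatrix c c' y
  have hJ : IsUnit J.det := by
    rw [isUnit_iff_ne_zero]
    intro h
    rw [hG, Matrix.det_mul, h, mul_zero] at hdet
    exact lt_irrefl _ hdet
  have hJt : IsUnit J.transpose.det := by rwa [Matrix.det_transpose]
  rw [chartForm_eq_dotProduct, chartForm_eq_dotProduct, hv, hv, hG, Matrix.mul_inv_rev,
    Matrix.mul_inv_rev, Matrix.mulVec_transpose, ← Matrix.dotProduct_mulVec,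
    Matrix.mulVec_mulVec, Matrix.mulVec_mulVec]
  congr 2
  rw [Matrix.mul_assoc, Matrix.mul_assoc, Matrix.mul_assoc, Matrix.nonsing_inv_mul _ hJt,
    Matrix.mul_one, Matrix.mul_nonsing_inv_cancel_left _ _ hJ]

theorem contDiffOn_volDensity [IsContMDiffRiemannianBundle (𝓡 n) ∞ (EuclideanSpace ℝ (Fin n))
      (fun x : K ↦ TangentSpace (𝓡 n) x)]
    (hc : c ∈ atlas (EuclideanSpace ℝ (Fin n)) K) :
    ContDiffOn ℝ ∞ (volDensity c) c.target :=
  (contDiffOn_det (contDiffOn_metricMatrix hc)).sqrt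
    fun _ hy ↦ (metricMatrix_posDef hc hy).det_pos.ne'

theorem contDiffOn_metricMatrix_inv
    [IsContMDiffRiemannianBundle (𝓡 n) ∞ (EuclideanSpace ℝ (Fin n))
      (fun x : K ↦ TangentSpace (𝓡 n) x)]
    (hc : c ∈ atlas (EuclideanSpace ℝ (Fin n)) K) (i j : Fin n) :
    ContDiffOn ℝ ∞ (fun y ↦ (metricMatrix c y)⁻¹ i j) c.target :=
  contDiffOn_inv_apply (contDiffOn_metricMatrix hc)
    (fun _ hy ↦ (metricMatrix_posDef hc hy).det_pos.ne') i j

/-- Green's formula in the chart `c`: harmonic functions are weakly harmonic. -/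
theorem IsHarmonicOn.integral_chartForm_eq_zero
    [IsContMDiffRiemannianBundle (𝓡 n) ∞ (EuclideanSpace ℝ (Fin n))
      (fun x : K ↦ TangentSpace (𝓡 n) x)]
    (hc : c ∈ atlas (EuclideanSpace ℝ (Fin n)) K) {u : K → ℝ} {U : Set K} (hU : IsOpen U)
    (hu : IsHarmonicOn (n := n) u U) {f : EuclideanSpace ℝ (Fin n) → ℝ} (hf : ContDiff ℝ 1 f)
    (hfc : HasCompactSupport f) (hfs : tsupport f ⊆ c.target ∩ c.symm ⁻¹' U) :
    ∫ y, volDensity c y * chartForm c y (fderiv ℝ f y) (fderiv ℝ (u ∘ c.symm) y) = 0 := by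
  set Ω := c.target ∩ c.symm ⁻¹' U with hΩ
  have hΩo : IsOpen Ω := c.symm.isOpen_inter_preimage hU
  have hu2 : ContDiffOn ℝ 2 (u ∘ c.symm) Ω := by
    rw [← contMDiffOn_iff_contDiffOn]
    exact hu.1.comp (((contMDiffOn_atlas_symm hc).of_le (by norm_cast)).mono
      inter_subset_left) fun y hy ↦ hy.2
  let X : Fin n → EuclideanSpace ℝ (Fin n) → ℝ := fun i z ↦ volDensity c z *
        ∑ j, (metricMatrix c z)⁻¹ i j *
          fderiv ℝ (u ∘ c.symm) z (EuclideanSpace.single j (1 : ℝ))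
  have hX : ∀ i, ContDiffOn ℝ 1 (X i) Ω := by
    intro i
    refine (((contDiffOn_volDensity hc).of_le (by norm_cast)).mono
      inter_subset_left).mul (ContDiffOn.sum fun j _ ↦ ?_)
    refine (((contDiffOn_metricMatrix_inv hc i j).of_le (by norm_cast)).mono
      inter_subset_left).mul ?_
    exact (hu2.fderiv_of_isOpen hΩo (m := 1) (by norm_num)).clm_apply contDiffOn_const
  -- `X` is the density times the gradient of `u`. The Laplacian is its divergence divided by the
  -- positive density, so this divergence vanishes.
  have hdiv : ∀ y ∈ Ω, ∑ i, fderiv ℝ (X i) y (EuclideanSpace.single i (1 : ℝ)) = 0 := by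
    intro y hy
    have := hu.2 c hc (c.symm y) ⟨hy.2, c.map_target hy.1⟩
    rw [c.right_inv hy.1, laplaceBeltrami] at this
    exact (mul_eq_zero.1 this).resolve_left (inv_ne_zero (volDensity_pos hc hy.1).ne')
  have hzero : ∀ y ∉ tsupport f, fderiv ℝ f y = 0 := fun y hy ↦ by
    have h1 : f =ᶠ[𝓝 y] 0 := notMem_tsupport_iff_eventuallyEq.1 hy
    rw [h1.fderiv_eq]
    simp
  have hintg : ∀ g : EuclideanSpace ℝ (Fin n) → ℝ, ContinuousOn g Ω →
      (∀ y ∉ tsupport f, g y = 0) → Integrable g := fun g hg hg0 ↦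
    ((hg.mono hfs).integrableOn_compact hfc).integrable_of_forall_notMem_eq_zero hg0
  have hdf : ∀ v, Continuous fun y ↦ fderiv ℝ f y v := fun v ↦
    (hf.continuous_fderiv one_ne_zero).clm_apply continuous_const
  have hI1 : ∀ i, Integrable fun y ↦ fderiv ℝ f y (EuclideanSpace.single i (1 : ℝ)) * X i y :=
    fun i ↦ hintg _ ((hdf _).continuousOn.mul (hX i).continuousOn)
      fun y hy ↦ by rw [hzero y hy]; simp
  have hI2 : ∀ i, Integrable fun y ↦ f y * fderiv ℝ (X i) y (EuclideanSpace.single i (1 : ℝ)) :=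
    fun i ↦ hintg _ (hf.continuous.continuousOn.mul
      (((hX i).continuousOn_fderiv_of_isOpen hΩo le_rfl).clm_apply continuousOn_const))
      fun y hy ↦ by rw [image_eq_zero_of_notMem_tsupport hy]; simp
  have hI3 : ∀ i, Integrable fun y ↦ f y * X i y :=
    fun i ↦ hintg _ (hf.continuous.continuousOn.mul (hX i).continuousOn)
      fun y hy ↦ by rw [image_eq_zero_of_notMem_tsupport hy]; simp
  have hparts := fun i ↦ integral_mul_fderiv_eq_neg_fderiv_mul_of_integrable (hI1 i) (hI2 i) (hI3 i)
    (fun x _ ↦ (hf.differentiable (by norm_num)).differentiableAt)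
    (fun x hx ↦ ((hX i).differentiableOn (by norm_num)).differentiableAt (hΩo.mem_nhds (hfs hx)))
  have h1 : ∀ y, volDensity c y * chartForm c y (fderiv ℝ f y) (fderiv ℝ (u ∘ c.symm) y) =
      ∑ i, fderiv ℝ f y (EuclideanSpace.single i (1 : ℝ)) * X i y := by
    intro y
    rw [chartForm_apply]
    simp only [X, Finset.mul_sum]
    refine Finset.sum_congr rfl fun i _ ↦ Finset.sum_congr rfl fun j _ ↦ ?_
    ring
  simp only [h1]
  rw [integral_finsetSum _ fun i _ ↦ hI1 i]
  have h2 : ∑ i, ∫ y, f y * fderiv ℝ (X i) y (EuclideanSpace.single i (1 : ℝ)) = 0 := by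
    rw [← integral_finsetSum _ fun i _ ↦ hI2 i]
    refine integral_eq_zero_of_ae (Eventually.of_forall fun y ↦ ?_)
    simp only [Pi.zero_apply, ← Finset.mul_sum]
    by_cases hy : y ∈ tsupport f
    · rw [hdiv y (hfs hy), mul_zero]
    · rw [image_eq_zero_of_notMem_tsupport hy, zero_mul]
  simp only [hparts, Finset.sum_neg_distrib, neg_eq_zero] at h2
  exact h2

/-- The inner product of the differentials of `u` and `v` at `q`. -/
noncomputable def gradInner (u v : K → ℝ) (q : K) : ℝ :=
  chartForm (chartAt (EuclideanSpace ℝ (Fin n)) q) (chartAt (EuclideanSpace ℝ (Fin n)) q q)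
    (fderiv ℝ (u ∘ (chartAt (EuclideanSpace ℝ (Fin n)) q).symm)
      (chartAt (EuclideanSpace ℝ (Fin n)) q q))
    (fderiv ℝ (v ∘ (chartAt (EuclideanSpace ℝ (Fin n)) q).symm)
      (chartAt (EuclideanSpace ℝ (Fin n)) q q))

theorem fderiv_comp_symm_transition (hc : c ∈ atlas (EuclideanSpace ℝ (Fin n)) K)
    (hc' : c' ∈ atlas (EuclideanSpace ℝ (Fin n)) K) {y : EuclideanSpace ℝ (Fin n)}
    (hy : y ∈ c.target) (hy' : c.symm y ∈ c'.source) {u : K → ℝ}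
    (hu : MDifferentiableAt (𝓡 n) 𝓘(ℝ, ℝ) u (c.symm y)) :
    fderiv ℝ (u ∘ c.symm) y =
      (fderiv ℝ (u ∘ c'.symm) (transition c c' y)).comp (fderiv ℝ (transition c c') y) := by
  have h1 : u ∘ c.symm =ᶠ[𝓝 y] (u ∘ c'.symm) ∘ transition c c' := by
    filter_upwards [eventually_symm_mem hy hy'] with z hz
    simp only [Function.comp_apply, symm_transition hz.2]
  have h2 : DifferentiableAt ℝ (u ∘ c'.symm) (transition c c' y) := by
    rw [← mdifferentiableAt_iff_differentiableAt]
    rw [← symm_transition hy'] at hu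
    exact hu.comp _ (mdifferentiableAt_atlas_symm' hc' (c'.map_source hy'))
  rw [h1.fderiv_eq, fderiv_comp y h2 (differentiableAt_transition hc hc' hy hy')]

theorem gradInner_eq (hc : c ∈ atlas (EuclideanSpace ℝ (Fin n)) K) {u v : K → ℝ}
    {y : EuclideanSpace ℝ (Fin n)} (hy : y ∈ c.target)
    (hu : MDifferentiableAt (𝓡 n) 𝓘(ℝ, ℝ) u (c.symm y))
    (hv : MDifferentiableAt (𝓡 n) 𝓘(ℝ, ℝ) v (c.symm y)) :
    gradInner (n := n) u v (c.symm y) =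
      chartForm c y (fderiv ℝ (u ∘ c.symm) y) (fderiv ℝ (v ∘ c.symm) y) := by
  have hc' := chart_mem_atlas (EuclideanSpace ℝ (Fin n)) (c.symm y)
  have hy' := mem_chart_source (EuclideanSpace ℝ (Fin n)) (c.symm y)
  rw [fderiv_comp_symm_transition hc hc' hy hy' hu, fderiv_comp_symm_transition hc hc' hy hy' hv,
    chartForm_transition hc hc' hy hy']
  rfl

theorem gradInner_congr {u u' v v' : K → ℝ} {q : K} (hu : u =ᶠ[𝓝 q] u') (hv : v =ᶠ[𝓝 q] v') :
    gradInner (n := n) u v q = gradInner (n := n) u' v' q := by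
  have h : Tendsto (chartAt (EuclideanSpace ℝ (Fin n)) q).symm
      (𝓝 (chartAt (EuclideanSpace ℝ (Fin n)) q q)) (𝓝 q) :=
    (chartAt (EuclideanSpace ℝ (Fin n)) q).tendsto_symm (mem_chart_source _ q)
  have h1 := (hu.comp_tendsto h).fderiv_eq (𝕜 := ℝ)
  have h2 := (hv.comp_tendsto h).fderiv_eq (𝕜 := ℝ)
  rw [gradInner, gradInner, h1, h2]

/-- The differentials of a partition of unity add up to zero; this removes the first-order term when
the local identities are summed. -/
theorem sum_gradInner_eq_zero {ι : Type*} {s : Finset ι} {ψ : ι → K → ℝ} {v : K → ℝ} {q : K}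
    (hψ : ∀ i ∈ s, MDifferentiableAt (𝓡 n) 𝓘(ℝ, ℝ) (ψ i) q) (hsum : ∀ x, ∑ i ∈ s, ψ i x = 1) :
    ∑ i ∈ s, gradInner (n := n) (ψ i) v q = 0 := by
  have hc := chart_mem_atlas (EuclideanSpace ℝ (Fin n)) q
  have hq := mem_chart_source (EuclideanSpace ℝ (Fin n)) q
  have hd : ∀ i ∈ s, DifferentiableAt ℝ (ψ i ∘ (chartAt (EuclideanSpace ℝ (Fin n)) q).symm)
      (chartAt (EuclideanSpace ℝ (Fin n)) q q) := by
    intro i hi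
    rw [← mdifferentiableAt_iff_differentiableAt]
    have := hψ i hi
    rw [← (chartAt (EuclideanSpace ℝ (Fin n)) q).left_inv hq] at this
    exact this.comp _ (mdifferentiableAt_atlas_symm' hc
      ((chartAt (EuclideanSpace ℝ (Fin n)) q).map_source hq))
  have h1 : ∑ i ∈ s, fderiv ℝ (ψ i ∘ (chartAt (EuclideanSpace ℝ (Fin n)) q).symm)
      (chartAt (EuclideanSpace ℝ (Fin n)) q q) = 0 := by
    rw [← fderiv_fun_sum hd]
    simp only [Function.comp_apply, hsum]
    simp
  simp only [gradInner, chartForm]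
  rw [← covForm_sum_left, h1, covForm_zero_left]

end Geometry

/-! ### Caccioppoli's inequality for the graphs of a box -/

section GraphFamily

variable {n : ℕ}

/-- Nonnegativity on `ε ξ ± η` gives a weighted Cauchy-Schwarz inequality. It will be used with `ε`
equal to the distance between two parameters. -/
theorem abs_covForm_le {A : Matrix (Fin n) (Fin n) ℝ}
    (hs : ∀ ξ η, covForm A ξ η = covForm A η ξ) (hA : ∀ ξ, 0 ≤ covForm A ξ ξ)
    (ξ η : EuclideanSpace ℝ (Fin n) →L[ℝ] ℝ) {ε : ℝ} (hε : 0 < ε) :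
    |covForm A ξ η| ≤ ε * covForm A ξ ξ + ε⁻¹ * covForm A η η := by
  have h1 := hA (ε • ξ + η)
  have h2 := hA (ε • ξ - η)
  have h3 := hA ξ
  have h4 := hA η
  simp only [covForm_add_left, covForm_add_right, covForm_sub_left, covForm_sub_right,
    covForm_smul_left, covForm_smul_right, hs η ξ] at h1 h2
  have h5 : ε * |covForm A ξ η| ≤ ε * (ε * covForm A ξ ξ + ε⁻¹ * covForm A η η) := by
    rw [mul_add, mul_inv_cancel_left₀ hε.ne']
    rcases abs_cases (covForm A ξ η) with h | h <;> rw [h.1] <;> nlinarith [mul_pos hε hε]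
  exact le_of_mul_le_mul_left h5 hε

/-- The differential at `y` of the function `h · t`. -/
noncomputable def graphDeriv (h : EuclideanSpace ℝ (Fin n) → ℝ → ℝ) (t : ℝ)
    (y : EuclideanSpace ℝ (Fin n)) : EuclideanSpace ℝ (Fin n) →L[ℝ] ℝ :=
  fderiv ℝ (fun z ↦ h z t) y

/-- A family of functions `h · t`, `t ∈ [0, 1]`, on the open set `Ω`, weakly harmonic for the
operator `∑ i j, ∂ᵢ (Aᵢⱼ ∂ⱼ)`, whose graphs foliate `Ω × [0, 1]` in a bi-Lipschitz way;
`k y` is the inverse of `h y`. -/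
structure IsHarmonicGraphFamily (Ω : Set (EuclideanSpace ℝ (Fin n)))
    (A : EuclideanSpace ℝ (Fin n) → Matrix (Fin n) (Fin n) ℝ)
    (h k : EuclideanSpace ℝ (Fin n) → ℝ → ℝ) (C : ℝ≥0) : Prop where
  isOpen : IsOpen Ω
  continuousOn : ∀ i j, ContinuousOn (fun y ↦ A y i j) Ω
  symm : ∀ y ∈ Ω, ∀ ξ η, covForm (A y) ξ η = covForm (A y) η ξ
  pos : ∀ y ∈ Ω, ∀ ξ, ξ ≠ 0 → 0 < covForm (A y) ξ ξ
  contDiffOn : ∀ t, ContDiffOn ℝ 1 (fun y ↦ h y t) Ω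
  lipschitz : ∀ y ∈ Ω, LipschitzWith C (h y)
  strictMonoOn : ∀ y ∈ Ω, StrictMonoOn (h y) (Icc 0 1)
  zero : ∀ y ∈ Ω, h y 0 = 0
  one : ∀ y ∈ Ω, h y 1 = 1
  mem_inv : ∀ y ∈ Ω, ∀ s ∈ Ico (0 : ℝ) 1, k y s ∈ Ico (0 : ℝ) 1
  right_inv : ∀ y ∈ Ω, ∀ s ∈ Ico (0 : ℝ) 1, h y (k y s) = s
  lipschitz_inv : ∀ y ∈ Ω, LipschitzWith C (k y)
  green : ∀ t f, ContDiff ℝ 1 f → HasCompactSupport f → tsupport f ⊆ Ω →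
    ∫ y, covForm (A y) (fderiv ℝ f y) (graphDeriv h t y) = 0

theorem exists_cutoff {S Ω : Set (EuclideanSpace ℝ (Fin n))} (hS : IsCompact S) (hΩ : IsOpen Ω)
    (hSΩ : S ⊆ Ω) : ∃ χ : EuclideanSpace ℝ (Fin n) → ℝ, ContDiff ℝ 1 χ ∧ HasCompactSupport χ ∧
      tsupport χ ⊆ Ω ∧ ∀ᶠ x in 𝓝ˢ S, χ x = 1 := by
  obtain ⟨L, hL, hSL, hLΩ⟩ := exists_compact_between hS hΩ hSΩ
  obtain ⟨f, h1, h2, -⟩ := exists_contMDiffMap_one_nhds_of_subset_interior (n := 1)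
    (𝓡 n) hS.isClosed hSL
  have hsupp : tsupport f ⊆ L := closure_minimal
    (fun x hx ↦ by by_contra h; exact hx (h2 x h)) hL.isClosed
  exact ⟨f, f.contMDiff.contDiff, hL.of_isClosed_subset (isClosed_tsupport _) hsupp,
    hsupp.trans hLΩ, h1⟩

theorem fderiv_eq_zero_of_notMem_tsupport {f : EuclideanSpace ℝ (Fin n) → ℝ}
    {y : EuclideanSpace ℝ (Fin n)} (hy : y ∉ tsupport f) : fderiv ℝ f y = 0 := by
  have h1 : f =ᶠ[𝓝 y] 0 := notMem_tsupport_iff_eventuallyEq.1 hy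
  rw [h1.fderiv_eq]
  simp

theorem integrable_of_continuousOn_of_eq_zero {g : EuclideanSpace ℝ (Fin n) → ℝ}
    {S Ω : Set (EuclideanSpace ℝ (Fin n))} (hS : IsCompact S) (hSΩ : S ⊆ Ω)
    (hg : ContinuousOn g Ω) (hg0 : ∀ y ∉ S, g y = 0) : Integrable g :=
  ((hg.mono hSΩ).integrableOn_compact hS).integrable_of_forall_notMem_eq_zero hg0

theorem contDiff_mul_of_tsupport_subset {f g : EuclideanSpace ℝ (Fin n) → ℝ}
    {Ω : Set (EuclideanSpace ℝ (Fin n))} (hΩ : IsOpen Ω) (hf : ContDiff ℝ 1 f)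
    (hfs : tsupport f ⊆ Ω) (hg : ContDiffOn ℝ 1 g Ω) : ContDiff ℝ 1 (fun y ↦ f y * g y) := by
  refine contDiff_iff_contDiffAt.2 fun y ↦ ?_
  by_cases hy : y ∈ Ω
  · exact hf.contDiffAt.mul (hg.contDiffAt (hΩ.mem_nhds hy))
  · have h1 : f =ᶠ[𝓝 y] 0 := notMem_tsupport_iff_eventuallyEq.1 fun h ↦ hy (hfs h)
    have h2 : (fun y ↦ f y * g y) =ᶠ[𝓝 y] fun _ ↦ 0 := by
      filter_upwards [h1] with z hz
      simp [hz]
    exact contDiffAt_const.congr_of_eventuallyEq h2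

namespace IsHarmonicGraphFamily

variable {Ω : Set (EuclideanSpace ℝ (Fin n))}
  {A : EuclideanSpace ℝ (Fin n) → Matrix (Fin n) (Fin n) ℝ}
  {h k : EuclideanSpace ℝ (Fin n) → ℝ → ℝ} {C : ℝ≥0}

theorem nonneg (H : IsHarmonicGraphFamily Ω A h k C) {y : EuclideanSpace ℝ (Fin n)} (hy : y ∈ Ω)
    (ξ : EuclideanSpace ℝ (Fin n) →L[ℝ] ℝ) : 0 ≤ covForm (A y) ξ ξ := by
  by_cases h : ξ = 0
  · rw [h, covForm_zero_left]
  · exact (H.pos y hy ξ h).le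

theorem mem_Icc (H : IsHarmonicGraphFamily Ω A h k C) {y : EuclideanSpace ℝ (Fin n)} (hy : y ∈ Ω)
    {t : ℝ} (ht : t ∈ Icc (0 : ℝ) 1) : h y t ∈ Icc (0 : ℝ) 1 := by
  have hm := (H.strictMonoOn y hy).monotoneOn
  rw [← H.zero y hy, ← H.one y hy]
  exact ⟨hm (by simp) ht ht.1, hm ht (by simp) ht.2⟩

theorem hasFDerivAt (H : IsHarmonicGraphFamily Ω A h k C) {y : EuclideanSpace ℝ (Fin n)}
    (hy : y ∈ Ω) (t : ℝ) : HasFDerivAt (fun z ↦ h z t) (graphDeriv h t y) y :=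
  (((H.contDiffOn t).differentiableOn (by norm_num)).differentiableAt
    (H.isOpen.mem_nhds hy)).hasFDerivAt

theorem continuousOn_graphDeriv (H : IsHarmonicGraphFamily Ω A h k C) (t : ℝ) :
    ContinuousOn (graphDeriv h t) Ω :=
  (H.contDiffOn t).continuousOn_fderiv_of_isOpen H.isOpen le_rfl

theorem graphDeriv_of_const (H : IsHarmonicGraphFamily Ω A h k C) {t c : ℝ}
    (hc : ∀ y ∈ Ω, h y t = c) {y : EuclideanSpace ℝ (Fin n)} (hy : y ∈ Ω) :
    graphDeriv h t y = 0 := by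
  have h1 : (fun z ↦ h z t) =ᶠ[𝓝 y] fun _ ↦ c := by
    filter_upwards [H.isOpen.mem_nhds hy] with z hz using hc z hz
  rw [graphDeriv, h1.fderiv_eq]
  simp

theorem continuousOn_covForm (H : IsHarmonicGraphFamily Ω A h k C)
    {ξ η : EuclideanSpace ℝ (Fin n) → EuclideanSpace ℝ (Fin n) →L[ℝ] ℝ}
    (hξ : ContinuousOn ξ Ω) (hη : ContinuousOn η Ω) :
    ContinuousOn (fun y ↦ covForm (A y) (ξ y) (η y)) Ω :=
  _root_.continuousOn_covForm H.continuousOn hξ hη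

/-- Caccioppoli's inequality for the differences `h · t - h · s`. -/
theorem exists_caccioppoli (H : IsHarmonicGraphFamily Ω A h k C)
    {χ : EuclideanSpace ℝ (Fin n) → ℝ} (hχ : ContDiff ℝ 1 χ) (hχc : HasCompactSupport χ)
    (hχs : tsupport χ ⊆ Ω) : ∃ B : ℝ, 0 ≤ B ∧ ∀ s t : ℝ,
      ∫ y, χ y ^ 2 * covForm (A y) (graphDeriv h t y - graphDeriv h s y)
        (graphDeriv h t y - graphDeriv h s y) ≤ B * (t - s) ^ 2 := by
  have hdχ : ContinuousOn (fun y ↦ fderiv ℝ χ y) Ω :=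
    (hχ.continuous_fderiv one_ne_zero).continuousOn
  have hintg : ∀ g : EuclideanSpace ℝ (Fin n) → ℝ, ContinuousOn g Ω →
      (∀ y ∉ tsupport χ, g y = 0) → Integrable g := fun g hg hg0 ↦
    integrable_of_continuousOn_of_eq_zero hχc hχs hg hg0
  have hnn : ∀ y, 0 ≤ covForm (A y) (fderiv ℝ χ y) (fderiv ℝ χ y) := fun y ↦ by
    by_cases hy : y ∈ tsupport χ
    · exact H.nonneg (hχs hy) _
    · rw [fderiv_eq_zero_of_notMem_tsupport hy, covForm_zero_left]
  refine ⟨4 * C ^ 2 * ∫ y, covForm (A y) (fderiv ℝ χ y) (fderiv ℝ χ y),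
    mul_nonneg (by positivity) (integral_nonneg hnn), fun s t ↦ ?_⟩
  set w : EuclideanSpace ℝ (Fin n) → ℝ := fun y ↦ h y t - h y s with hw
  set dw : EuclideanSpace ℝ (Fin n) → EuclideanSpace ℝ (Fin n) →L[ℝ] ℝ :=
    fun y ↦ graphDeriv h t y - graphDeriv h s y with hdw
  have hwd : ContDiffOn ℝ 1 w Ω := (H.contDiffOn t).sub (H.contDiffOn s)
  have hdwc : ContinuousOn dw Ω := (H.continuousOn_graphDeriv t).sub (H.continuousOn_graphDeriv s)
  have hwD : ∀ y ∈ Ω, HasFDerivAt w (dw y) y := fun y hy ↦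
    (H.hasFDerivAt hy t).sub (H.hasFDerivAt hy s)
  -- The usual test function `χ² w`; one factor `χ` is kept outside because it carries the compact
  -- support.
  set f : EuclideanSpace ℝ (Fin n) → ℝ := fun y ↦ χ y * (χ y * w y) with hf
  have hfd : ContDiff ℝ 1 f := contDiff_mul_of_tsupport_subset H.isOpen hχ hχs
    (hχ.contDiffOn.mul hwd)
  have hfs : tsupport f ⊆ tsupport χ := tsupport_mul_subset_left
  have hfc : HasCompactSupport f := hχc.of_isClosed_subset (isClosed_tsupport _) hfs
  have hdf : ∀ y ∈ Ω, fderiv ℝ f y = (χ y ^ 2) • dw y + (2 * χ y * w y) • fderiv ℝ χ y := by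
    intro y hy
    have h1 := (hχ.differentiable (by norm_num)).differentiableAt (x := y) |>.hasFDerivAt
    have h2 : HasFDerivAt f _ y := h1.mul (h1.mul (hwD y hy))
    rw [h2.fderiv]
    ext v
    simp only [add_apply, smul_apply, smul_eq_mul]
    ring
  let P : EuclideanSpace ℝ (Fin n) → ℝ := fun y ↦ χ y ^ 2 * covForm (A y) (dw y) (dw y)
  let R : EuclideanSpace ℝ (Fin n) → ℝ := fun y ↦ χ y * w y * covForm (A y) (fderiv ℝ χ y) (dw y)
  let S : EuclideanSpace ℝ (Fin n) → ℝ :=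
    fun y ↦ w y ^ 2 * covForm (A y) (fderiv ℝ χ y) (fderiv ℝ χ y)
  have hP : Integrable P := hintg _ ((hχ.continuous.continuousOn.pow 2).mul
    (H.continuousOn_covForm hdwc hdwc))
    fun y hy ↦ by simp [P, image_eq_zero_of_notMem_tsupport hy]
  have hR : Integrable R := hintg _ ((hχ.continuous.continuousOn.mul hwd.continuousOn).mul
    (H.continuousOn_covForm hdχ hdwc))
    fun y hy ↦ by simp [R, image_eq_zero_of_notMem_tsupport hy]
  have hS : Integrable S := hintg _ ((hwd.continuousOn.pow 2).mul
    (H.continuousOn_covForm hdχ hdχ))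
    fun y hy ↦ by simp [S, fderiv_eq_zero_of_notMem_tsupport hy, covForm_zero_left]
  have hT : Integrable fun y ↦ covForm (A y) (fderiv ℝ χ y) (fderiv ℝ χ y) := hintg _
    (H.continuousOn_covForm hdχ hdχ)
    fun y hy ↦ by simp [fderiv_eq_zero_of_notMem_tsupport hy, covForm_zero_left]
  have hfd0 : ∀ y ∉ tsupport χ, fderiv ℝ f y = 0 := fun y hy ↦
    fderiv_eq_zero_of_notMem_tsupport fun h ↦ hy (hfs h)
  have hg : ∀ t, Integrable fun y ↦ covForm (A y) (fderiv ℝ f y) (graphDeriv h t y) := fun t ↦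
    hintg _ (H.continuousOn_covForm (hfd.continuous_fderiv one_ne_zero).continuousOn
      (H.continuousOn_graphDeriv t)) fun y hy ↦ by rw [hfd0 y hy, covForm_zero_left]
  have hgreen : ∫ y, covForm (A y) (fderiv ℝ f y) (dw y) = 0 := by
    simp only [hdw, covForm_sub_right]
    rw [integral_sub (hg t) (hg s), H.green t f hfd hfc (hfs.trans hχs),
      H.green s f hfd hfc (hfs.trans hχs), sub_zero]
  have hPR : (∫ y, P y) + 2 * ∫ y, R y = 0 := by
    rw [← integral_const_mul, ← integral_add hP (hR.const_mul 2), ← hgreen]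
    refine integral_congr_ae (Eventually.of_forall fun y ↦ ?_)
    by_cases hy : y ∈ tsupport χ
    · simp only [hdf y (hχs hy), covForm_add_left, covForm_smul_left, P, R]
      ring
    · simp [P, R, image_eq_zero_of_notMem_tsupport hy, hfd0 y hy, covForm_zero_left]
  -- The integrand is the square of `χ dw + 2 w dχ`. Together with `∫ P = -2 ∫ R` this gives `∫ P ≤
  -- 4 ∫ S`.
  have hneg : 0 ≤ (∫ y, P y) + 4 * (∫ y, R y) + 4 * ∫ y, S y := by
    have hPR4 : Integrable fun y ↦ P y + 4 * R y := hP.add (hR.const_mul 4)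
    rw [← integral_const_mul, ← integral_const_mul, ← integral_add hP (hR.const_mul 4),
      ← integral_add hPR4 (hS.const_mul 4)]
    refine integral_nonneg fun y ↦ ?_
    by_cases hy : y ∈ tsupport χ
    · have h1 := H.nonneg (hχs hy) (χ y • dw y + (2 * w y) • fderiv ℝ χ y)
      simp only [covForm_add_left, covForm_add_right, covForm_smul_left, covForm_smul_right,
        H.symm y (hχs hy) (dw y) (fderiv ℝ χ y)] at h1
      simp only [P, R, S, Pi.zero_apply]
      nlinarith [h1]
    · simp [P, R, S, image_eq_zero_of_notMem_tsupport hy, fderiv_eq_zero_of_notMem_tsupport hy,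
        covForm_zero_left]
  -- This is where Lipschitz holonomy enters: `|w| ≤ C |t - s|` pointwise.
  have hSle : ∫ y, S y ≤ C ^ 2 * (t - s) ^ 2 *
      ∫ y, covForm (A y) (fderiv ℝ χ y) (fderiv ℝ χ y) := by
    rw [← integral_const_mul]
    refine integral_mono hS (hT.const_mul _) fun y ↦ ?_
    by_cases hy : y ∈ tsupport χ
    · have h1 := (H.lipschitz y (hχs hy)).dist_le_mul t s
      rw [Real.dist_eq, Real.dist_eq] at h1
      have h2 : w y ^ 2 ≤ C ^ 2 * (t - s) ^ 2 := by
        rw [← mul_pow, sq_le_sq, abs_mul, NNReal.abs_eq]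
        exact h1
      exact mul_le_mul_of_nonneg_right h2 (hnn y)
    · simp [S, fderiv_eq_zero_of_notMem_tsupport hy, covForm_zero_left]
  have : ∫ y, P y ≤ 4 * ∫ y, S y := by linarith
  calc ∫ y, P y ≤ 4 * ∫ y, S y := this
    _ ≤ _ := by nlinarith

end IsHarmonicGraphFamily

end GraphFamily

/-! ### Discretization of the integrand and telescoping -/

section GraphFamily

variable {n : ℕ}

/-- The integrand `s ⟪dψ, a⟫ + ψ |a|² / 2`, where `a y s` is the leafwise differential of the
height function at `(y, s)`. -/
noncomputable def leafDensity (A : EuclideanSpace ℝ (Fin n) → Matrix (Fin n) (Fin n) ℝ)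
    (ψ : EuclideanSpace ℝ (Fin n) → ℝ)
    (a : EuclideanSpace ℝ (Fin n) → ℝ → EuclideanSpace ℝ (Fin n) →L[ℝ] ℝ)
    (y : EuclideanSpace ℝ (Fin n)) (s : ℝ) : ℝ :=
  s * covForm (A y) (fderiv ℝ ψ y) (a y s) + 1 / 2 * ψ y * covForm (A y) (a y s) (a y s)

/-- The approximation of `leafDensity` between the graphs of `h · t₀` and `h · t₁`. -/
noncomputable def stepDensity (A : EuclideanSpace ℝ (Fin n) → Matrix (Fin n) (Fin n) ℝ)
    (h : EuclideanSpace ℝ (Fin n) → ℝ → ℝ) (ψ : EuclideanSpace ℝ (Fin n) → ℝ) (t₀ t₁ : ℝ)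
    (y : EuclideanSpace ℝ (Fin n)) (s : ℝ) : ℝ :=
  s * (1 / 2 * covForm (A y) (fderiv ℝ ψ y) (graphDeriv h t₀ y + graphDeriv h t₁ y)) +
    1 / 2 * ψ y * covForm (A y) (graphDeriv h t₀ y) (graphDeriv h t₁ y)

theorem integrable_sq_mul {Ω : Set (EuclideanSpace ℝ (Fin n))}
    {χ : EuclideanSpace ℝ (Fin n) → ℝ} (hχ : ContDiff ℝ 1 χ) (hχc : HasCompactSupport χ)
    (hχs : tsupport χ ⊆ Ω) {g : EuclideanSpace ℝ (Fin n) → ℝ} (hg : ContinuousOn g Ω) :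
    Integrable fun y ↦ χ y ^ 2 * g y :=
  integrable_of_continuousOn_of_eq_zero hχc hχs ((hχ.continuous.continuousOn.pow 2).mul hg)
    fun y hy ↦ by simp [image_eq_zero_of_notMem_tsupport hy]

namespace IsHarmonicGraphFamily

variable {Ω : Set (EuclideanSpace ℝ (Fin n))}
  {A : EuclideanSpace ℝ (Fin n) → Matrix (Fin n) (Fin n) ℝ}
  {h k : EuclideanSpace ℝ (Fin n) → ℝ → ℝ} {C : ℝ≥0}

/-- In the weighted Cauchy-Schwarz inequality, the weight `ε = |t - s|` balances the fixed energy of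
`ξ` against the Caccioppoli bound `B (t - s)²`; both contributions become linear in `|t - s|`. -/
theorem integral_abs_covForm_sub_le (H : IsHarmonicGraphFamily Ω A h k C)
    {χ : EuclideanSpace ℝ (Fin n) → ℝ} (hχ : ContDiff ℝ 1 χ) (hχc : HasCompactSupport χ)
    (hχs : tsupport χ ⊆ Ω) {B : ℝ} {s t : ℝ}
    (hB : ∫ y, χ y ^ 2 * covForm (A y) (graphDeriv h t y - graphDeriv h s y)
        (graphDeriv h t y - graphDeriv h s y) ≤ B * (t - s) ^ 2)
    {ξ : EuclideanSpace ℝ (Fin n) → EuclideanSpace ℝ (Fin n) →L[ℝ] ℝ} (hξ : ContinuousOn ξ Ω) :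
    ∫ y, χ y ^ 2 * |covForm (A y) (ξ y) (graphDeriv h t y - graphDeriv h s y)| ≤
      ((∫ y, χ y ^ 2 * covForm (A y) (ξ y) (ξ y)) + B) * |t - s| := by
  rcases eq_or_ne t s with rfl | hts
  · simp [covForm_zero_right]
  set ε := |t - s| with hε
  have hε0 : 0 < ε := abs_pos.2 (sub_ne_zero.2 hts)
  set dw : EuclideanSpace ℝ (Fin n) → EuclideanSpace ℝ (Fin n) →L[ℝ] ℝ :=
    fun y ↦ graphDeriv h t y - graphDeriv h s y with hdw
  have hdwc : ContinuousOn dw Ω := (H.continuousOn_graphDeriv t).sub (H.continuousOn_graphDeriv s)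
  have h1 := integrable_sq_mul hχ hχc hχs (H.continuousOn_covForm hξ hdwc).abs
  have h2 := integrable_sq_mul hχ hχc hχs (H.continuousOn_covForm hξ hξ)
  have h3 := integrable_sq_mul hχ hχc hχs (H.continuousOn_covForm hdwc hdwc)
  calc ∫ y, χ y ^ 2 * |covForm (A y) (ξ y) (dw y)|
      ≤ ∫ y, (ε * (χ y ^ 2 * covForm (A y) (ξ y) (ξ y)) +
          ε⁻¹ * (χ y ^ 2 * covForm (A y) (dw y) (dw y))) := by
        refine integral_mono h1 ((h2.const_mul ε).add (h3.const_mul ε⁻¹)) fun y ↦ ?_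
        by_cases hy : y ∈ tsupport χ
        · have := mul_le_mul_of_nonneg_left (abs_covForm_le (H.symm y (hχs hy))
            (H.nonneg (hχs hy)) (ξ y) (dw y) hε0) (sq_nonneg (χ y))
          dsimp only
          linarith
        · simp [image_eq_zero_of_notMem_tsupport hy]
    _ = ε * (∫ y, χ y ^ 2 * covForm (A y) (ξ y) (ξ y)) +
          ε⁻¹ * ∫ y, χ y ^ 2 * covForm (A y) (dw y) (dw y) := by
        rw [integral_add (h2.const_mul ε) (h3.const_mul ε⁻¹), integral_const_mul,
          integral_const_mul]
    _ ≤ ε * (∫ y, χ y ^ 2 * covForm (A y) (ξ y) (ξ y)) + ε⁻¹ * (B * ε ^ 2) := by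
        rw [hε, sq_abs, ← hε]
        gcongr
    _ = _ := by field_simp

theorem leafDensity_sub_stepDensity (H : IsHarmonicGraphFamily Ω A h k C)
    {y : EuclideanSpace ℝ (Fin n)} (hy : y ∈ Ω) {ψ : EuclideanSpace ℝ (Fin n) → ℝ}
    {a : EuclideanSpace ℝ (Fin n) → ℝ → EuclideanSpace ℝ (Fin n) →L[ℝ] ℝ} {t t₀ t₁ : ℝ}
    (ha : a y (h y t) = graphDeriv h t y) :
    leafDensity A ψ a y (h y t) - stepDensity A h ψ t₀ t₁ y (h y t) =
      h y t / 2 * (covForm (A y) (fderiv ℝ ψ y) (graphDeriv h t y - graphDeriv h t₀ y) +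
        covForm (A y) (fderiv ℝ ψ y) (graphDeriv h t y - graphDeriv h t₁ y)) +
      ψ y / 2 * (covForm (A y) (graphDeriv h t y) (graphDeriv h t y - graphDeriv h t₀ y) +
        covForm (A y) (graphDeriv h t₀ y) (graphDeriv h t y - graphDeriv h t₁ y)) := by
  rw [leafDensity, stepDensity, ha]
  simp only [covForm_sub_right, covForm_add_right]
  rw [H.symm y hy (graphDeriv h t₀ y) (graphDeriv h t y)]
  ring

/-- Every term of `leafDensity_sub_stepDensity` contains a difference of differentials at parameters
at most `t₁ - t₀` apart, which Caccioppoli's inequality controls. The bound is uniform in `t`, ready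
to be integrated over the parameters. -/
theorem exists_leafDensity_sub_stepDensity_le (H : IsHarmonicGraphFamily Ω A h k C)
    {ψ : EuclideanSpace ℝ (Fin n) → ℝ} (hψ : ContDiff ℝ 1 ψ) (hψc : HasCompactSupport ψ)
    (hψs : tsupport ψ ⊆ Ω)
    {a : EuclideanSpace ℝ (Fin n) → ℝ → EuclideanSpace ℝ (Fin n) →L[ℝ] ℝ}
    (ha : ∀ y ∈ Ω, ∀ t ∈ Ico (0 : ℝ) 1, a y (h y t) = graphDeriv h t y) :
    ∃ B : ℝ, 0 ≤ B ∧ ∀ t₀ t t₁ : ℝ, 0 ≤ t₀ → t₀ ≤ t → t < t₁ → t₁ ≤ 1 →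
      ∫⁻ y, ‖leafDensity A ψ a y (h y t) - stepDensity A h ψ t₀ t₁ y (h y t)‖ₑ ≤
        ENNReal.ofReal (B * (t₁ - t₀)) := by
  obtain ⟨χ, hχ, hχc, hχs, hχ1⟩ := exists_cutoff hψc.isCompact H.isOpen hψs
  have hχψ : ∀ y ∈ tsupport ψ, χ y = 1 := fun y hy ↦ hχ1.self_of_nhdsSet y hy
  obtain ⟨B, hB0, hB⟩ := H.exists_caccioppoli hχ hχc hχs
  obtain ⟨M, hM⟩ := hψc.exists_bound_of_continuous hψ.continuous
  have hM0 : 0 ≤ M := (norm_nonneg _).trans (hM 0)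
  have hdψ : ContinuousOn (fun y ↦ fderiv ℝ ψ y) Ω :=
    (hψ.continuous_fderiv one_ne_zero).continuousOn
  set B₀ := ∫ y, χ y ^ 2 * covForm (A y) (fderiv ℝ ψ y) (fderiv ℝ ψ y) with hB₀
  have hB₀0 : 0 ≤ B₀ := integral_nonneg fun y ↦ by
    by_cases hy : y ∈ tsupport χ
    · exact mul_nonneg (sq_nonneg _) (H.nonneg (hχs hy) _)
    · simp [image_eq_zero_of_notMem_tsupport hy]
  -- The graph at parameter `0` is horizontal, so Caccioppoli's inequality against `s = 0` bounds
  -- the energy of every graph.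
  have hV : ∀ r ∈ Icc (0 : ℝ) 1,
      ∫ y, χ y ^ 2 * covForm (A y) (graphDeriv h r y) (graphDeriv h r y) ≤ B := by
    intro r hr
    have h1 := hB 0 r
    have h2 : ∫ y, χ y ^ 2 * covForm (A y) (graphDeriv h r y) (graphDeriv h r y) =
        ∫ y, χ y ^ 2 * covForm (A y) (graphDeriv h r y - graphDeriv h 0 y)
          (graphDeriv h r y - graphDeriv h 0 y) := by
      refine integral_congr_ae (Eventually.of_forall fun y ↦ ?_)
      by_cases hy : y ∈ tsupport χ
      · simp only [H.graphDeriv_of_const H.zero (hχs hy), sub_zero]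
      · simp [image_eq_zero_of_notMem_tsupport hy]
    rw [h2]
    refine h1.trans (mul_le_of_le_one_right hB0 ?_)
    rw [sub_zero]
    exact pow_le_one₀ hr.1 hr.2
  -- Two terms in `dψ` with weight `1 / 2` each, and two quadratic terms with weight `M / 2` each.
  refine ⟨(B₀ + B) + M * (B + B), by positivity, fun t₀ t t₁ h0 h1 h2 h3 ↦ ?_⟩
  have ht : t ∈ Ico (0 : ℝ) 1 := ⟨h0.trans h1, h2.trans_le h3⟩
  have hI1 := fun s ↦ H.integral_abs_covForm_sub_le hχ hχc hχs (hB s t) hdψ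
  have hI2 := fun r s ↦ H.integral_abs_covForm_sub_le hχ hχc hχs (hB s t)
    (H.continuousOn_graphDeriv r)
  have hsub : ∀ s, ContinuousOn (fun y ↦ graphDeriv h t y - graphDeriv h s y) Ω := fun s ↦
    (H.continuousOn_graphDeriv t).sub (H.continuousOn_graphDeriv s)
  have hJ1 := fun s ↦ integrable_sq_mul hχ hχc hχs (H.continuousOn_covForm hdψ (hsub s)).abs
  have hJ2 := fun r s ↦ integrable_sq_mul hχ hχc hχs
    (H.continuousOn_covForm (H.continuousOn_graphDeriv r) (hsub s)).abs
  set g : EuclideanSpace ℝ (Fin n) → ℝ := fun y ↦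
    1 / 2 * (χ y ^ 2 * |covForm (A y) (fderiv ℝ ψ y) (graphDeriv h t y - graphDeriv h t₀ y)|) +
    1 / 2 * (χ y ^ 2 * |covForm (A y) (fderiv ℝ ψ y) (graphDeriv h t y - graphDeriv h t₁ y)|) +
    M / 2 * (χ y ^ 2 * |covForm (A y) (graphDeriv h t y) (graphDeriv h t y - graphDeriv h t₀ y)|) +
    M / 2 * (χ y ^ 2 * |covForm (A y) (graphDeriv h t₀ y) (graphDeriv h t y - graphDeriv h t₁ y)|)
    with hg
  have i1 := (hJ1 t₀).const_mul (1 / 2)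
  have i2 := (hJ1 t₁).const_mul (1 / 2)
  have i3 := (hJ2 t t₀).const_mul (M / 2)
  have i4 := (hJ2 t₀ t₁).const_mul (M / 2)
  have hgi : Integrable g := ((i1.add i2).add i3).add i4
  have hgint : ∫ y, g y ≤ ((B₀ + B) + M * (B + B)) * (t₁ - t₀) := by
    have e : ∫ y, g y = _ := (integral_add ((i1.add i2).add i3) i4).trans
      (congrArg (· + _) ((integral_add (i1.add i2) i3).trans
        (congrArg (· + _) (integral_add i1 i2))))
    rw [e]
    simp only [integral_const_mul]
    have a1 : |t - t₀| ≤ t₁ - t₀ := by rw [abs_of_nonneg (by linarith)]; linarith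
    have a2 : |t - t₁| ≤ t₁ - t₀ := by rw [abs_sub_comm, abs_of_nonneg (by linarith)]; linarith
    have e1 := (hI1 t₀).trans (mul_le_mul_of_nonneg_left a1 (by positivity))
    have e2 := (hI1 t₁).trans (mul_le_mul_of_nonneg_left a2 (by positivity))
    have v1 := hV t ⟨ht.1, ht.2.le⟩
    have v2 := hV t₀ ⟨h0, by linarith⟩
    have e3 : _ ≤ (B + B) * (t₁ - t₀) := (hI2 t t₀).trans
      (mul_le_mul (by linarith) a1 (abs_nonneg _) (by positivity))
    have e4 : _ ≤ (B + B) * (t₁ - t₀) := (hI2 t₀ t₁).trans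
      (mul_le_mul (by linarith) a2 (abs_nonneg _) (by positivity))
    have e3' := mul_le_mul_of_nonneg_left e3 (show 0 ≤ M / 2 by positivity)
    have e4' := mul_le_mul_of_nonneg_left e4 (show 0 ≤ M / 2 by positivity)
    linarith
  have hpt : ∀ y, |leafDensity A ψ a y (h y t) - stepDensity A h ψ t₀ t₁ y (h y t)| ≤ g y := by
    intro y
    by_cases hy : y ∈ tsupport ψ
    · have hyΩ := hψs hy
      rw [H.leafDensity_sub_stepDensity hyΩ (ha y hyΩ t ht)]
      have hh := H.mem_Icc hyΩ ⟨ht.1, ht.2.le⟩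
      have hm : |ψ y| ≤ M := hM y
      simp only [hg, hχψ y hy, one_pow, one_mul]
      refine (abs_add_le _ _).trans ?_
      rw [abs_mul, abs_mul, abs_div, abs_div, abs_of_nonneg hh.1, abs_two]
      have p1 := abs_add_le (covForm (A y) (fderiv ℝ ψ y) (graphDeriv h t y - graphDeriv h t₀ y))
        (covForm (A y) (fderiv ℝ ψ y) (graphDeriv h t y - graphDeriv h t₁ y))
      have p2 := abs_add_le (covForm (A y) (graphDeriv h t y) (graphDeriv h t y - graphDeriv h t₀ y))
        (covForm (A y) (graphDeriv h t₀ y) (graphDeriv h t y - graphDeriv h t₁ y))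
      have q1 := mul_le_mul (show h y t / 2 ≤ 1 / 2 by linarith [hh.2]) p1 (abs_nonneg _)
        (by norm_num)
      have q2 := mul_le_mul (show |ψ y| / 2 ≤ M / 2 by linarith) p2 (abs_nonneg _)
        (by positivity)
      linarith
    · have : leafDensity A ψ a y (h y t) - stepDensity A h ψ t₀ t₁ y (h y t) = 0 := by
        simp [leafDensity, stepDensity, fderiv_eq_zero_of_notMem_tsupport hy,
          image_eq_zero_of_notMem_tsupport hy, covForm_zero_left]
      rw [this, abs_zero, hg]
      positivity
  calc ∫⁻ y, ‖leafDensity A ψ a y (h y t) - stepDensity A h ψ t₀ t₁ y (h y t)‖ₑ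
      ≤ ∫⁻ y, ENNReal.ofReal (g y) := by
        refine lintegral_mono fun y ↦ ?_
        rw [← ofReal_norm, Real.norm_eq_abs]
        exact ENNReal.ofReal_le_ofReal (hpt y)
    _ = ENNReal.ofReal (∫ y, g y) :=
        (ofReal_integral_eq_lintegral_ofReal hgi
          (Eventually.of_forall fun y ↦ (abs_nonneg _).trans (hpt y))).symm
    _ ≤ _ := ENNReal.ofReal_le_ofReal hgint

/-- The integral of `stepDensity` over the fiber between the graphs of `h · t₀` and `h · t₁`. -/
noncomputable def stepIntegral (A : EuclideanSpace ℝ (Fin n) → Matrix (Fin n) (Fin n) ℝ)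
    (h : EuclideanSpace ℝ (Fin n) → ℝ → ℝ) (ψ : EuclideanSpace ℝ (Fin n) → ℝ) (t₀ t₁ : ℝ)
    (y : EuclideanSpace ℝ (Fin n)) : ℝ :=
  (h y t₁ ^ 2 - h y t₀ ^ 2) / 4 *
      covForm (A y) (fderiv ℝ ψ y) (graphDeriv h t₀ y + graphDeriv h t₁ y) +
    ψ y / 2 * (h y t₁ - h y t₀) * covForm (A y) (graphDeriv h t₀ y) (graphDeriv h t₁ y)

/-- Green's formula is applied to `ψ (h₁² - h₀²) / 4` against `dh₀ + dh₁`, both graphs being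
harmonic. The mixed products give exactly the quadratic part of `stepIntegral`, and the pure squares
form a difference of one expression at `t₀` and at `t₁`. This is why `stepDensity` uses the mean of
the differentials in its linear term but their product in its quadratic term. -/
theorem integral_stepIntegral (H : IsHarmonicGraphFamily Ω A h k C)
    {ψ : EuclideanSpace ℝ (Fin n) → ℝ} (hψ : ContDiff ℝ 1 ψ) (hψc : HasCompactSupport ψ)
    (hψs : tsupport ψ ⊆ Ω) (t₀ t₁ : ℝ) :
    Integrable (stepIntegral A h ψ t₀ t₁) ∧ ∫ y, stepIntegral A h ψ t₀ t₁ y =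
      (∫ y, ψ y / 2 * (h y t₀ * covForm (A y) (graphDeriv h t₀ y) (graphDeriv h t₀ y))) -
      ∫ y, ψ y / 2 * (h y t₁ * covForm (A y) (graphDeriv h t₁ y) (graphDeriv h t₁ y)) := by
  have hdψ : ContinuousOn (fun y ↦ fderiv ℝ ψ y) Ω :=
    (hψ.continuous_fderiv one_ne_zero).continuousOn
  have hintg : ∀ g : EuclideanSpace ℝ (Fin n) → ℝ, ContinuousOn g Ω →
      (∀ y ∉ tsupport ψ, g y = 0) → Integrable g := fun g hg hg0 ↦
    integrable_of_continuousOn_of_eq_zero hψc hψs hg hg0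
  have hh := fun t ↦ (H.contDiffOn t).continuousOn
  have hD := H.continuousOn_graphDeriv
  have hi1 : Integrable (stepIntegral A h ψ t₀ t₁) := by
    refine hintg _ ?_ fun y hy ↦ by
      simp [stepIntegral, fderiv_eq_zero_of_notMem_tsupport hy,
        image_eq_zero_of_notMem_tsupport hy, covForm_zero_left]
    exact (((((hh t₁).pow 2).sub ((hh t₀).pow 2)).div_const 4).mul
      (H.continuousOn_covForm hdψ ((hD t₀).add (hD t₁)))).add
      (((hψ.continuous.continuousOn.div_const 2).mul ((hh t₁).sub (hh t₀))).mul
        (H.continuousOn_covForm (hD t₀) (hD t₁)))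
  have hi2 : ∀ t, Integrable fun y ↦
      ψ y / 2 * (h y t * covForm (A y) (graphDeriv h t y) (graphDeriv h t y)) := fun t ↦
    hintg _ ((hψ.continuous.continuousOn.div_const 2).mul ((hh t).mul
      (H.continuousOn_covForm (hD t) (hD t)))) fun y hy ↦ by
        simp [image_eq_zero_of_notMem_tsupport hy]
  refine ⟨hi1, ?_⟩
  set f : EuclideanSpace ℝ (Fin n) → ℝ := fun y ↦ ψ y * ((h y t₁ ^ 2 - h y t₀ ^ 2) / 4) with hf
  have hfd : ContDiff ℝ 1 f := contDiff_mul_of_tsupport_subset H.isOpen hψ hψs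
    ((((H.contDiffOn t₁).pow 2).sub ((H.contDiffOn t₀).pow 2)).div_const 4)
  have hfs : tsupport f ⊆ tsupport ψ := tsupport_mul_subset_left
  have hfc : HasCompactSupport f := hψc.of_isClosed_subset (isClosed_tsupport _) hfs
  have hfd0 : ∀ y ∉ tsupport ψ, fderiv ℝ f y = 0 := fun y hy ↦
    fderiv_eq_zero_of_notMem_tsupport fun h ↦ hy (hfs h)
  have hdf : ∀ y ∈ Ω, fderiv ℝ f y = ((h y t₁ ^ 2 - h y t₀ ^ 2) / 4) • fderiv ℝ ψ y +
      (ψ y / 2) • (h y t₁ • graphDeriv h t₁ y - h y t₀ • graphDeriv h t₀ y) := by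
    intro y hy
    have h1 := (hψ.differentiable (by norm_num)).differentiableAt (x := y) |>.hasFDerivAt
    have h2 : HasFDerivAt f _ y := h1.mul
      ((((H.hasFDerivAt hy t₁).pow 2).sub ((H.hasFDerivAt hy t₀).pow 2)).mul_const' (4⁻¹ : ℝ))
    rw [h2.fderiv]
    ext v
    simp only [add_apply, smul_apply, smul_eq_mul, sub_apply]
    simp
    ring
  have hg : ∀ t, Integrable fun y ↦ covForm (A y) (fderiv ℝ f y) (graphDeriv h t y) := fun t ↦
    hintg _ (H.continuousOn_covForm (hfd.continuous_fderiv one_ne_zero).continuousOn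
      (hD t)) fun y hy ↦ by rw [hfd0 y hy, covForm_zero_left]
  have hgreen : ∫ y, covForm (A y) (fderiv ℝ f y) (graphDeriv h t₀ y + graphDeriv h t₁ y) = 0 := by
    simp only [covForm_add_right]
    rw [integral_add (hg t₀) (hg t₁), H.green t₀ f hfd hfc (hfs.trans hψs),
      H.green t₁ f hfd hfc (hfs.trans hψs), add_zero]
  have hi3 : Integrable fun y ↦
      ψ y / 2 * (h y t₀ * covForm (A y) (graphDeriv h t₀ y) (graphDeriv h t₀ y)) -
      ψ y / 2 * (h y t₁ * covForm (A y) (graphDeriv h t₁ y) (graphDeriv h t₁ y)) :=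
    (hi2 t₀).sub (hi2 t₁)
  rw [← sub_eq_zero, ← hgreen, ← integral_sub (hi2 t₀) (hi2 t₁), ← integral_sub hi1 hi3]
  refine integral_congr_ae (Eventually.of_forall fun y ↦ ?_)
  by_cases hy : y ∈ tsupport ψ
  · simp only [hdf y (hψs hy), covForm_add_left, covForm_add_right, covForm_smul_left,
      covForm_sub_left, stepIntegral, H.symm y (hψs hy) (graphDeriv h t₁ y) (graphDeriv h t₀ y)]
    ring
  · simp [stepIntegral, image_eq_zero_of_notMem_tsupport hy, hfd0 y hy, covForm_zero_left,
      fderiv_eq_zero_of_notMem_tsupport hy]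

/-- The sum telescopes, and the two end terms vanish because the boundary leaves are horizontal. -/
theorem integral_sum_stepIntegral (H : IsHarmonicGraphFamily Ω A h k C)
    {ψ : EuclideanSpace ℝ (Fin n) → ℝ} (hψ : ContDiff ℝ 1 ψ) (hψc : HasCompactSupport ψ)
    (hψs : tsupport ψ ⊆ Ω) {N : ℕ} (hN : N ≠ 0) :
    ∫ y, ∑ i ∈ Finset.range N, stepIntegral A h ψ (i / N) ((i + 1 : ℕ) / N) y = 0 := by
  rw [integral_finsetSum _ fun i _ ↦ (H.integral_stepIntegral hψ hψc hψs _ _).1]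
  simp only [(H.integral_stepIntegral hψ hψc hψs _ _).2]
  rw [Finset.sum_range_sub' (fun i : ℕ ↦ ∫ y, ψ y / 2 * (h y (i / N) *
    covForm (A y) (graphDeriv h (i / N) y) (graphDeriv h (i / N) y)))]
  have h1 : ((N : ℝ) / N) = 1 := div_self (by exact_mod_cast hN)
  rw [h1, Nat.cast_zero, zero_div, sub_eq_zero]
  refine integral_congr_ae (Eventually.of_forall fun y ↦ ?_)
  by_cases hy : y ∈ tsupport ψ
  · simp only [H.graphDeriv_of_const H.zero (hψs hy), H.graphDeriv_of_const H.one (hψs hy),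
      covForm_zero_left, mul_zero]
  · simp [image_eq_zero_of_notMem_tsupport hy]

end IsHarmonicGraphFamily

end GraphFamily

/-! ### Change of variable on the fibers, measurability and the step functions -/

section GraphFamily

variable {n : ℕ}

/-- Lebesgue measure on the line is one-dimensional Hausdorff measure, so no measurability of `s` is
needed. -/
theorem volume_image_le_of_lipschitzWith {f : ℝ → ℝ} {C : ℝ≥0} (hf : LipschitzWith C f)
    (s : Set ℝ) : volume (f '' s) ≤ C * volume s := by
  have := hf.hausdorffMeasure_image_le (d := 1) zero_le_one s
  simpa [hausdorffMeasure_real] using this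

/-- The indicator function of `a ≤ s < b`. -/
noncomputable def stepWeight (a b s : ℝ) : ℝ := if a ≤ s ∧ s < b then 1 else 0

theorem measurable_stepWeight : Measurable fun p : ℝ × ℝ × ℝ ↦ stepWeight p.1 p.2.1 p.2.2 :=
  Measurable.ite ((measurableSet_le measurable_fst (measurable_snd.comp measurable_snd)).inter
    (measurableSet_lt (measurable_snd.comp measurable_snd) (measurable_fst.comp measurable_snd)))
    measurable_const measurable_const

theorem abs_stepWeight_le (a b s : ℝ) : |stepWeight a b s| ≤ 1 := by
  unfold stepWeight
  split_ifs <;> simp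

theorem integral_affine_mul_stepWeight {a b : ℝ} (ha : 0 ≤ a) (hab : a ≤ b) (hb : b ≤ 1)
    (α β : ℝ) : ∫ s in Ico (0 : ℝ) 1, (s * α + β) * stepWeight a b s =
      (b ^ 2 - a ^ 2) / 2 * α + (b - a) * β := by
  have h1 : (fun s ↦ (s * α + β) * stepWeight a b s) =
      (Ico a b).indicator fun s ↦ s * α + β := by
    ext s
    by_cases hs : s ∈ Ico a b
    · have hs' : a ≤ s ∧ s < b := hs
      rw [indicator_of_mem hs, stepWeight, if_pos hs', mul_one]
    · have hs' : ¬ (a ≤ s ∧ s < b) := hs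
      rw [indicator_of_notMem hs, stepWeight, if_neg hs', mul_zero]
  rw [h1, setIntegral_indicator measurableSet_Ico,
    inter_eq_self_of_subset_right (Ico_subset_Ico ha hb), integral_Ico_eq_integral_Ioc,
    ← intervalIntegral.integral_of_le hab, intervalIntegral.integral_add
      ((show Continuous fun s ↦ s * α by fun_prop).intervalIntegrable _ _) (by simp),
    intervalIntegral.integral_mul_const, integral_id, intervalIntegral.integral_const, smul_eq_mul]

namespace IsHarmonicGraphFamily

variable {Ω : Set (EuclideanSpace ℝ (Fin n))}
  {A : EuclideanSpace ℝ (Fin n) → Matrix (Fin n) (Fin n) ℝ}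
  {h k : EuclideanSpace ℝ (Fin n) → ℝ → ℝ} {C : ℝ≥0}

theorem continuousOn_uncurry (H : IsHarmonicGraphFamily Ω A h k C) :
    ContinuousOn (fun p : EuclideanSpace ℝ (Fin n) × ℝ ↦ h p.1 p.2) (Ω ×ˢ univ) :=
  continuousOn_prod_of_continuousOn_lipschitzOnWith' _ C
    (fun y hy ↦ (H.lipschitz y hy).lipschitzOnWith) fun t _ ↦ (H.contDiffOn t).continuousOn

theorem mem_Ico (H : IsHarmonicGraphFamily Ω A h k C) {y : EuclideanSpace ℝ (Fin n)} (hy : y ∈ Ω)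
    {t : ℝ} (ht : t ∈ Ico (0 : ℝ) 1) : h y t ∈ Ico (0 : ℝ) 1 := by
  refine ⟨(H.mem_Icc hy ⟨ht.1, ht.2.le⟩).1, ?_⟩
  rw [← H.one y hy]
  exact H.strictMonoOn y hy ⟨ht.1, ht.2.le⟩ (by simp) ht.2

theorem left_inv (H : IsHarmonicGraphFamily Ω A h k C) {y : EuclideanSpace ℝ (Fin n)} (hy : y ∈ Ω)
    {t : ℝ} (ht : t ∈ Ico (0 : ℝ) 1) : k y (h y t) = t := by
  have h1 := H.mem_Ico hy ht
  exact (H.strictMonoOn y hy).injOn (Ico_subset_Icc_self (H.mem_inv y hy _ h1))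
    (Ico_subset_Icc_self ht) (H.right_inv y hy _ h1)

/-- For fixed `s`, the Lipschitz bound on the inverses gives `|k z s - k y s| ≤ C |s - h z (k y
s)|`, which tends to `0` as `z` tends to `y` since `h y (k y s) = s`. -/
theorem continuousOn_uncurry_inv (H : IsHarmonicGraphFamily Ω A h k C) :
    ContinuousOn (fun p : EuclideanSpace ℝ (Fin n) × ℝ ↦ k p.1 p.2) (Ω ×ˢ Ico 0 1) := by
  refine continuousOn_prod_of_continuousOn_lipschitzOnWith' _ C
    (fun y hy ↦ (H.lipschitz_inv y hy).lipschitzOnWith) fun s hs y hy ↦ ?_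
  have ht := H.mem_inv y hy s hs
  have h1 : Tendsto (fun z ↦ C * |s - h z (k y s)|) (𝓝[Ω] y) (𝓝 0) := by
    have h2 : ContinuousWithinAt (fun z ↦ C * |s - h z (k y s)|) Ω y :=
      continuousWithinAt_const.mul
        ((continuousWithinAt_const.sub ((H.contDiffOn (k y s)).continuousOn y hy)).abs)
    have h3 := h2.tendsto
    simpa only [H.right_inv y hy s hs, sub_self, abs_zero, mul_zero] using h3
  refine tendsto_iff_dist_tendsto_zero.2 (squeeze_zero' (Eventually.of_forall fun _ ↦ dist_nonneg)
    ?_ h1)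
  filter_upwards [self_mem_nhdsWithin] with z hz
  have h4 := (H.lipschitz_inv z hz).dist_le_mul s (h z (k y s))
  rwa [H.left_inv hz ht, Real.dist_eq s] at h4

/-- Each set of heights is the image under `h y` of its preimage, so Lebesgue measure is at most `C`
times its push-forward. This one-sided change of variable suffices for error estimates and needs no
derivative in `t`. -/
theorem lintegral_fiber_le (H : IsHarmonicGraphFamily Ω A h k C) {y : EuclideanSpace ℝ (Fin n)}
    (hy : y ∈ Ω) (g : ℝ → ENNReal) :
    ∫⁻ s in Ico (0 : ℝ) 1, g s ≤ C * ∫⁻ t in Ico (0 : ℝ) 1, g (h y t) := by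
  have hle : (volume.restrict (Ico (0 : ℝ) 1)) ≤
      (C : ENNReal) • (volume.restrict (Ico (0 : ℝ) 1)).map (h y) := by
    refine Measure.le_iff.2 fun s hs ↦ ?_
    rw [Measure.smul_apply, Measure.map_apply (H.lipschitz y hy).continuous.measurable hs,
      Measure.restrict_apply hs,
      Measure.restrict_apply ((H.lipschitz y hy).continuous.measurable hs), smul_eq_mul]
    refine (measure_mono ?_).trans (volume_image_le_of_lipschitzWith (H.lipschitz y hy) _)
    rintro r ⟨hr, hr1⟩
    refine ⟨k y r, ⟨?_, H.mem_inv y hy r hr1⟩, H.right_inv y hy r hr1⟩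
    rw [mem_preimage, H.right_inv y hy r hr1]
    exact hr
  calc ∫⁻ s in Ico (0 : ℝ) 1, g s
      ≤ ∫⁻ s, g s ∂((C : ENNReal) • (volume.restrict (Ico (0 : ℝ) 1)).map (h y)) :=
        lintegral_mono' hle le_rfl
    _ = C * ∫⁻ s, g s ∂((volume.restrict (Ico (0 : ℝ) 1)).map (h y)) := lintegral_smul_measure _ _
    _ ≤ _ := mul_le_mul' le_rfl (lintegral_map_le g (h y))

/-- The derivative of a jointly continuous family is jointly measurable. A cutoff equal to `1` near
`S` extends the family continuously to the whole space without changing its derivative on `S`. -/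
theorem exists_measurable_graphDeriv (H : IsHarmonicGraphFamily Ω A h k C)
    {S : Set (EuclideanSpace ℝ (Fin n))} (hS : IsCompact S) (hSΩ : S ⊆ Ω) :
    ∃ D : ℝ × EuclideanSpace ℝ (Fin n) → EuclideanSpace ℝ (Fin n) →L[ℝ] ℝ,
      Measurable D ∧ ∀ y ∈ S, ∀ t, D (t, y) = graphDeriv h t y := by
  obtain ⟨χ, hχ, -, hχs, hχ1⟩ := exists_cutoff hS H.isOpen hSΩ
  let f : ℝ → EuclideanSpace ℝ (Fin n) → ℝ := fun t y ↦ χ y * h y t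
  have hf : Continuous f.uncurry := by
    refine continuous_iff_continuousAt.2 ?_
    rintro ⟨t, y⟩
    by_cases hy : y ∈ Ω
    · have h1 : ContinuousAt (fun p : EuclideanSpace ℝ (Fin n) × ℝ ↦ h p.1 p.2) (y, t) :=
        H.continuousOn_uncurry.continuousAt
          ((H.isOpen.prod isOpen_univ).mem_nhds ⟨hy, mem_univ _⟩)
      have h2 : ContinuousAt (fun p : ℝ × EuclideanSpace ℝ (Fin n) ↦ h p.2 p.1) (t, y) :=
        ContinuousAt.comp (f := Prod.swap) (x := (t, y)) h1 continuous_swap.continuousAt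
      exact (hχ.continuous.comp continuous_snd).continuousAt.mul h2
    · have h1 : χ =ᶠ[𝓝 y] 0 := notMem_tsupport_iff_eventuallyEq.1 fun h ↦ hy (hχs h)
      have h2 : f.uncurry =ᶠ[𝓝 (t, y)] fun _ ↦ 0 := by
        filter_upwards [continuous_snd.continuousAt.eventually h1] with p hp
        simp only [Function.uncurry, f]
        rw [hp]
        simp
      exact continuousAt_const.congr h2.symm
  refine ⟨_, measurable_fderiv_with_param ℝ hf, fun y hy t ↦ ?_⟩
  have h1 : f t =ᶠ[𝓝 y] fun z ↦ h z t := by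
    filter_upwards [hχ1.filter_mono (nhds_le_nhdsSet hy)] with z hz
    simp [f, hz]
  exact h1.fderiv_eq

theorem aemeasurable_of_continuousOn (H : IsHarmonicGraphFamily Ω A h k C) {F : Type*}
    [TopologicalSpace F] [MeasurableSpace F] [BorelSpace F]
    {f : EuclideanSpace ℝ (Fin n) × ℝ → F} (hf : ContinuousOn f (Ω ×ˢ Ico 0 1)) :
    AEMeasurable f (volume.restrict (Ω ×ˢ Ico (0 : ℝ) 1)) :=
  hf.aemeasurable (H.isOpen.measurableSet.prod measurableSet_Ico)

theorem aemeasurable_of_continuousOn_fst (H : IsHarmonicGraphFamily Ω A h k C) {F : Type*}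
    [TopologicalSpace F] [MeasurableSpace F] [BorelSpace F]
    {f : EuclideanSpace ℝ (Fin n) → F} (hf : ContinuousOn f Ω) :
    AEMeasurable (fun p : EuclideanSpace ℝ (Fin n) × ℝ ↦ f p.1)
      (volume.restrict (Ω ×ˢ Ico (0 : ℝ) 1)) :=
  H.aemeasurable_of_continuousOn (hf.comp continuousOn_fst fun _ hp ↦ hp.1)

/-- Serves twice: with height `s` and parameter `k y s`, and with height `h y t` and parameter `t`.
-/
theorem aemeasurable_leafDensity_aux (H : IsHarmonicGraphFamily Ω A h k C)
    {ψ : EuclideanSpace ℝ (Fin n) → ℝ} (hψ : ContDiff ℝ 1 ψ) (hψc : HasCompactSupport ψ)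
    (hψs : tsupport ψ ⊆ Ω)
    {b : EuclideanSpace ℝ (Fin n) × ℝ → EuclideanSpace ℝ (Fin n) →L[ℝ] ℝ}
    {σ τ : EuclideanSpace ℝ (Fin n) × ℝ → ℝ}
    (hσ : AEMeasurable σ (volume.restrict (Ω ×ˢ Ico (0 : ℝ) 1)))
    (hτ : AEMeasurable τ (volume.restrict (Ω ×ˢ Ico (0 : ℝ) 1)))
    (hb : ∀ p ∈ Ω ×ˢ Ico (0 : ℝ) 1, b p = graphDeriv h (τ p) p.1) :
    AEMeasurable (fun p : EuclideanSpace ℝ (Fin n) × ℝ ↦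
      σ p * covForm (A p.1) (fderiv ℝ ψ p.1) (b p) +
        1 / 2 * ψ p.1 * covForm (A p.1) (b p) (b p)) (volume.restrict (Ω ×ˢ Ico (0 : ℝ) 1)) := by
  obtain ⟨D, hD, hDS⟩ := H.exists_measurable_graphDeriv hψc.isCompact hψs
  have hA := fun i j ↦ H.aemeasurable_of_continuousOn_fst (H.continuousOn i j)
  have hdψ := H.aemeasurable_of_continuousOn_fst
    (hψ.continuous_fderiv one_ne_zero).continuousOn
  have hψm := H.aemeasurable_of_continuousOn_fst hψ.continuous.continuousOn
  have hD' : AEMeasurable (fun p : EuclideanSpace ℝ (Fin n) × ℝ ↦ D (τ p, p.1))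
      (volume.restrict (Ω ×ˢ Ico (0 : ℝ) 1)) :=
    hD.comp_aemeasurable (hτ.prodMk measurable_fst.aemeasurable)
  refine ((hσ.mul (aemeasurable_covForm hA hdψ hD')).add
    ((hψm.const_mul (1 / 2)).mul (aemeasurable_covForm hA hD' hD'))).congr ?_
  filter_upwards [ae_restrict_mem (H.isOpen.measurableSet.prod measurableSet_Ico)] with p hp
  by_cases hy : p.1 ∈ tsupport ψ
  · simp only [Pi.add_apply, Pi.mul_apply, hb p hp, hDS p.1 hy]
  · simp [fderiv_eq_zero_of_notMem_tsupport hy, image_eq_zero_of_notMem_tsupport hy,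
      covForm_zero_left]

/-- The step function approximating `leafDensity`. -/
noncomputable def stepSum (A : EuclideanSpace ℝ (Fin n) → Matrix (Fin n) (Fin n) ℝ)
    (h : EuclideanSpace ℝ (Fin n) → ℝ → ℝ) (ψ : EuclideanSpace ℝ (Fin n) → ℝ) (N : ℕ)
    (y : EuclideanSpace ℝ (Fin n)) (s : ℝ) : ℝ :=
  ∑ i ∈ Finset.range N, stepDensity A h ψ (i / N) ((i + 1 : ℕ) / N) y s *
    stepWeight (h y (i / N)) (h y ((i + 1 : ℕ) / N)) s

theorem aemeasurable_stepSum_comp (H : IsHarmonicGraphFamily Ω A h k C)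
    {ψ : EuclideanSpace ℝ (Fin n) → ℝ} (hψ : ContDiff ℝ 1 ψ) (N : ℕ)
    {σ : EuclideanSpace ℝ (Fin n) × ℝ → ℝ}
    (hσ : AEMeasurable σ (volume.restrict (Ω ×ˢ Ico (0 : ℝ) 1))) :
    AEMeasurable (fun p : EuclideanSpace ℝ (Fin n) × ℝ ↦ stepSum A h ψ N p.1 (σ p))
      (volume.restrict (Ω ×ˢ Ico (0 : ℝ) 1)) := by
  have hdψ : ContinuousOn (fun y ↦ fderiv ℝ ψ y) Ω :=
    (hψ.continuous_fderiv one_ne_zero).continuousOn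
  have hD := H.continuousOn_graphDeriv
  refine Finset.aemeasurable_fun_sum _ fun i _ ↦ ?_
  have h1 := fun t ↦ H.aemeasurable_of_continuousOn_fst (H.contDiffOn t).continuousOn
  refine AEMeasurable.mul ?_
    (measurable_stepWeight.comp_aemeasurable
      ((h1 (i / N)).prodMk ((h1 ((i + 1 : ℕ) / N)).prodMk hσ)))
  exact (hσ.mul ((H.aemeasurable_of_continuousOn_fst
    (H.continuousOn_covForm hdψ ((hD (i / N)).add (hD ((i + 1 : ℕ) / N))))).const_mul (1 / 2))).add
    (((H.aemeasurable_of_continuousOn_fst hψ.continuous.continuousOn).const_mul (1 / 2)).mul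
      (H.aemeasurable_of_continuousOn_fst (H.continuousOn_covForm (hD _) (hD _))))

theorem stepSum_apply (H : IsHarmonicGraphFamily Ω A h k C) {ψ : EuclideanSpace ℝ (Fin n) → ℝ}
    {N : ℕ} (hN : N ≠ 0) {t : ℝ} (ht : t ∈ Ico (0 : ℝ) 1) :
    ∃ i < N, (i / N : ℝ) ≤ t ∧ t < (i + 1 : ℕ) / N ∧ ∀ y ∈ Ω,
      stepSum A h ψ N y (h y t) = stepDensity A h ψ (i / N) ((i + 1 : ℕ) / N) y (h y t) := by
  have hN0 : (0 : ℝ) < N := by exact_mod_cast Nat.pos_of_ne_zero hN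
  have hNt : 0 ≤ (N : ℝ) * t := mul_nonneg hN0.le ht.1
  have h1 : (⌊(N : ℝ) * t⌋₊ : ℝ) ≤ N * t := Nat.floor_le hNt
  have h2 : (N : ℝ) * t < ⌊(N : ℝ) * t⌋₊ + 1 := Nat.lt_floor_add_one _
  have hiN : ⌊(N : ℝ) * t⌋₊ < N := by
    rw [Nat.floor_lt hNt]
    nlinarith [ht.2]
  have htIcc := Ico_subset_Icc_self ht
  have hw : ∀ y ∈ Ω, ∀ j < N, stepWeight (h y (j / N)) (h y ((j + 1 : ℕ) / N)) (h y t) =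
      if j = ⌊(N : ℝ) * t⌋₊ then 1 else 0 := by
    intro y hy j hj
    have m1 : (j / N : ℝ) ∈ Icc (0 : ℝ) 1 :=
      ⟨by positivity, by rw [div_le_one hN0]; exact_mod_cast hj.le⟩
    have m2 : ((j + 1 : ℕ) / N : ℝ) ∈ Icc (0 : ℝ) 1 :=
      ⟨by positivity, by rw [div_le_one hN0]; exact_mod_cast hj⟩
    have e : (h y (j / N) ≤ h y t ∧ h y t < h y ((j + 1 : ℕ) / N)) ↔ j = ⌊(N : ℝ) * t⌋₊ := by
      rw [(H.strictMonoOn y hy).le_iff_le m1 htIcc, (H.strictMonoOn y hy).lt_iff_lt htIcc m2,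
        div_le_iff₀ hN0, lt_div_iff₀ hN0, eq_comm, Nat.floor_eq_iff hNt, mul_comm t]
      push_cast
      rfl
    rw [stepWeight]
    simp only [e]
  -- The slab has index `⌊N t⌋`. Half-open slabs make it unique, and `t < 1` keeps it below `N`.
  refine ⟨_, hiN, ?_, ?_, ?_⟩
  · rw [div_le_iff₀ hN0]; linarith
  · rw [lt_div_iff₀ hN0]; push_cast; linarith
  · intro y hy
    rw [stepSum, Finset.sum_eq_single ⌊(N : ℝ) * t⌋₊]
    · rw [hw y hy _ hiN, if_pos rfl, mul_one]
    · intro j hj hne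
      rw [hw y hy j (Finset.mem_range.1 hj), if_neg hne, mul_zero]
    · intro hh
      exact absurd (Finset.mem_range.2 hiN) hh

theorem volume_restrict_prod (Ω : Set (EuclideanSpace ℝ (Fin n))) :
    (volume : Measure (EuclideanSpace ℝ (Fin n) × ℝ)).restrict (Ω ×ˢ Ico (0 : ℝ) 1) =
      (volume.restrict Ω).prod (volume.restrict (Ico (0 : ℝ) 1)) := by
  rw [Measure.prod_restrict]
  rfl

theorem integral_stepSum (H : IsHarmonicGraphFamily Ω A h k C)
    {ψ : EuclideanSpace ℝ (Fin n) → ℝ} (hψ : ContDiff ℝ 1 ψ) (hψc : HasCompactSupport ψ)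
    (hψs : tsupport ψ ⊆ Ω) {N : ℕ} (hN : N ≠ 0) :
    IntegrableOn (fun p : EuclideanSpace ℝ (Fin n) × ℝ ↦ stepSum A h ψ N p.1 p.2)
      (Ω ×ˢ Ico (0 : ℝ) 1) ∧
    ∫ p in Ω ×ˢ Ico (0 : ℝ) 1, stepSum A h ψ N p.1 p.2 = 0 := by
  have hN0 : (0 : ℝ) < N := by exact_mod_cast Nat.pos_of_ne_zero hN
  have hdψ : ContinuousOn (fun y ↦ fderiv ℝ ψ y) Ω :=
    (hψ.continuous_fderiv one_ne_zero).continuousOn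
  have hD := H.continuousOn_graphDeriv
  have hintg : IntegrableOn (fun p : EuclideanSpace ℝ (Fin n) × ℝ ↦ stepSum A h ψ N p.1 p.2)
      (Ω ×ˢ Ico (0 : ℝ) 1) := by
    let g : EuclideanSpace ℝ (Fin n) → ℝ := fun y ↦ ∑ i ∈ Finset.range N,
      (|1 / 2 * covForm (A y) (fderiv ℝ ψ y)
          (graphDeriv h (i / N) y + graphDeriv h ((i + 1 : ℕ) / N) y)| +
        |1 / 2 * ψ y * covForm (A y) (graphDeriv h (i / N) y) (graphDeriv h ((i + 1 : ℕ) / N) y)|)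
    have hg : Integrable g := by
      refine integrable_of_continuousOn_of_eq_zero hψc hψs ?_ fun y hy ↦ by
        simp [g, fderiv_eq_zero_of_notMem_tsupport hy, image_eq_zero_of_notMem_tsupport hy,
          covForm_zero_left]
      refine continuousOn_finsetSum _ fun i _ ↦ ContinuousOn.add ?_ ?_
      · exact (continuousOn_const.mul (H.continuousOn_covForm hdψ ((hD _).add (hD _)))).abs
      · exact ((continuousOn_const.mul hψ.continuous.continuousOn).mul
          (H.continuousOn_covForm (hD _) (hD _))).abs
    have hg' : IntegrableOn (fun p : EuclideanSpace ℝ (Fin n) × ℝ ↦ g p.1)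
        (Ω ×ˢ Ico (0 : ℝ) 1) := by
      rw [IntegrableOn, volume_restrict_prod]
      exact hg.integrableOn.comp_fst _
    refine hg'.mono'
      (H.aemeasurable_stepSum_comp hψ N measurable_snd.aemeasurable).aestronglyMeasurable ?_
    filter_upwards [ae_restrict_mem (H.isOpen.measurableSet.prod measurableSet_Ico)] with p hp
    refine (norm_sum_le _ _).trans (Finset.sum_le_sum fun i _ ↦ ?_)
    rw [Real.norm_eq_abs, abs_mul]
    refine (mul_le_of_le_one_right (abs_nonneg _) (abs_stepWeight_le _ _ _)).trans ?_
    refine (abs_add_le _ _).trans (add_le_add_left ?_ _)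
    rw [abs_mul]
    refine mul_le_of_le_one_left (abs_nonneg _) ?_
    rw [abs_of_nonneg hp.2.1]
    exact hp.2.2.le
  refine ⟨hintg, ?_⟩
  rw [IntegrableOn, volume_restrict_prod] at hintg
  rw [volume_restrict_prod, integral_prod _ hintg]
  have hfib : ∀ y ∈ Ω, ∫ s in Ico (0 : ℝ) 1, stepSum A h ψ N y s =
      ∑ i ∈ Finset.range N, stepIntegral A h ψ (i / N) ((i + 1 : ℕ) / N) y := by
    intro y hy
    have hm : ∀ i < N, 0 ≤ h y (i / N) ∧ h y (i / N) ≤ h y ((i + 1 : ℕ) / N) ∧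
        h y ((i + 1 : ℕ) / N) ≤ 1 := by
      intro i hi
      have m1 : (i / N : ℝ) ∈ Icc (0 : ℝ) 1 :=
        ⟨by positivity, by rw [div_le_one hN0]; exact_mod_cast hi.le⟩
      have m2 : ((i + 1 : ℕ) / N : ℝ) ∈ Icc (0 : ℝ) 1 :=
        ⟨by positivity, by rw [div_le_one hN0]; exact_mod_cast hi⟩
      refine ⟨(H.mem_Icc hy m1).1, (H.strictMonoOn y hy).monotoneOn m1 m2 ?_, (H.mem_Icc hy m2).2⟩
      gcongr
      simp
    unfold stepSum
    rw [integral_finsetSum]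
    · refine Finset.sum_congr rfl fun i hi ↦ ?_
      obtain ⟨m1, m2, m3⟩ := hm i (Finset.mem_range.1 hi)
      unfold stepDensity
      rw [integral_affine_mul_stepWeight m1 m2 m3, stepIntegral]
      ring
    · intro i _
      have hc : Continuous fun s ↦ stepDensity A h ψ (i / N) ((i + 1 : ℕ) / N) y s := by
        unfold stepDensity
        fun_prop
      have hI : IntegrableOn (fun s ↦ stepDensity A h ψ (i / N) ((i + 1 : ℕ) / N) y s)
          (Ico (0 : ℝ) 1) :=
        (hc.continuousOn.integrableOn_compact isCompact_Icc).mono_set Ico_subset_Icc_self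
      refine hI.mul_bdd (c := 1) ?_ (Eventually.of_forall fun s ↦ abs_stepWeight_le _ _ s)
      exact (measurable_stepWeight.comp
        (measurable_const.prodMk (measurable_const.prodMk measurable_id))).aestronglyMeasurable
  rw [setIntegral_congr_fun H.isOpen.measurableSet hfib,
    setIntegral_eq_integral_of_forall_compl_eq_zero]
  · exact H.integral_sum_stepIntegral hψ hψc hψs hN
  · intro y hy
    have hy' : y ∉ tsupport ψ := fun h ↦ hy (hψs h)
    simp [stepIntegral, fderiv_eq_zero_of_notMem_tsupport hy',
      image_eq_zero_of_notMem_tsupport hy', covForm_zero_left]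

end IsHarmonicGraphFamily

end GraphFamily

/-! ### The integral identity in a box, and rigidity when the differential vanishes -/

section GraphFamily

variable {n : ℕ}

namespace IsHarmonicGraphFamily

variable {Ω : Set (EuclideanSpace ℝ (Fin n))}
  {A : EuclideanSpace ℝ (Fin n) → Matrix (Fin n) (Fin n) ℝ}
  {h k : EuclideanSpace ℝ (Fin n) → ℝ → ℝ} {C : ℝ≥0}
  {a : EuclideanSpace ℝ (Fin n) → ℝ → EuclideanSpace ℝ (Fin n) →L[ℝ] ℝ}
  {ψ : EuclideanSpace ℝ (Fin n) → ℝ}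

theorem aemeasurable_leafDensity (H : IsHarmonicGraphFamily Ω A h k C)
    (ha : ∀ y ∈ Ω, ∀ t ∈ Ico (0 : ℝ) 1, a y (h y t) = graphDeriv h t y)
    (hψ : ContDiff ℝ 1 ψ) (hψc : HasCompactSupport ψ) (hψs : tsupport ψ ⊆ Ω) :
    AEMeasurable (fun p : EuclideanSpace ℝ (Fin n) × ℝ ↦ leafDensity A ψ a p.1 p.2)
      (volume.restrict (Ω ×ˢ Ico (0 : ℝ) 1)) := by
  refine H.aemeasurable_leafDensity_aux hψ hψc hψs measurable_snd.aemeasurable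
    (H.aemeasurable_of_continuousOn H.continuousOn_uncurry_inv) fun p hp ↦ ?_
  rw [← ha p.1 hp.1 _ (H.mem_inv _ hp.1 _ hp.2), H.right_inv _ hp.1 _ hp.2]

theorem aemeasurable_leafDensity_graph (H : IsHarmonicGraphFamily Ω A h k C)
    (ha : ∀ y ∈ Ω, ∀ t ∈ Ico (0 : ℝ) 1, a y (h y t) = graphDeriv h t y)
    (hψ : ContDiff ℝ 1 ψ) (hψc : HasCompactSupport ψ) (hψs : tsupport ψ ⊆ Ω) :
    AEMeasurable (fun p : EuclideanSpace ℝ (Fin n) × ℝ ↦ leafDensity A ψ a p.1 (h p.1 p.2))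
      (volume.restrict (Ω ×ˢ Ico (0 : ℝ) 1)) :=
  H.aemeasurable_leafDensity_aux hψ hψc hψs
    (H.aemeasurable_of_continuousOn (H.continuousOn_uncurry.mono
      (prod_mono le_rfl (subset_univ _)))) measurable_snd.aemeasurable
    fun p hp ↦ ha p.1 hp.1 _ hp.2

/-- The height variable is replaced by the leaf parameter at the cost of a factor `C`, and the
integrals are exchanged. On each single graph the error is then at most `B / N`. -/
theorem lintegral_leafDensity_sub_stepSum_le (H : IsHarmonicGraphFamily Ω A h k C)
    (ha : ∀ y ∈ Ω, ∀ t ∈ Ico (0 : ℝ) 1, a y (h y t) = graphDeriv h t y)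
    (hψ : ContDiff ℝ 1 ψ) (hψc : HasCompactSupport ψ) (hψs : tsupport ψ ⊆ Ω) :
    ∃ B : ℝ, 0 ≤ B ∧ ∀ N : ℕ, N ≠ 0 →
      ∫⁻ p in Ω ×ˢ Ico (0 : ℝ) 1, ‖leafDensity A ψ a p.1 p.2 - stepSum A h ψ N p.1 p.2‖ₑ ≤
        ENNReal.ofReal (B / N) := by
  obtain ⟨B, hB0, hB⟩ := H.exists_leafDensity_sub_stepDensity_le hψ hψc hψs ha
  refine ⟨C * B, by positivity, fun N hN ↦ ?_⟩
  have hN0 : (0 : ℝ) < N := by exact_mod_cast Nat.pos_of_ne_zero hN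
  have hm1 := ((H.aemeasurable_leafDensity ha hψ hψc hψs).sub
    (H.aemeasurable_stepSum_comp hψ N measurable_snd.aemeasurable)).enorm
  have hm2 := ((H.aemeasurable_leafDensity_graph ha hψ hψc hψs).sub
    (H.aemeasurable_stepSum_comp hψ N (H.aemeasurable_of_continuousOn
      (H.continuousOn_uncurry.mono (prod_mono le_rfl (subset_univ _)))))).enorm
  rw [volume_restrict_prod] at hm1 hm2
  have h1 : ∀ t ∈ Ico (0 : ℝ) 1, ∫⁻ y in Ω,
      ‖leafDensity A ψ a y (h y t) - stepSum A h ψ N y (h y t)‖ₑ ≤ ENNReal.ofReal (B / N) := by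
    intro t ht
    obtain ⟨i, hi, h1, h2, h3⟩ := H.stepSum_apply (ψ := ψ) hN ht
    calc ∫⁻ y in Ω, ‖leafDensity A ψ a y (h y t) - stepSum A h ψ N y (h y t)‖ₑ
        = ∫⁻ y in Ω, ‖leafDensity A ψ a y (h y t) -
            stepDensity A h ψ (i / N) ((i + 1 : ℕ) / N) y (h y t)‖ₑ :=
          setLIntegral_congr_fun H.isOpen.measurableSet fun y hy ↦ by simp only [h3 y hy]
      _ ≤ ∫⁻ y, ‖leafDensity A ψ a y (h y t) -
            stepDensity A h ψ (i / N) ((i + 1 : ℕ) / N) y (h y t)‖ₑ := setLIntegral_le_lintegral _ _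
      _ ≤ ENNReal.ofReal (B * ((i + 1 : ℕ) / N - i / N)) :=
          hB _ _ _ (by positivity) h1 h2 (by rw [div_le_one hN0]; exact_mod_cast hi)
      _ = ENNReal.ofReal (B / N) := by
          congr 1
          push_cast
          ring
  calc ∫⁻ p in Ω ×ˢ Ico (0 : ℝ) 1, ‖leafDensity A ψ a p.1 p.2 - stepSum A h ψ N p.1 p.2‖ₑ
      = ∫⁻ y in Ω, ∫⁻ s in Ico (0 : ℝ) 1,
          ‖leafDensity A ψ a y s - stepSum A h ψ N y s‖ₑ := by
        rw [volume_restrict_prod]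
        exact lintegral_prod _ hm1
    _ ≤ ∫⁻ y in Ω, C * ∫⁻ t in Ico (0 : ℝ) 1,
          ‖leafDensity A ψ a y (h y t) - stepSum A h ψ N y (h y t)‖ₑ :=
        setLIntegral_mono' H.isOpen.measurableSet fun y hy ↦ H.lintegral_fiber_le hy _
    _ = C * ∫⁻ y in Ω, ∫⁻ t in Ico (0 : ℝ) 1,
          ‖leafDensity A ψ a y (h y t) - stepSum A h ψ N y (h y t)‖ₑ :=
        lintegral_const_mul' _ _ ENNReal.coe_ne_top
    _ = C * ∫⁻ t in Ico (0 : ℝ) 1, ∫⁻ y in Ω,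
          ‖leafDensity A ψ a y (h y t) - stepSum A h ψ N y (h y t)‖ₑ := by
        rw [lintegral_lintegral_swap hm2]
    _ ≤ C * ∫⁻ _ in Ico (0 : ℝ) 1, ENNReal.ofReal (B / N) :=
        mul_le_mul' le_rfl (setLIntegral_mono' measurableSet_Ico h1)
    _ = ENNReal.ofReal (C * B / N) := by
        rw [setLIntegral_const, Real.volume_Ico, sub_zero, ENNReal.ofReal_one, mul_one,
          mul_div_assoc, ENNReal.ofReal_mul C.coe_nonneg, ENNReal.ofReal_coe_nnreal]

/-- The product of the Riemannian volume and of the Lebesgue measure on the fibers is a harmonic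
measure; this is the local form of that fact, tested against `ψ` times half the squared height. -/
theorem integral_leafDensity (H : IsHarmonicGraphFamily Ω A h k C)
    (ha : ∀ y ∈ Ω, ∀ t ∈ Ico (0 : ℝ) 1, a y (h y t) = graphDeriv h t y)
    (hψ : ContDiff ℝ 1 ψ) (hψc : HasCompactSupport ψ) (hψs : tsupport ψ ⊆ Ω) :
    IntegrableOn (fun p : EuclideanSpace ℝ (Fin n) × ℝ ↦ leafDensity A ψ a p.1 p.2)
      (Ω ×ˢ Ico (0 : ℝ) 1) ∧
    ∫ p in Ω ×ˢ Ico (0 : ℝ) 1, leafDensity A ψ a p.1 p.2 = 0 := by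
  obtain ⟨B, hB0, hB⟩ := H.lintegral_leafDensity_sub_stepSum_le ha hψ hψc hψs
  have hm := H.aemeasurable_leafDensity ha hψ hψc hψs
  have hS := fun N hN ↦ H.integral_stepSum hψ hψc hψs (N := N) hN
  have hF : IntegrableOn (fun p : EuclideanSpace ℝ (Fin n) × ℝ ↦ leafDensity A ψ a p.1 p.2)
      (Ω ×ˢ Ico (0 : ℝ) 1) := by
    have h1 : IntegrableOn (fun p : EuclideanSpace ℝ (Fin n) × ℝ ↦
        leafDensity A ψ a p.1 p.2 - stepSum A h ψ 1 p.1 p.2) (Ω ×ˢ Ico (0 : ℝ) 1) :=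
      ⟨(hm.sub (H.aemeasurable_stepSum_comp hψ 1
        measurable_snd.aemeasurable)).aestronglyMeasurable,
        (hB 1 one_ne_zero).trans_lt ENNReal.ofReal_lt_top⟩
    refine (h1.add (hS 1 one_ne_zero).1).congr (Eventually.of_forall fun p ↦ ?_)
    simp
  refine ⟨hF, ?_⟩
  -- The step functions have integral exactly zero, so the whole integral is bounded by the
  -- approximation error.
  have hle : ∀ N : ℕ, N ≠ 0 → |∫ p in Ω ×ˢ Ico (0 : ℝ) 1, leafDensity A ψ a p.1 p.2| ≤ B / N := by
    intro N hN
    have h1 := integral_sub hF (hS N hN).1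
    rw [(hS N hN).2, sub_zero] at h1
    have h2 := (enorm_integral_le_lintegral_enorm _).trans (hB N hN)
    rw [h1, ← ofReal_norm, ENNReal.ofReal_le_ofReal_iff (by positivity)] at h2
    exact h2
  have hlim : Tendsto (fun N : ℕ ↦ B / (N : ℝ)) atTop (𝓝 0) :=
    tendsto_const_div_atTop_nhds_zero_nat B
  have := ge_of_tendsto hlim
    (b := |∫ p in Ω ×ˢ Ico (0 : ℝ) 1, leafDensity A ψ a p.1 p.2|) (by
      filter_upwards [eventually_ne_atTop 0] with N hN using hle N hN)
  exact abs_nonpos_iff.1 this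

/-- After exchanging quantifiers by Fubini, for almost every `t` the differential of `h · t`
vanishes almost everywhere. It is continuous in `y`, hence zero on the ball, and `h · t` is constant
there; continuity in `t` reaches the remaining parameters. -/
theorem eq_of_ae_eq_zero (H : IsHarmonicGraphFamily Ω A h k C)
    (ha : ∀ y ∈ Ω, ∀ t ∈ Ico (0 : ℝ) 1, a y (h y t) = graphDeriv h t y)
    {y₀ : EuclideanSpace ℝ (Fin n)} {r : ℝ} (hr : 0 < r) (hball : Metric.closedBall y₀ r ⊆ Ω)
    (h0 : ∀ᵐ p ∂(volume : Measure (EuclideanSpace ℝ (Fin n) × ℝ)).restrict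
      (Metric.ball y₀ r ×ˢ Ico (0 : ℝ) 1), a p.1 p.2 = 0) :
    ∀ t ∈ Icc (0 : ℝ) 1, ∀ y ∈ Metric.ball y₀ r, h y t = h y₀ t := by
  have hbΩ : Metric.ball y₀ r ⊆ Ω := Metric.ball_subset_closedBall.trans hball
  have hy₀ : y₀ ∈ Metric.ball y₀ r := Metric.mem_ball_self hr
  obtain ⟨D, hD, hDS⟩ := H.exists_measurable_graphDeriv (isCompact_closedBall y₀ r) hball
  rw [volume_restrict_prod] at h0
  have h1 : ∀ᵐ y ∂(volume : Measure (EuclideanSpace ℝ (Fin n))).restrict (Metric.ball y₀ r),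
      ∀ᵐ t ∂(volume : Measure ℝ).restrict (Ico (0 : ℝ) 1), D (t, y) = 0 := by
    filter_upwards [Measure.ae_ae_of_ae_prod h0, ae_restrict_mem Metric.isOpen_ball.measurableSet]
      with y hy hyb
    rw [ae_restrict_iff' measurableSet_Ico, ae_iff] at hy ⊢
    -- The exceptional parameters lie in the image under the Lipschitz map `k y` of the null set of
    -- exceptional heights.
    refine measure_mono_null ?_ (le_antisymm ((volume_image_le_of_lipschitzWith
      (H.lipschitz_inv y (hbΩ hyb)) _).trans (by rw [hy, mul_zero])) zero_le)
    intro t ht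
    simp only [mem_ofPred_eq, Classical.not_imp] at ht
    refine ⟨h y t, ?_, H.left_inv (hbΩ hyb) ht.1⟩
    simp only [mem_ofPred_eq, Classical.not_imp]
    refine ⟨H.mem_Ico (hbΩ hyb) ht.1, ?_⟩
    rw [ha y (hbΩ hyb) t ht.1, ← hDS y (Metric.ball_subset_closedBall hyb)]
    exact ht.2
  have h2 := (Measure.ae_ae_comm (p := fun y t ↦ D (t, y) = 0)
    (hD.comp measurable_swap (measurableSet_singleton 0))).1 h1
  have h3 : ∀ᵐ t ∂(volume : Measure ℝ).restrict (Ico (0 : ℝ) 1),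
      ∀ y ∈ Metric.ball y₀ r, h y t = h y₀ t := by
    filter_upwards [h2] with t ht y hy
    have h4 : EqOn (graphDeriv h t) 0 (Metric.ball y₀ r) := by
      refine Measure.eqOn_open_of_ae_eq (μ := volume) ?_ Metric.isOpen_ball
        ((H.continuousOn_graphDeriv t).mono hbΩ) continuousOn_const
      filter_upwards [ht, ae_restrict_mem Metric.isOpen_ball.measurableSet] with z hz hzb
      rw [← hDS z (Metric.ball_subset_closedBall hzb), hz]
      rfl
    exact Metric.isOpen_ball.is_const_of_fderiv_eq_zero (𝕜 := ℝ) (f := fun z ↦ h z t)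
      (convex_ball y₀ r).isPreconnected
      (((H.contDiffOn t).differentiableOn (by norm_num)).mono hbΩ) h4 hy hy₀
  intro t ht y hy
  have h5 : EqOn (h y) (h y₀) (Ioo 0 1) := by
    refine Measure.eqOn_open_of_ae_eq (μ := volume) ?_ isOpen_Ioo
      (H.lipschitz y (hbΩ hy)).continuous.continuousOn
      (H.lipschitz y₀ (hbΩ hy₀)).continuous.continuousOn
    filter_upwards [ae_mono (Measure.restrict_mono Ioo_subset_Ico_self le_rfl) h3] with t ht
      using ht y hy
  rcases eq_or_lt_of_le ht.1 with rfl | ht0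
  · rw [H.zero y (hbΩ hy), H.zero y₀ (hbΩ hy₀)]
  rcases eq_or_lt_of_le ht.2 with rfl | ht1
  · rw [H.one y (hbΩ hy), H.one y₀ (hbΩ hy₀)]
  exact h5 ⟨ht0, ht1⟩

end IsHarmonicGraphFamily

end GraphFamily

/-! ### Independence of the chart for integrals over `K × [0, 1)` -/

section ChangeOfVariables

variable {n : ℕ} {K : Type*} [TopologicalSpace K] [ChartedSpace (EuclideanSpace ℝ (Fin n)) K]
  [IsManifold (𝓡 n) ∞ K] [RiemannianBundle (fun x : K ↦ TangentSpace (𝓡 n) x)]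
  {c c' : OpenPartialHomeomorph K (EuclideanSpace ℝ (Fin n))}

/-- The function `f` on `K × ℝ`, written in the chart `c` and multiplied by the density of the
Riemannian volume. -/
noncomputable def chartDensity (c : OpenPartialHomeomorph K (EuclideanSpace ℝ (Fin n)))
    (f : K → ℝ → ℝ) (p : EuclideanSpace ℝ (Fin n) × ℝ) : ℝ :=
  volDensity c p.1 * f (c.symm p.1) p.2

/-- The coordinate change fixes the height, so its Jacobian is that of the transition map, which the
volume densities absorb. -/
theorem chartDensity_change_aux (hc : c ∈ atlas (EuclideanSpace ℝ (Fin n)) K)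
    (hc' : c' ∈ atlas (EuclideanSpace ℝ (Fin n)) K) (f : K → ℝ → ℝ) :
    (IntegrableOn (chartDensity c' f) ((c'.target ∩ c'.symm ⁻¹' c.source) ×ˢ Ico (0 : ℝ) 1) ↔
      IntegrableOn (chartDensity c f) ((c.target ∩ c.symm ⁻¹' c'.source) ×ˢ Ico (0 : ℝ) 1)) ∧
    ∫ p in (c'.target ∩ c'.symm ⁻¹' c.source) ×ˢ Ico (0 : ℝ) 1, chartDensity c' f p =
      ∫ p in (c.target ∩ c.symm ⁻¹' c'.source) ×ˢ Ico (0 : ℝ) 1, chartDensity c f p := by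
  set O := c.target ∩ c.symm ⁻¹' c'.source with hO
  set O' := c'.target ∩ c'.symm ⁻¹' c.source with hO'
  have hOo : IsOpen O := c.symm.isOpen_inter_preimage c'.open_source
  have hOm : MeasurableSet (O ×ˢ Ico (0 : ℝ) 1) := hOo.measurableSet.prod measurableSet_Ico
  let Φ : EuclideanSpace ℝ (Fin n) × ℝ → EuclideanSpace ℝ (Fin n) × ℝ :=
    Prod.map (transition c c') id
  let Φ' : EuclideanSpace ℝ (Fin n) × ℝ →
      (EuclideanSpace ℝ (Fin n) × ℝ) →L[ℝ] (EuclideanSpace ℝ (Fin n) × ℝ) := fun p ↦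
    (fderiv ℝ (transition c c') p.1).prodMap (ContinuousLinearMap.id ℝ ℝ)
  have hΦ' : ∀ p ∈ O ×ˢ Ico (0 : ℝ) 1, HasFDerivWithinAt Φ (Φ' p) (O ×ˢ Ico (0 : ℝ) 1) p := by
    rintro ⟨y, s⟩ hp
    have h1 : HasFDerivAt (transition c c') (fderiv ℝ (transition c c') y) y :=
      (differentiableAt_transition hc hc' hp.1.1 hp.1.2).hasFDerivAt
    exact (HasFDerivAt.prodMap (y, s) h1 (hasFDerivAt_id s)).hasFDerivWithinAt
  have hinj : InjOn Φ (O ×ˢ Ico (0 : ℝ) 1) := by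
    rintro ⟨y, s⟩ hp ⟨z, r⟩ hq hpq
    simp only [Φ, Prod.map_apply, id, Prod.mk.injEq] at hpq
    refine Prod.ext ?_ hpq.2
    exact c.symm.injOn hp.1.1 hq.1.1 (c'.injOn hp.1.2 hq.1.2 hpq.1)
  have himg : Φ '' (O ×ˢ Ico (0 : ℝ) 1) = O' ×ˢ Ico (0 : ℝ) 1 := by
    apply Subset.antisymm
    · rintro _ ⟨⟨y, s⟩, hp, rfl⟩
      refine ⟨⟨c'.map_source hp.1.2, ?_⟩, hp.2⟩
      change c'.symm (transition c c' y) ∈ c.source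
      rw [symm_transition hp.1.2]
      exact c.map_target hp.1.1
    · rintro ⟨y, s⟩ hp
      refine ⟨(transition c' c y, s), ⟨⟨c.map_source hp.1.2, ?_⟩, hp.2⟩, ?_⟩
      · change c.symm (transition c' c y) ∈ c'.source
        rw [symm_transition hp.1.2]
        exact c'.map_target hp.1.1
      · simp only [Φ, Prod.map_apply, id, Prod.mk.injEq, and_true]
        rw [transition, symm_transition hp.1.2, c'.right_inv hp.1.1]
  have hdet : ∀ p, (Φ' p).det = (fderiv ℝ (transition c c') p.1).det := by
    intro p
    simp only [Φ', ContinuousLinearMap.det]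
    rw [show (((fderiv ℝ (transition c c') p.1).prodMap (ContinuousLinearMap.id ℝ ℝ) :
      (EuclideanSpace ℝ (Fin n) × ℝ) →L[ℝ] (EuclideanSpace ℝ (Fin n) × ℝ)) :
        (EuclideanSpace ℝ (Fin n) × ℝ) →ₗ[ℝ] (EuclideanSpace ℝ (Fin n) × ℝ)) =
        LinearMap.prodMap (fderiv ℝ (transition c c') p.1).toLinearMap LinearMap.id from rfl,
      LinearMap.det_prodMap, LinearMap.det_id, mul_one]
  have hpt : ∀ p ∈ O ×ˢ Ico (0 : ℝ) 1, |(Φ' p).det| • chartDensity c' f (Φ p) =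
      chartDensity c f p := by
    rintro ⟨y, s⟩ hp
    rw [hdet, chartDensity, chartDensity, smul_eq_mul, ← mul_assoc]
    simp only [Φ, Prod.map_apply, id]
    rw [volDensity_transition hc hc' hp.1.1 hp.1.2, symm_transition hp.1.2]
  have : (volume : Measure (EuclideanSpace ℝ (Fin n) × ℝ)).IsAddHaarMeasure :=
    Measure.prod.instIsAddHaarMeasure volume volume
  rw [← himg]
  constructor
  · rw [integrableOn_image_iff_integrableOn_abs_det_fderiv_smul volume hOm hΦ' hinj]
    exact integrableOn_congr_fun hpt hOm
  · rw [integral_image_eq_integral_abs_det_fderiv_smul volume hOm hΦ' hinj]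
    exact setIntegral_congr_fun hOm hpt

theorem chartDensity_restrict {U : Set K} (hU : IsOpen U) {f : K → ℝ → ℝ}
    (hf : ∀ q ∈ c.source, q ∉ U → ∀ s, f q s = 0) :
    (IntegrableOn (chartDensity c f) ((c.target ∩ c.symm ⁻¹' U) ×ˢ Ico (0 : ℝ) 1) ↔
      IntegrableOn (chartDensity c f) (c.target ×ˢ Ico (0 : ℝ) 1)) ∧
    ∫ p in (c.target ∩ c.symm ⁻¹' U) ×ˢ Ico (0 : ℝ) 1, chartDensity c f p =
      ∫ p in c.target ×ˢ Ico (0 : ℝ) 1, chartDensity c f p := by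
  have hsub : (c.target ∩ c.symm ⁻¹' U) ×ˢ Ico (0 : ℝ) 1 ⊆ c.target ×ˢ Ico (0 : ℝ) 1 :=
    prod_mono inter_subset_left le_rfl
  have h0 : ∀ p ∈ (c.target ×ˢ Ico (0 : ℝ) 1) \ ((c.target ∩ c.symm ⁻¹' U) ×ˢ Ico (0 : ℝ) 1),
      chartDensity c f p = 0 := by
    rintro p ⟨hp, hp'⟩
    rw [chartDensity, hf _ (c.map_target hp.1) (fun h ↦ hp' ⟨⟨hp.1, h⟩, hp.2⟩), mul_zero]
  have hm : MeasurableSet (c.target ×ˢ Ico (0 : ℝ) 1) :=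
    c.open_target.measurableSet.prod measurableSet_Ico
  have hm' : MeasurableSet ((c.target ∩ c.symm ⁻¹' U) ×ˢ Ico (0 : ℝ) 1) :=
    (c.symm.isOpen_inter_preimage hU).measurableSet.prod measurableSet_Ico
  refine ⟨⟨fun h ↦ ?_, fun h ↦ h.mono_set hsub⟩,
    setIntegral_eq_of_subset_of_forall_sdiff_eq_zero hm hsub h0 |>.symm⟩
  exact h.of_forall_sdiff_eq_zero hm h0

theorem chartDensity_change (hc : c ∈ atlas (EuclideanSpace ℝ (Fin n)) K)
    (hc' : c' ∈ atlas (EuclideanSpace ℝ (Fin n)) K) {f : K → ℝ → ℝ}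
    (hf : ∀ q, q ∉ c.source ∩ c'.source → ∀ s, f q s = 0) :
    (IntegrableOn (chartDensity c' f) (c'.target ×ˢ Ico (0 : ℝ) 1) ↔
      IntegrableOn (chartDensity c f) (c.target ×ˢ Ico (0 : ℝ) 1)) ∧
    ∫ p in c'.target ×ˢ Ico (0 : ℝ) 1, chartDensity c' f p =
      ∫ p in c.target ×ˢ Ico (0 : ℝ) 1, chartDensity c f p := by
  have h1 := chartDensity_change_aux hc hc' f
  have h2 := chartDensity_restrict (c := c) c'.open_source (f := f)
    fun q _ hq ↦ hf q fun h ↦ hq h.2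
  have h3 := chartDensity_restrict (c := c') c.open_source (f := f)
    fun q _ hq ↦ hf q fun h ↦ hq h.1
  exact ⟨h3.1.symm.trans (h1.1.trans h2.1), h3.2.symm.trans (h1.2.trans h2.2)⟩

end ChangeOfVariables

/-! ### Foliated boxes read in charts -/

section Boxes

variable {n : ℕ} {K : Type*} [TopologicalSpace K]
  {F : Foliation (EuclideanSpace ℝ (Fin n)) unitInterval (K × unitInterval)}
  {q₀ : K} {U : Set K} {h : K → unitInterval → unitInterval} {C : ℝ≥0}

namespace IsFoliatedBox

theorem strictMono (H : IsFoliatedBox F q₀ U h C) {q : K} (hq : q ∈ U) : StrictMono (h q) := by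
  rcases (H.lipschitz q hq).continuous.strictMono_of_inj (H.antilipschitz q hq).injective
    with hm | hm
  · exact hm
  · have := hm (show (0 : unitInterval) < 1 from zero_lt_one)
    rw [H.zero q hq, H.one q hq] at this
    exact absurd this (not_lt.2 zero_le_one)

theorem surjective (H : IsFoliatedBox F q₀ U h C) {q : K} (hq : q ∈ U) :
    Function.Surjective (h q) := fun s ↦
  mem_range_of_exists_le_of_exists_ge (H.lipschitz q hq).continuous
    ⟨0, by rw [H.zero q hq]; exact unitInterval.nonneg'⟩
    ⟨1, by rw [H.one q hq]; exact unitInterval.le_one'⟩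

/-- Both sides follow the leaf through the same point over `q₁`, so uniqueness of sections
identifies them near `q₁`. -/
theorem eventually_eq {q₁ : K} {U₁ : Set K} {h₁ : K → unitInterval → unitInterval} {C₁ : ℝ≥0}
    (hF : IsFoliatedIBundle F) (H : IsFoliatedBox F q₀ U h C) (H₁ : IsFoliatedBox F q₁ U₁ h₁ C₁)
    (hq : q₁ ∈ U) (t : unitInterval) : ∀ᶠ q in 𝓝 q₁, h₁ q (h q₁ t) = h q t := by
  have h1 := hF.section_eventuallyEq
    ((H₁.leafContinuousOn (h q₁ t)).mono (inter_subset_right (s := U)))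
    ((H.leafContinuousOn t).mono (inter_subset_left (t := U₁))) ⟨hq, H₁.mem⟩ (H₁.base _)
  rwa [(H.isOpen.inter H₁.isOpen).nhdsWithin_eq ⟨hq, H₁.mem⟩] at h1

end IsFoliatedBox

variable [ChartedSpace (EuclideanSpace ℝ (Fin n)) K]
  [IsManifold (𝓡 n) ∞ K] [RiemannianBundle (fun x : K ↦ TangentSpace (𝓡 n) x)]

theorem IsFoliatedBox.isHarmonicOn (H : IsFoliatedBox F q₀ U h C) (hF : IsHarmonicFoliation F)
    (t : unitInterval) : IsHarmonicOn (n := n) (fun q ↦ (h q t : ℝ)) U :=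
  hF.2.2 U (fun q ↦ (q, h q t)) H.isOpen (fun _ _ ↦ rfl) (H.leafContinuousOn t)

/-- The holonomy of a foliated box, written in the chart `c`. -/
noncomputable def boxGraph (c : OpenPartialHomeomorph K (EuclideanSpace ℝ (Fin n)))
    (h : K → unitInterval → unitInterval) (y : EuclideanSpace ℝ (Fin n)) (t : ℝ) : ℝ :=
  h (c.symm y) (projIcc 0 1 zero_le_one t)

theorem IsFoliatedBox.isHarmonicGraphFamily
    [IsContMDiffRiemannianBundle (𝓡 n) ∞ (EuclideanSpace ℝ (Fin n))
      (fun x : K ↦ TangentSpace (𝓡 n) x)]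
    (H : IsFoliatedBox F q₀ U h C) (hF : IsHarmonicFoliation F)
    {c : OpenPartialHomeomorph K (EuclideanSpace ℝ (Fin n))}
    (hc : c ∈ atlas (EuclideanSpace ℝ (Fin n)) K) :
    IsHarmonicGraphFamily (c.target ∩ c.symm ⁻¹' U)
      (fun y ↦ volDensity c y • (metricMatrix c y)⁻¹) (boxGraph c h)
      (boxGraph c fun q ↦ Function.invFun (h q)) C where
  isOpen := c.symm.isOpen_inter_preimage H.isOpen
  continuousOn i j := ((contDiffOn_volDensity hc).continuousOn.mul
    (contDiffOn_metricMatrix_inv hc i j).continuousOn).mono inter_subset_left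
  symm y hy ξ η := by
    rw [covForm_smul_matrix, covForm_smul_matrix]
    exact congrArg _ (chartForm_symm hc hy.1 ξ η)
  pos y hy ξ hξ := by
    rw [covForm_smul_matrix]
    exact mul_pos (volDensity_pos hc hy.1) (chartForm_pos hc hy.1 hξ)
  contDiffOn t := by
    rw [← contMDiffOn_iff_contDiffOn]
    exact ((H.isHarmonicOn hF (projIcc 0 1 zero_le_one t)).1.of_le (by norm_num)).comp
      (((contMDiffOn_atlas_symm hc).of_le (by norm_cast)).mono inter_subset_left)
      fun y hy ↦ hy.2
  lipschitz y hy := by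
    have h1 := ((LipschitzWith.subtype_val _).comp (H.lipschitz _ hy.2)).comp
      (LipschitzWith.projIcc (zero_le_one' ℝ))
    rw [one_mul, mul_one] at h1
    exact h1
  strictMonoOn y hy s hs t ht hst := by
    refine H.strictMono hy.2 ?_
    rw [projIcc_of_mem _ hs, projIcc_of_mem _ ht]
    exact hst
  zero y hy := by
    rw [boxGraph, projIcc_left, show (⟨0, _⟩ : unitInterval) = 0 from rfl, H.zero _ hy.2]
    rfl
  one y hy := by
    rw [boxGraph, projIcc_right, show (⟨1, _⟩ : unitInterval) = 1 from rfl, H.one _ hy.2]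
    rfl
  mem_inv y hy s hs := by
    refine ⟨(Function.invFun (h (c.symm y)) _).2.1,
      lt_of_le_of_ne (Function.invFun (h (c.symm y)) _).2.2 fun h1 ↦ ?_⟩
    have h2 := Function.rightInverse_invFun (H.surjective hy.2) (projIcc 0 1 zero_le_one s)
    rw [show Function.invFun (h (c.symm y)) (projIcc 0 1 zero_le_one s) = 1 from Subtype.ext h1,
      H.one _ hy.2, projIcc_of_mem _ (Ico_subset_Icc_self hs)] at h2
    exact hs.2.ne (congrArg Subtype.val h2).symm
  right_inv y hy s hs := by
    have h2 := Function.rightInverse_invFun (H.surjective hy.2) (projIcc 0 1 zero_le_one s)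
    simp only [boxGraph]
    rw [projIcc_val, h2, projIcc_of_mem _ (Ico_subset_Icc_self hs)]
  lipschitz_inv y hy := by
    have h1 := ((LipschitzWith.subtype_val _).comp ((H.antilipschitz _ hy.2).to_rightInverse
      (Function.rightInverse_invFun (H.surjective hy.2)))).comp
      (LipschitzWith.projIcc (zero_le_one' ℝ))
    rw [one_mul, mul_one] at h1
    exact h1
  green t f hf hfc hfs := by
    rw [← (H.isHarmonicOn hF (projIcc 0 1 zero_le_one t)).integral_chartForm_eq_zero hc H.isOpen
      hf hfc hfs]
    exact integral_congr_ae (Eventually.of_forall fun y ↦ covForm_smul_matrix _ _ _ _)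

end Boxes

/-! ### Gluing the local identities and vanishing of the leafwise energy -/

section Gluing

variable {n : ℕ} {K : Type*} [TopologicalSpace K]

/-- The height function of the leaf through `(q, s)`, near `q`, for a choice `h q` of foliated
boxes based at the points `q`. -/
noncomputable def leafGerm (h : K → K → unitInterval → unitInterval) (q : K) (s : ℝ) : K → ℝ :=
  fun q' ↦ h q q' (projIcc 0 1 zero_le_one s)

/-- The leafwise differential of the height function in the chart `c`. -/
noncomputable def leafDeriv (c : OpenPartialHomeomorph K (EuclideanSpace ℝ (Fin n)))
    (h : K → K → unitInterval → unitInterval) (y : EuclideanSpace ℝ (Fin n)) (s : ℝ) :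
    EuclideanSpace ℝ (Fin n) →L[ℝ] ℝ :=
  fderiv ℝ (leafGerm h (c.symm y) s ∘ c.symm) y

variable {F : Foliation (EuclideanSpace ℝ (Fin n)) unitInterval (K × unitInterval)}
  {U : K → Set K} {h : K → K → unitInterval → unitInterval} {C : K → ℝ≥0}
  {c : OpenPartialHomeomorph K (EuclideanSpace ℝ (Fin n))}

/-- `leafDeriv` uses a different box at each base point, but a differential depends only on the germ
of the leaf, on which all boxes agree. This supplies the hypothesis `ha` of the box estimates with a
single `a` for all boxes. -/
theorem leafDeriv_boxGraph (hF : IsFoliatedIBundle F)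
    (H : ∀ q, IsFoliatedBox F q (U q) (h q) (C q)) (q₀ : K) {y : EuclideanSpace ℝ (Fin n)}
    (hy : y ∈ c.target ∩ c.symm ⁻¹' U q₀) (t : ℝ) :
    leafDeriv c h y (boxGraph c (h q₀) y t) = graphDeriv (boxGraph c (h q₀)) t y := by
  have h1 := (H q₀).eventually_eq hF (H (c.symm y)) hy.2 (projIcc 0 1 zero_le_one t)
  have h2 := (c.symm.continuousAt hy.1).eventually h1
  have h3 : leafGerm h (c.symm y) (boxGraph c (h q₀) y t) ∘ c.symm =ᶠ[𝓝 y]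
      fun z ↦ boxGraph c (h q₀) z t := by
    filter_upwards [h2] with z hz
    simp only [Function.comp_apply, leafGerm, boxGraph]
    rw [projIcc_val, hz]
  exact h3.fderiv_eq

/-- The function `ψ` on `K` written in the chart `c`, extended by zero. -/
noncomputable def chartExtension (c : OpenPartialHomeomorph K (EuclideanSpace ℝ (Fin n)))
    (ψ : K → ℝ) : EuclideanSpace ℝ (Fin n) → ℝ :=
  c.target.indicator (ψ ∘ c.symm)

theorem chartExtension_eventuallyEq {ψ : K → ℝ} {y : EuclideanSpace ℝ (Fin n)}
    (hy : y ∈ c.target) : chartExtension c ψ =ᶠ[𝓝 y] ψ ∘ c.symm := by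
  filter_upwards [c.open_target.mem_nhds hy] with z hz
  exact indicator_of_mem hz _

theorem tsupport_chartExtension_subset [T2Space K] [CompactSpace K] {ψ : K → ℝ}
    (hψ : tsupport ψ ⊆ c.source) : IsCompact (c '' tsupport ψ) ∧
      tsupport (chartExtension c ψ) ⊆ c '' tsupport ψ := by
  have hK : IsCompact (c '' tsupport ψ) :=
    (isClosed_tsupport ψ).isCompact.image_of_continuousOn (c.continuousOn.mono hψ)
  refine ⟨hK, closure_minimal (fun y hy ↦ ?_) hK.isClosed⟩
  have hyt : y ∈ c.target := by
    by_contra h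
    exact hy (indicator_of_notMem h _)
  refine ⟨c.symm y, subset_tsupport _ fun h ↦ hy ?_, c.right_inv hyt⟩
  rw [chartExtension, indicator_of_mem hyt]
  exact h

variable [ChartedSpace (EuclideanSpace ℝ (Fin n)) K] [IsManifold (𝓡 n) ∞ K]

theorem contDiff_chartExtension [T2Space K] [CompactSpace K]
    (hc : c ∈ atlas (EuclideanSpace ℝ (Fin n)) K) {ψ : K → ℝ}
    (hψ : ContMDiff (𝓡 n) 𝓘(ℝ, ℝ) 1 ψ) (hψs : tsupport ψ ⊆ c.source) :
    ContDiff ℝ 1 (chartExtension c ψ) := by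
  refine contDiff_iff_contDiffAt.2 fun y ↦ ?_
  by_cases hy : y ∈ c.target
  · refine ContDiffAt.congr_of_eventuallyEq ?_ (chartExtension_eventuallyEq hy)
    rw [← contMDiffAt_iff_contDiffAt]
    exact hψ.contMDiffAt.comp y (((contMDiffOn_atlas_symm hc).of_le (by norm_cast)).contMDiffAt
      (c.open_target.mem_nhds hy))
  · have h1 : y ∉ tsupport (chartExtension c ψ) := fun h ↦ by
      obtain ⟨q, hq, rfl⟩ := (tsupport_chartExtension_subset hψs).2 h
      exact hy (c.map_source (hψs hq))
    exact contDiffAt_const.congr_of_eventuallyEq (notMem_tsupport_iff_eventuallyEq.1 h1)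

variable [RiemannianBundle (fun x : K ↦ TangentSpace (𝓡 n) x)]

/-- The squared norm of the leafwise gradient of the height function. -/
noncomputable def leafEnergy (h : K → K → unitInterval → unitInterval) (q : K) (s : ℝ) : ℝ :=
  gradInner (n := n) (leafGerm h q s) (leafGerm h q s) q

/-- The function `s ⟪dψ, a⟫ + ψ |a|² / 2` on `K × ℝ`, with `a` the leafwise differential of the
height function. -/
noncomputable def testDensity (n : ℕ) {K : Type*} [TopologicalSpace K]
    [ChartedSpace (EuclideanSpace ℝ (Fin n)) K]
    [IsManifold (𝓡 n) ∞ K] [RiemannianBundle (fun x : K ↦ TangentSpace (𝓡 n) x)]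
    (h : K → K → unitInterval → unitInterval) (ψ : K → ℝ) (q : K) (s : ℝ) : ℝ :=
  s * gradInner (n := n) ψ (leafGerm h q s) q + 1 / 2 * ψ q * leafEnergy (n := n) h q s

theorem mdifferentiableAt_leafGerm (hF : IsHarmonicFoliation F)
    (H : ∀ q, IsFoliatedBox F q (U q) (h q) (C q)) (q : K) (s : ℝ) :
    MDifferentiableAt (𝓡 n) 𝓘(ℝ, ℝ) (leafGerm h q s) q :=
  (((H q).isHarmonicOn hF (projIcc 0 1 zero_le_one s)).1.contMDiffAt
    ((H q).isOpen.mem_nhds (H q).mem)).mdifferentiableAt (by norm_num)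

theorem leafEnergy_eq (hF : IsHarmonicFoliation F)
    (H : ∀ q, IsFoliatedBox F q (U q) (h q) (C q)) (hc : c ∈ atlas (EuclideanSpace ℝ (Fin n)) K)
    {y : EuclideanSpace ℝ (Fin n)} (hy : y ∈ c.target) (s : ℝ) :
    leafEnergy (n := n) h (c.symm y) s = chartForm c y (leafDeriv c h y s) (leafDeriv c h y s) :=
  gradInner_eq hc hy (mdifferentiableAt_leafGerm hF H _ s) (mdifferentiableAt_leafGerm hF H _ s)

theorem leafEnergy_nonneg (q : K) (s : ℝ) : 0 ≤ leafEnergy (n := n) h q s :=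
  chartForm_nonneg (chart_mem_atlas _ q)
    ((chartAt (EuclideanSpace ℝ (Fin n)) q).map_source (mem_chart_source _ q)) _

theorem chartDensity_testDensity (hF : IsHarmonicFoliation F)
    (H : ∀ q, IsFoliatedBox F q (U q) (h q) (C q)) (hc : c ∈ atlas (EuclideanSpace ℝ (Fin n)) K)
    {ψ : K → ℝ} (hψ : ContMDiff (𝓡 n) 𝓘(ℝ, ℝ) 1 ψ)
    {p : EuclideanSpace ℝ (Fin n) × ℝ} (hp : p.1 ∈ c.target) :
    chartDensity c (testDensity n h ψ) p =
      leafDensity (fun y ↦ volDensity c y • (metricMatrix c y)⁻¹) (chartExtension c ψ)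
        (leafDeriv c h) p.1 p.2 := by
  rw [chartDensity, testDensity, leafEnergy_eq hF H hc hp, leafDensity,
    (chartExtension_eventuallyEq hp).fderiv_eq, (chartExtension_eventuallyEq hp).eq_of_nhds,
    gradInner_eq hc hp (hψ.mdifferentiableAt (by norm_num)) (mdifferentiableAt_leafGerm hF H _ _),
    covForm_smul_matrix, covForm_smul_matrix]
  simp only [chartForm, leafDeriv, Function.comp_apply]
  ring

theorem testDensity_eq_zero {ψ : K → ℝ} {q : K} (hq : q ∉ tsupport ψ) (s : ℝ) :
    testDensity n h ψ q s = 0 := by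
  have h1 : ψ =ᶠ[𝓝 q] 0 := notMem_tsupport_iff_eventuallyEq.1 hq
  have h2 : gradInner (n := n) ψ (leafGerm h q s) q = 0 := by
    rw [gradInner_congr h1 (EventuallyEq.refl _ _), gradInner, chartForm]
    have : ((0 : K → ℝ) ∘ (chartAt (EuclideanSpace ℝ (Fin n)) q).symm) = fun _ ↦ 0 := rfl
    rw [this, fderiv_const_apply, covForm_zero_left]
  rw [testDensity, h2, image_eq_zero_of_notMem_tsupport hq]
  ring

theorem integral_testDensity [T2Space K] [CompactSpace K]
    [IsContMDiffRiemannianBundle (𝓡 n) ∞ (EuclideanSpace ℝ (Fin n))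
      (fun x : K ↦ TangentSpace (𝓡 n) x)] (hF : IsHarmonicFoliation F)
    (H : ∀ q, IsFoliatedBox F q (U q) (h q) (C q)) (hc : c ∈ atlas (EuclideanSpace ℝ (Fin n)) K)
    {ψ : K → ℝ} (hψ : ContMDiff (𝓡 n) 𝓘(ℝ, ℝ) 1 ψ) {q₀ : K} (hU : U q₀ ⊆ c.source)
    (hψs : tsupport ψ ⊆ U q₀) :
    IntegrableOn (chartDensity c (testDensity n h ψ)) (c.target ×ˢ Ico (0 : ℝ) 1) ∧
    ∫ p in c.target ×ˢ Ico (0 : ℝ) 1, chartDensity c (testDensity n h ψ) p = 0 := by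
  have hr := chartDensity_restrict (c := c) (H q₀).isOpen (f := testDensity n h ψ)
    fun q _ hq s ↦ testDensity_eq_zero (fun hh ↦ hq (hψs hh)) s
  have hG := (H q₀).isHarmonicGraphFamily hF hc
  obtain ⟨hcomp, hsub⟩ := tsupport_chartExtension_subset (hψs.trans hU)
  have hI := hG.integral_leafDensity (fun y hy t _ ↦ leafDeriv_boxGraph hF.1 H q₀ hy t)
    (contDiff_chartExtension hc hψ (hψs.trans hU))
    (hcomp.of_isClosed_subset (isClosed_tsupport _) hsub) (by
      refine hsub.trans ?_
      rintro _ ⟨q, hq, rfl⟩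
      refine ⟨c.map_source (hU (hψs hq)), ?_⟩
      rw [mem_preimage, c.left_inv (hU (hψs hq))]
      exact hψs hq)
  have hm : MeasurableSet ((c.target ∩ c.symm ⁻¹' U q₀) ×ˢ Ico (0 : ℝ) 1) :=
    hG.isOpen.measurableSet.prod measurableSet_Ico
  have hpt : EqOn (chartDensity c (testDensity n h ψ)) (fun p ↦
      leafDensity (fun y ↦ volDensity c y • (metricMatrix c y)⁻¹) (chartExtension c ψ)
        (leafDeriv c h) p.1 p.2) ((c.target ∩ c.symm ⁻¹' U q₀) ×ˢ Ico (0 : ℝ) 1) :=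
    fun p hp ↦ chartDensity_testDensity hF H hc hψ hp.1.1
  rw [← hr.1, ← hr.2, integrableOn_congr_fun hpt hm, setIntegral_congr_fun hm hpt]
  exact hI

/-- The leafwise energy of the height function vanishes almost everywhere. -/
theorem ae_leafEnergy_eq_zero [T2Space K] [CompactSpace K]
    [IsContMDiffRiemannianBundle (𝓡 n) ∞ (EuclideanSpace ℝ (Fin n))
      (fun x : K ↦ TangentSpace (𝓡 n) x)] (hF : IsHarmonicFoliation F)
    (H : ∀ q, IsFoliatedBox F q (U q) (h q) (C q)) {ι : Type*} [Fintype ι] (x : ι → K)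
    (hU : ∀ i, U (x i) ⊆ (chartAt (EuclideanSpace ℝ (Fin n)) (x i)).source)
    {ψ : ι → K → ℝ} (hψ : ∀ i, ContMDiff (𝓡 n) 𝓘(ℝ, ℝ) 1 (ψ i))
    (hψs : ∀ i, tsupport (ψ i) ⊆ U (x i)) (hψ0 : ∀ i q, 0 ≤ ψ i q) (hψ1 : ∀ q, ∑ i, ψ i q = 1)
    (j : ι) : ∀ᵐ p ∂(volume : Measure (EuclideanSpace ℝ (Fin n) × ℝ)).restrict
      ((chartAt (EuclideanSpace ℝ (Fin n)) (x j)).target ×ˢ Ico (0 : ℝ) 1),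
      ψ j ((chartAt (EuclideanSpace ℝ (Fin n)) (x j)).symm p.1) *
        leafEnergy (n := n) h ((chartAt (EuclideanSpace ℝ (Fin n)) (x j)).symm p.1) p.2 = 0 := by
  set c : ι → OpenPartialHomeomorph K (EuclideanSpace ℝ (Fin n)) :=
    fun i ↦ chartAt (EuclideanSpace ℝ (Fin n)) (x i) with hcdef
  have hc : ∀ i, c i ∈ atlas (EuclideanSpace ℝ (Fin n)) K := fun i ↦ chart_mem_atlas _ _
  have hm : ∀ i, MeasurableSet ((c i).target ×ˢ Ico (0 : ℝ) 1) := fun i ↦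
    (c i).open_target.measurableSet.prod measurableSet_Ico
  have hle : ∀ i q, ψ i q ≤ 1 := fun i q ↦ by
    rw [← hψ1 q]
    exact Finset.single_le_sum (f := fun i ↦ ψ i q) (fun i _ ↦ hψ0 i q) (Finset.mem_univ i)
  -- The extra factor `ψ j` supports the `i`-th test density in both charts, so its integral may be
  -- computed in either `c i` or `c j`.
  let g : ι → ι → K → ℝ → ℝ := fun i j q s ↦ ψ j q * testDensity n h (ψ i) q s
  have hI := fun i ↦ integral_testDensity hF H (hc i) (hψ i) (hU i) (hψs i)
  have hgi : ∀ i j, IntegrableOn (chartDensity (c i) (g i j)) ((c i).target ×ˢ Ico (0 : ℝ) 1) := by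
    intro i j
    have h1 : ContinuousOn (fun p : EuclideanSpace ℝ (Fin n) × ℝ ↦ ψ j ((c i).symm p.1))
        ((c i).target ×ˢ Ico (0 : ℝ) 1) :=
      (hψ j).continuous.comp_continuousOn
        ((c i).continuousOn_symm.comp continuousOn_fst fun p hp ↦ hp.1)
    have h2 := (hI i).1.bdd_mul (c := 1) (h1.aestronglyMeasurable (hm i))
      (Eventually.of_forall fun p ↦ by
        rw [Real.norm_eq_abs, abs_of_nonneg (hψ0 _ _)]
        exact hle _ _)
    refine h2.congr (Eventually.of_forall fun p ↦ ?_)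
    simp only [chartDensity, g]
    ring
  have hg0 : ∀ i j q, q ∉ (c i).source ∩ (c j).source → ∀ s, g i j q s = 0 := by
    intro i j q hq s
    by_cases h1 : q ∈ tsupport (ψ i)
    · have h2 : q ∉ tsupport (ψ j) := fun h2 ↦ hq ⟨hU i (hψs i h1), hU j (hψs j h2)⟩
      simp only [g, image_eq_zero_of_notMem_tsupport h2, zero_mul]
    · simp only [g, testDensity_eq_zero h1, mul_zero]
  have hch := fun i j ↦ chartDensity_change (hc i) (hc j) (hg0 i j)
  have hsum : ∀ q s, ∑ i, testDensity n h (ψ i) q s = 1 / 2 * leafEnergy (n := n) h q s := by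
    intro q s
    simp only [testDensity, Finset.sum_add_distrib, ← Finset.mul_sum, ← Finset.sum_mul, hψ1]
    rw [sum_gradInner_eq_zero (fun i _ ↦ (hψ i).mdifferentiableAt (by norm_num)) hψ1]
    ring
  let e : ι → K → ℝ → ℝ := fun j q s ↦ ψ j q * (1 / 2 * leafEnergy (n := n) h q s)
  have he : ∀ j p, chartDensity (c j) (e j) p = ∑ i, chartDensity (c j) (g i j) p := by
    intro j p
    simp only [chartDensity, e, g, ← hsum, Finset.mul_sum]
  have hei : ∀ j, IntegrableOn (chartDensity (c j) (e j)) ((c j).target ×ˢ Ico (0 : ℝ) 1) := by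
    intro j
    have h1 := integrable_finsetSum Finset.univ
      fun i (_ : i ∈ Finset.univ) ↦ ((hch i j).1.2 (hgi i j) : Integrable _ _)
    exact h1.congr (Eventually.of_forall fun p ↦ (he j p).symm)
  have hintg : ∀ j, ∫ p in (c j).target ×ˢ Ico (0 : ℝ) 1, chartDensity (c j) (e j) p =
      ∑ i, ∫ p in (c i).target ×ˢ Ico (0 : ℝ) 1, chartDensity (c i) (g i j) p := by
    intro j
    simp only [he]
    rw [integral_finsetSum _ fun i _ ↦ (hch i j).1.2 (hgi i j)]
    exact Finset.sum_congr rfl fun i _ ↦ (hch i j).2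
  -- Summing over `j` first, in the fixed chart `c i`, restores the full test density of `ψ i`,
  -- whose integral is zero.
  have htot : ∑ j, ∫ p in (c j).target ×ˢ Ico (0 : ℝ) 1, chartDensity (c j) (e j) p = 0 := by
    simp only [hintg]
    rw [Finset.sum_comm]
    refine Finset.sum_eq_zero fun i _ ↦ ?_
    have h1 := integral_finsetSum (μ := volume.restrict ((c i).target ×ˢ Ico (0 : ℝ) 1))
      Finset.univ (f := fun j ↦ chartDensity (c i) (g i j)) fun j _ ↦ hgi i j
    refine h1.symm.trans (Eq.trans ?_ (hI i).2)
    refine integral_congr_ae (Eventually.of_forall fun p ↦ ?_)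
    simp only [chartDensity, g, ← Finset.mul_sum, ← Finset.sum_mul, hψ1, one_mul, hcdef]
  have hpos : ∀ j, ∀ p ∈ (c j).target ×ˢ Ico (0 : ℝ) 1, 0 ≤ chartDensity (c j) (e j) p :=
    fun j p hp ↦ mul_nonneg (volDensity_pos (hc j) hp.1).le
      (mul_nonneg (hψ0 _ _) (mul_nonneg (by norm_num) (leafEnergy_nonneg _ _)))
  -- Nonnegative integrals with zero sum all vanish, and then so do their nonnegative integrands
  -- almost everywhere.
  have hzero := (Finset.sum_eq_zero_iff_of_nonneg fun j _ ↦
    setIntegral_nonneg (hm j) (hpos j)).1 htot j (Finset.mem_univ j)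
  rw [setIntegral_eq_zero_iff_of_nonneg_ae
    ((ae_restrict_iff' (hm j)).2 (Eventually.of_forall (hpos j))) (hei j)] at hzero
  filter_upwards [hzero, ae_restrict_mem (hm j)] with p hp hpm
  have h1 := (mul_eq_zero.1 hp).resolve_left (volDensity_pos (hc j) hpm.1).ne'
  simp only [e] at h1
  linarith

end Gluing

/-! ### Conclusion -/

theorem mainTheorem6 {n : ℕ} {K : Type*} [TopologicalSpace K] [T2Space K] [CompactSpace K]
    [ChartedSpace (EuclideanSpace ℝ (Fin n)) K] [IsManifold (𝓡 n) ∞ K]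
    [RiemannianBundle (fun x : K ↦ TangentSpace (𝓡 n) x)]
    [IsContMDiffRiemannianBundle (𝓡 n) ∞ (EuclideanSpace ℝ (Fin n))
      (fun x : K ↦ TangentSpace (𝓡 n) x)]
    (F : Foliation (EuclideanSpace ℝ (Fin n)) unitInterval (K × unitInterval))
    (hF : IsHarmonicFoliation F) (hLip : IsLipschitzFoliation F) :
    IsProductFoliation F := by
  have : LocallyConnectedSpace K :=
    ChartedSpace.locallyConnectedSpace (EuclideanSpace ℝ (Fin n)) K
  choose U h C hU H using fun q : K ↦ hF.1.exists_isFoliatedBox hLip q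
    ((chartAt (EuclideanSpace ℝ (Fin n)) q).open_source.mem_nhds (mem_chart_source _ q))
  obtain ⟨S, hS⟩ := isCompact_univ.elim_finite_subcover U (fun q ↦ (H q).isOpen)
    fun q _ ↦ mem_iUnion.2 ⟨q, (H q).mem⟩
  obtain ⟨ψ, hψs⟩ := SmoothPartitionOfUnity.exists_isSubordinate (𝓡 n) isClosed_univ
    (fun i : S ↦ U i) (fun i ↦ (H i).isOpen) fun q hq ↦ by
      obtain ⟨i, hi, hqi⟩ := mem_iUnion₂.1 (hS hq)
      exact mem_iUnion.2 ⟨⟨i, hi⟩, hqi⟩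
  have hψ1 : ∀ q, ∑ i, ψ i q = 1 := fun q ↦ by
    rw [← finsum_eq_sum_of_fintype]
    exact ψ.sum_eq_one (mem_univ q)
  have hae := ae_leafEnergy_eq_zero hF H (fun i : S ↦ (i : K)) (fun i ↦ hU i)
    (ψ := fun i q ↦ ψ i q) (fun i ↦ (ψ i).contMDiff.of_le (by norm_cast)) hψs
    (fun i q ↦ ψ.nonneg i q) hψ1
  refine isProductFoliation_of_constant_sections (fun q s ↦ ?_) hF.1
  obtain ⟨j, hj⟩ : ∃ j, 0 < ψ j q := by
    by_contra! hcon
    have h1 := hψ1 q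
    rw [Finset.sum_eq_zero fun i _ ↦ le_antisymm (hcon i) (ψ.nonneg i q)] at h1
    exact zero_ne_one h1
  set c := chartAt (EuclideanSpace ℝ (Fin n)) (j : K) with hcdef
  have hc : c ∈ atlas (EuclideanSpace ℝ (Fin n)) K := chart_mem_atlas _ _
  have hqU : q ∈ U j := hψs j (subset_tsupport _ hj.ne')
  have hqc : q ∈ c.source := hU j hqU
  -- On `O` the weight `ψ j` is positive, so the vanishing of `ψ j` times the energy forces the
  -- energy itself to vanish almost everywhere.
  let O : Set K := U j ∩ {q' | 0 < ψ j q'}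
  have hO : IsOpen O := (H j).isOpen.inter (isOpen_lt continuous_const (ψ j).contMDiff.continuous)
  have hO' : c.target ∩ c.symm ⁻¹' O ∈ 𝓝 (c q) := by
    refine (c.symm.isOpen_inter_preimage hO).mem_nhds ⟨c.map_source hqc, ?_⟩
    rw [mem_preimage, c.left_inv hqc]
    exact ⟨hqU, hj⟩
  obtain ⟨r, hr, hrO⟩ := Metric.nhds_basis_closedBall.mem_iff.1 hO'
  have hG := (H j).isHarmonicGraphFamily hF hc
  have hbt : Metric.ball (c q) r ⊆ c.target :=
    Metric.ball_subset_closedBall.trans (hrO.trans inter_subset_left)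
  have hconst := hG.eq_of_ae_eq_zero (a := leafDeriv c h)
    (fun y hy t _ ↦ leafDeriv_boxGraph hF.1 H j hy t) hr
    (hrO.trans fun y hy ↦ ⟨hy.1, hy.2.1⟩) (by
      filter_upwards [ae_mono (Measure.restrict_mono (prod_mono hbt le_rfl) le_rfl) (hae j),
        ae_restrict_mem (Metric.isOpen_ball.measurableSet.prod measurableSet_Ico)] with p hp hpm
      have h1 := hrO (Metric.ball_subset_closedBall hpm.1)
      have h2 := (mul_eq_zero.1 hp).resolve_left h1.2.2.ne'
      rw [← hcdef, leafEnergy_eq hF H hc h1.1] at h2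
      by_contra h3
      exact (chartForm_pos hc h1.1 h3).ne' h2)
  -- The box is based at `j`, not at `q`; `t` is the label over `j` of the leaf through `(q, s)`.
  obtain ⟨t, ht⟩ := (H j).surjective hqU s
  refine ⟨c.source ∩ c ⁻¹' Metric.ball (c q) r, c.isOpen_inter_preimage Metric.isOpen_ball,
    ⟨hqc, Metric.mem_ball_self hr⟩, ?_⟩
  have hsub : ∀ q' ∈ c.source ∩ c ⁻¹' Metric.ball (c q) r, q' ∈ U j ∧ h j q' t = s := by
    intro q' hq'
    have h1 := hrO (Metric.ball_subset_closedBall hq'.2)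
    have h2 := h1.2.1
    rw [c.left_inv hq'.1] at h2
    refine ⟨h2, ?_⟩
    have h3 := hconst t t.2 (c q') hq'.2
    rw [boxGraph, boxGraph, c.left_inv hq'.1, c.left_inv hqc, projIcc_val, ht] at h3
    exact Subtype.ext h3
  exact (((H j).leafContinuousOn t).mono fun q' hq' ↦ (hsub q' hq').1).congr
    fun q' hq' ↦ by rw [(hsub q' hq').2]
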